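/- Let $q\ge 2$ and $\mathcal Q=\mathbb Z/q\mathbb Z$. A three-user memoryless multiple-access/degraded-broadcast two-way channel has inputs $X_1,X_2,X_3\in\mathcal Q$, outputs $Y_1,Y_2\in\mathcal Q$ and $Y_3$ in a finite alphabet $\mathcal Y_3$. In each use $Y_3$ has conditional law $P_{Y_3|X_1,X_2,X_3}$ given the inputs, and (modulo $q$) $Y_1=X_1+X_3+Z_1$, $Y_2=X_2+X_3+Z_1+Z_2$, where $Z_1\sim P_{Z_1}$ and $Z_2\sim P_{Z_2}$ are independent of each other, of the inputs and of the randomness of $Y_3$; different channel uses are independent given the inputs. Codes and capacity. Users 1 and 2 send messages $M_{13}$ and $M_{23}$ to user 3; user 3 sends $M_{31}$ to user 1 and $M_{32}$ to user 2. The messages are independent and uniform on sets $\{1,\dots,2^{nR_{13}}\}$, $\{1,\dots,2^{nR_{23}}\}$, $\{1,\dots,2^{nR_{31}}\}$, $\{1,\dots,2^{nR_{32}}\}$ (the positive integers that do not exceed the stated number). In a code of length $n$ the $i$-th input of each user is a function of its own message(s) and its own outputs $1,\dots,i-1$, and after time $n$ each user decodes the message(s) intended for it from its own message(s) and its $n$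 outputs. A quadruple $(R_{13},R_{23},R_{31},R_{32})$ of nonnegative rates is achievable if there are such codes for every $n$ whose probability that some message is decoded wrongly tends to $0$. The capacity region $\mathcal C$ is the closure of the convex hull of the set of achievable quadruples. Bounds. For a distribution $P=P_{X_1,X_2,X_3,V}$ on $\mathcal Q^3\times\mathcal V$ with $|\mathcal V|\le q+1$, let $\mathcal R(P)$ be the set of nonnegative quadruples with $$R_{13}\le I(X_1;Y_3|X_2,X_3),\quad R_{23}\le I(X_2;Y_3|X_1,X_3),\quad R_{13}+R_{23}\le I(X_1,X_2;Y_3|X_3),$$ $$R_{31}\le I(X_3;X_3+Z_1|V),\quad R_{32}\le I(V;X_3+Z_1+Z_2),$$ evaluated in bits under $P_{X_1,X_2,X_3,V}\,P_{Y_3|X_1,X_2,X_3}\,P_{Z_1}P_{Z_2}$. Write $\overline{\mathrm{co}}$ for the closure of the convex hull, and put $$\mathcal C_I=\overline{\mathrm{co}}\bigcup_{P_{X_1},P_{X_2},P_{V,X_3}}\mathcal R(P_{X_1}P_{X_2}P_{V,X_3}),\qquad \mathcal C_O=\overline{\mathrm{co}}\bigcup_{P_{X_1,X_2,X_3,V}}\mathcal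 R(P_{X_1,X_2,X_3,V}).$$ Theorem. For $a,b\in\mathcal Q$ let $\tau_{a,b}$ be the transposition of $\mathcal Q$ that swaps $a$ and $b$. Suppose that (i) for all $a,b\in\mathcal Q$ there is a permutation $\pi$ of $\mathcal Y_3$ such that $P_{Y_3|X_1,X_2,X_3}(y_3|x_1,x_2,x_3)=P_{Y_3|X_1,X_2,X_3}(\pi(y_3)|\tau_{a,b}(x_1),x_2,x_3)$ for all $x_1,x_2,x_3,y_3$; and (ii) for all $a,b\in\mathcal Q$ there is a permutation $\pi$ of $\mathcal Y_3$ such that $P_{Y_3|X_1,X_2,X_3}(y_3|x_1,x_2,x_3)=P_{Y_3|X_1,X_2,X_3}(\pi(y_3)|x_1,\tau_{a,b}(x_2),x_3)$ for all $x_1,x_2,x_3,y_3$. Then the inner and outer bounds coincide and give the capacity region, $\mathcal C=\mathcal C_I=\mathcal C_O$, and $$\mathcal C=\overline{\mathrm{co}}\bigcup_{P_{V,X_3}}\mathcal R\big(P^{\mathrm U}\cdot P^{\mathrm U}\cdot P_{V,X_3}\big),$$ where $P^{\mathrm U}$ is the uniform distribution on $\mathcal Q$ (used for $X_1$ and for $X_2$)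 and the union is over all distributions $P_{V,X_3}$ with $|\mathcal V|\le q+1$. -/

import Mathlib

open scoped BigOperators Topology

noncomputable section

namespace MADB

section Information

variable {Ω α β γ : Type*} [Fintype Ω] [Fintype α] [Fintype β] [Fintype γ]

open Classical in
/-- The law of the random variable `X` on the finite probability space `(Ω, P)`:
`law P X a = Pr(X = a)`. -/
def law (P : Ω → ℝ) (X : Ω → α) (a : α) : ℝ :=
  ∑ ω : Ω, if X ω = a then P ω else 0

/-- Mutual information `I(X; Y)` in bits of two random variables on the finite probability space
`(Ω, P)`. Terms with `Pr(X = a, Y = b) = 0` vanish. -/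
def mutualInfo (P : Ω → ℝ) (X : Ω → α) (Y : Ω → β) : ℝ :=
  ∑ a : α, ∑ b : β,
    law P (fun ω => (X ω, Y ω)) (a, b) *
      Real.logb 2 (law P (fun ω => (X ω, Y ω)) (a, b) / (law P X a * law P Y b))

/-- Conditional mutual information `I(X; Y | Z)` in bits of random variables on the finite
probability space `(Ω, P)`: the sum over `(a, b, c)` of
`p(a, b, c) log₂ (p(a, b, c) p(c) / (p(a, c) p(b, c)))`.
Terms with `p(a, b, c) = 0` vanish. -/
def condMutualInfo (P : Ω → ℝ) (X : Ω → α) (Y : Ω → β) (Z : Ω → γ) : ℝ :=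
  ∑ a : α, ∑ b : β, ∑ c : γ,
    law P (fun ω => (X ω, Y ω, Z ω)) (a, b, c) *
      Real.logb 2 (law P (fun ω => (X ω, Y ω, Z ω)) (a, b, c) * law P Z c /
        (law P (fun ω => (X ω, Z ω)) (a, c) * law P (fun ω => (Y ω, Z ω)) (b, c)))

end Information

/-- A rate quadruple `(R₁₃, R₂₃, R₃₁, R₃₂)`. -/
abbrev Rates : Type := ℝ × ℝ × ℝ × ℝ

/-! ### The rate region of an input distribution -/

/-- Joint values `(x₁, x₂, x₃, v, y₃, z₁, z₂)`. -/
abbrev Outcome (q : ℕ) (V Y : Type*) : Type _ :=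
  ZMod q × ZMod q × ZMod q × V × Y × ZMod q × ZMod q

namespace Outcome

variable {q : ℕ} {V Y : Type*}

/-- The input `X₁`. -/
def X₁ (ω : Outcome q V Y) : ZMod q := ω.1

/-- The input `X₂`. -/
def X₂ (ω : Outcome q V Y) : ZMod q := ω.2.1

/-- The input `X₃`. -/
def X₃ (ω : Outcome q V Y) : ZMod q := ω.2.2.1

/-- The auxiliary variable `V`. -/
def aux (ω : Outcome q V Y) : V := ω.2.2.2.1

/-- The output `Y₃`. -/
def Y₃ (ω : Outcome q V Y) : Y := ω.2.2.2.2.1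

/-- The noise `Z₁`. -/
def Z₁ (ω : Outcome q V Y) : ZMod q := ω.2.2.2.2.2.1

/-- The noise `Z₂`. -/
def Z₂ (ω : Outcome q V Y) : ZMod q := ω.2.2.2.2.2.2

end Outcome

section Regions

variable {q : ℕ} [NeZero q] {Y : Type*} [Fintype Y]

open Outcome in
/-- The joint distribution `P_{X₁,X₂,X₃,V} · P_{Y₃|X₁,X₂,X₃} · P_{Z₁} · P_{Z₂}`, where
`W x₁ x₂ x₃ y₃` is the transition probability of the multiple-access direction. -/
def jointDist {V : Type*} (p : ZMod q × ZMod q × ZMod q × V → ℝ)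
    (W : ZMod q → ZMod q → ZMod q → Y → ℝ) (pZ₁ pZ₂ : ZMod q → ℝ) (ω : Outcome q V Y) : ℝ :=
  p (X₁ ω, X₂ ω, X₃ ω, aux ω) * W (X₁ ω) (X₂ ω) (X₃ ω) (Y₃ ω) * pZ₁ (Z₁ ω) * pZ₂ (Z₂ ω)

open Outcome in
/-- The set of (nonnegative) rate quadruples permitted by the input distribution `p` of
`(X₁, X₂, X₃, V)`. -/
def rateRegion {V : Type*} [Fintype V] (p : ZMod q × ZMod q × ZMod q × V → ℝ)
    (W : ZMod q → ZMod q → ZMod q → Y → ℝ) (pZ₁ pZ₂ : ZMod q → ℝ) : Set Rates :=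
  {(R₁₃, R₂₃, R₃₁, R₃₂) : Rates |
    (0 ≤ R₁₃ ∧ 0 ≤ R₂₃ ∧ 0 ≤ R₃₁ ∧ 0 ≤ R₃₂) ∧
    R₁₃ ≤ condMutualInfo (jointDist p W pZ₁ pZ₂) X₁ Y₃ (fun ω => (X₂ ω, X₃ ω)) ∧
    R₂₃ ≤ condMutualInfo (jointDist p W pZ₁ pZ₂) X₂ Y₃ (fun ω => (X₁ ω, X₃ ω)) ∧
    R₁₃ + R₂₃ ≤ condMutualInfo (jointDist p W pZ₁ pZ₂) (fun ω => (X₁ ω, X₂ ω)) Y₃ X₃ ∧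
    R₃₁ ≤ condMutualInfo (jointDist p W pZ₁ pZ₂) X₃ (fun ω => X₃ ω + Z₁ ω) aux ∧
    R₃₂ ≤ mutualInfo (jointDist p W pZ₁ pZ₂) aux (fun ω => X₃ ω + Z₁ ω + Z₂ ω)}

/-- The input distribution `P_{X₁} · P_{X₂} · P_{V,X₃}`. -/
def prodInput {V : Type*} (p₁ p₂ : ZMod q → ℝ) (r : V × ZMod q → ℝ) :
    ZMod q × ZMod q × ZMod q × V → ℝ :=
  fun (x₁, x₂, x₃, v) => p₁ x₁ * p₂ x₂ * r (v, x₃)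

/-- The uniform distribution on the input alphabet. -/
def unif (q : ℕ) : ZMod q → ℝ := fun _ => 1 / (q : ℝ)

/-- The inner bound: closed convex hull of the union of the rate regions over all
`P_{X₁} · P_{X₂} · P_{V,X₃}`, where `V` has at most `q + 1` values. -/
def innerBound (W : ZMod q → ZMod q → ZMod q → Y → ℝ) (pZ₁ pZ₂ : ZMod q → ℝ) : Set Rates :=
  closure (convexHull ℝ {R : Rates | ∃ k ≤ q + 1,
    ∃ p₁ ∈ stdSimplex ℝ (ZMod q), ∃ p₂ ∈ stdSimplex ℝ (ZMod q),
    ∃ r ∈ stdSimplex ℝ (Fin k × ZMod q), R ∈ rateRegion (prodInput p₁ p₂ r) W pZ₁ pZ₂})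

/-- The outer bound: closed convex hull of the union of the rate regions over all
`P_{X₁,X₂,X₃,V}`, where `V` has at most `q + 1` values. -/
def outerBound (W : ZMod q → ZMod q → ZMod q → Y → ℝ) (pZ₁ pZ₂ : ZMod q → ℝ) : Set Rates :=
  closure (convexHull ℝ {R : Rates | ∃ k ≤ q + 1,
    ∃ p ∈ stdSimplex ℝ (ZMod q × ZMod q × ZMod q × Fin k), R ∈ rateRegion p W pZ₁ pZ₂})

/-- Closed convex hull of the union of the rate regions over all `P^U · P^U · P_{V,X₃}`, with
uniform inputs of users 1 and 2, where `V` has at most `q + 1` values. -/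
def uniformInputRegion (W : ZMod q → ZMod q → ZMod q → Y → ℝ) (pZ₁ pZ₂ : ZMod q → ℝ) :
    Set Rates :=
  closure (convexHull ℝ {R : Rates | ∃ k ≤ q + 1,
    ∃ r ∈ stdSimplex ℝ (Fin k × ZMod q), R ∈ rateRegion (prodInput (unif q) (unif q) r) W pZ₁ pZ₂})

end Regions

/-! ### Codes, achievability and the capacity region -/

/-- A code of length `n` for the three-user channel with message sets of sizes
`k₁₃, k₂₃, k₃₁, k₃₂`. The encoder of each user produces its `i`-th input from its own message(s)
and its own past outputs, indexed by `Fin i`. -/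
structure Code (q : ℕ) (Y : Type*) (n k₁₃ k₂₃ k₃₁ k₃₂ : ℕ) where
  /-- encoder of user 1 -/
  f₁ : (i : Fin n) → Fin k₁₃ → (Fin i → ZMod q) → ZMod q
  /-- encoder of user 2 -/
  f₂ : (i : Fin n) → Fin k₂₃ → (Fin i → ZMod q) → ZMod q
  /-- encoder of user 3 -/
  f₃ : (i : Fin n) → Fin k₃₁ → Fin k₃₂ → (Fin i → Y) → ZMod q
  /-- decoder of user 1, for the message from 3 to 1 -/
  g₁ : Fin k₁₃ → (Fin n → ZMod q) → Fin k₃₁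
  /-- decoder of user 2, for the message from 3 to 2 -/
  g₂ : Fin k₂₃ → (Fin n → ZMod q) → Fin k₃₂
  /-- decoder of user 3, for the messages from 1 to 3 and from 2 to 3 -/
  g₃ : Fin k₃₁ → Fin k₃₂ → (Fin n → Y) → Fin k₁₃ × Fin k₂₃

/-- The outputs observed strictly before time `i`. -/
def past {n : ℕ} {α : Type*} (y : Fin n → α) (i : Fin n) : Fin i → α :=
  fun j => y (Fin.castLE i.isLt.le j)

section Capacity

variable {q : ℕ} [NeZero q] {Y : Type*} [Fintype Y]

/-- The one-step transition probability `P(y₁, y₂, y₃ | x₁, x₂, x₃)` of the channel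
`Y₁ = X₁ + X₃ + Z₁`, `Y₂ = X₂ + X₃ + Z₁ + Z₂` (modulo `q`), `Y₃ ∼ W(· | X₁, X₂, X₃)`, where
`Z₁`, `Z₂` and the randomness of `Y₃` are independent. -/
def channel (W : ZMod q → ZMod q → ZMod q → Y → ℝ) (pZ₁ pZ₂ : ZMod q → ℝ)
    (x₁ x₂ x₃ y₁ y₂ : ZMod q) (y₃ : Y) : ℝ :=
  W x₁ x₂ x₃ y₃ * pZ₁ (y₁ - x₁ - x₃) * pZ₂ (y₂ - x₂ - y₁ + x₁)

/-- The probability that the outputs over `n` uses of the memoryless channel are `y₁, y₂, y₃` when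
the messages `m₁₃, m₂₃, m₃₁, m₃₂` are sent with the code `c`. -/
def Code.outputProb {n k₁₃ k₂₃ k₃₁ k₃₂ : ℕ} (c : Code q Y n k₁₃ k₂₃ k₃₁ k₃₂)
    (W : ZMod q → ZMod q → ZMod q → Y → ℝ) (pZ₁ pZ₂ : ZMod q → ℝ)
    (m₁₃ : Fin k₁₃) (m₂₃ : Fin k₂₃) (m₃₁ : Fin k₃₁) (m₃₂ : Fin k₃₂)
    (y₁ y₂ : Fin n → ZMod q) (y₃ : Fin n → Y) : ℝ :=
  ∏ i : Fin n, channel W pZ₁ pZ₂ (c.f₁ i m₁₃ (past y₁ i)) (c.f₂ i m₂₃ (past y₂ i))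
    (c.f₃ i m₃₁ m₃₂ (past y₃ i)) (y₁ i) (y₂ i) (y₃ i)

/-- The probability of decoding error of the code `c`, with independent messages that are uniformly
distributed over their alphabets: an error occurs when at least one message is decoded wrongly. -/
def Code.errorProb {n k₁₃ k₂₃ k₃₁ k₃₂ : ℕ} (c : Code q Y n k₁₃ k₂₃ k₃₁ k₃₂)
    (W : ZMod q → ZMod q → ZMod q → Y → ℝ) (pZ₁ pZ₂ : ZMod q → ℝ) : ℝ :=
  (1 / ((k₁₃ : ℝ) * k₂₃ * k₃₁ * k₃₂)) *
    ∑ m₁₃ : Fin k₁₃, ∑ m₂₃ : Fin k₂₃, ∑ m₃₁ : Fin k₃₁, ∑ m₃₂ : Fin k₃₂,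
      ∑ y₁ : Fin n → ZMod q, ∑ y₂ : Fin n → ZMod q, ∑ y₃ : Fin n → Y,
        if (c.g₃ m₃₁ m₃₂ y₃).1 ≠ m₁₃ ∨ (c.g₃ m₃₁ m₃₂ y₃).2 ≠ m₂₃ ∨
            c.g₁ m₁₃ y₁ ≠ m₃₁ ∨ c.g₂ m₂₃ y₂ ≠ m₃₂ then
          c.outputProb W pZ₁ pZ₂ m₁₃ m₂₃ m₃₁ m₃₂ y₁ y₂ y₃
        else 0

/-- The number of messages at rate `R` and length `n`, i.e. the number of positive integers
that are at most `2 ^ (n R)`. -/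
def messageCount (n : ℕ) (R : ℝ) : ℕ := ⌊(2 : ℝ) ^ ((n : ℝ) * R)⌋₊

/-- A quadruple of nonnegative rates is achievable if there is a sequence of codes with these rates,
one for each length `n`, whose probability of decoding error tends to `0`. -/
def IsAchievable (W : ZMod q → ZMod q → ZMod q → Y → ℝ) (pZ₁ pZ₂ : ZMod q → ℝ) :
    Rates → Prop :=
  fun (R₁₃, R₂₃, R₃₁, R₃₂) =>
    (0 ≤ R₁₃ ∧ 0 ≤ R₂₃ ∧ 0 ≤ R₃₁ ∧ 0 ≤ R₃₂) ∧
    ∃ c : (n : ℕ) → Code q Y n (messageCount n R₁₃) (messageCount n R₂₃)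
        (messageCount n R₃₁) (messageCount n R₃₂),
      Filter.Tendsto (fun n => (c n).errorProb W pZ₁ pZ₂) Filter.atTop (𝓝 0)

/-- The capacity region: the closure of the convex hull of all achievable rate quadruples. -/
def capacityRegion (W : ZMod q → ZMod q → ZMod q → Y → ℝ) (pZ₁ pZ₂ : ZMod q → ℝ) : Set Rates :=
  closure (convexHull ℝ {R : Rates | IsAchievable W pZ₁ pZ₂ R})

end Capacity

end MADB

end

set_option linter.unusedSectionVars false

open scoped BigOperators Topology

noncomputable section

namespace MADB

/-! ### Laws of random variables on a finite space -/

section Law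

variable {Ω α β γ δ : Type*} [Fintype Ω] [Fintype α] [Fintype β] [Fintype γ] [Fintype δ]
  {P : Ω → ℝ}

/-! Symmetry makes uniform inputs optimal for users 1 and 2, whatever user 3 does. Transpositions
generate all permutations, so the alphabets of X₁, of X₂ and of (X₁, X₂) are permuted transitively
by relabelings that merely permute Y₃. Hence H(Y₃ | X₁, X₂, X₃ = x₃) is a function `noiseEnt` of x₃
alone, and the cross entropy of Y₃ against its law under a uniform input is the same for every input
letter (`IsSymmetricChannel.cross_eq`). Conditional entropy never exceeds cross entropy, so under
every joint law H(Y₃ | X₂, X₃) is at most the mean of `outEnt₁ W X₃`, with equality for independent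
uniform X₁ and X₂; the other two multiple-access terms behave alike. The broadcast terms see only
the law of (V, X₃). Replacing (X₁, X₂) by independent uniform letters therefore relaxes every bound
(`rateRegion_subset_unif`), and outer ⊆ uniform ⊆ inner ⊆ outer.

Converse (`mem_uniformInputRegion_of_isAchievable`). Fano's inequality bounds the rates by the
information that outputs carry about messages, and this information grows by one increment per
channel use. For R₁₃, user 3 is also given the outputs of user 2 and all other messages: X₂ and X₃
become functions of the conditioning, Y₂ then reveals only Z₁ + Z₂, and this cancels. R₂₃ uses Y₁ in
the same way, and the sum rate needs Y₃ alone. For the broadcast direction, V consists of M₁₃, M₂₃,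
M₃₂ and the past of Y₁ and Y₂. Adaptive encoding makes the inputs dependent, but by symmetry every
increment is bounded through the law of X₃ and the two entropies H(X₃ + Z₁ | V) and H(X₃ + Z₁ + Z₂ |
V). Such triples form the convex set `bcHull`, on which the bounds are concave, so averaging over
time stands in for a time-sharing variable. The alphabet of V shrinks to q + 1 letters by a
linear-programming argument (`exists_small_support`).

Achievability (`isAchievable_smul`). Random codes without feedback suffice: independent codewords
for users 1 and 2, superposition coding for user 3, and receivers 1 and 2 that subtract their own
input. Decoding is by thresholds on information densities. The true messages rarely fail (Chebyshev,
`tendsto_failProb`); a wrong message passes with probability at most 2^(-nt) (change of measure,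
`sum_passesTest_le`). Degradedness lets user 1 decode the cloud center as well
(`condMutualInfo_aux_le`). -/

theorem sum_law_mul (P : Ω → ℝ) (X : Ω → α) (F : α → ℝ) :
    ∑ a, law P X a * F a = ∑ ω, P ω * F (X ω) := by
  classical
  simp only [law, Finset.sum_mul]
  rw [Finset.sum_comm]
  refine Finset.sum_congr rfl fun ω _ => ?_
  rw [Finset.sum_eq_single (X ω)]
  · simp
  · intro b _ hb
    simp [Ne.symm hb]
  · simp

theorem sum_law (P : Ω → ℝ) (X : Ω → α) : ∑ a, law P X a = ∑ ω, P ω := by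
  simpa using sum_law_mul P X fun _ => 1

theorem law_nonneg (hP : ∀ ω, 0 ≤ P ω) (X : Ω → α) (a : α) : 0 ≤ law P X a := by
  classical
  exact Finset.sum_nonneg fun ω _ => by split_ifs <;> simp [hP]

theorem law_mem_stdSimplex (hP : P ∈ stdSimplex ℝ Ω) (X : Ω → α) :
    law P X ∈ stdSimplex ℝ α :=
  ⟨law_nonneg hP.1 X, by rw [sum_law, hP.2]⟩

open Classical in
theorem law_eq_sum_mul (P : Ω → ℝ) (X : Ω → α) (a : α) :
    law P X a = ∑ ω, P ω * (if X ω = a then 1 else 0) := by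
  simp [law]

theorem law_comp (P : Ω → ℝ) (X : Ω → α) (f : α → β) :
    law P (fun ω => f (X ω)) = law (law P X) f := by
  classical
  funext b
  rw [law_eq_sum_mul, law_eq_sum_mul (law P X), sum_law_mul P X fun a => if f a = b then 1 else 0]

theorem law_eq_sum_snd (P : Ω → ℝ) (X : Ω → α) (Y : Ω → β) (a : α) :
    law P X a = ∑ b, law P (fun ω => (X ω, Y ω)) (a, b) := by
  classical
  simp only [law]
  rw [Finset.sum_comm]
  refine Finset.sum_congr rfl fun ω _ => ?_
  rw [Finset.sum_eq_single (Y ω)] <;> simp +contextual [eq_comm]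

theorem le_law_self (hP : ∀ ω, 0 ≤ P ω) (X : Ω → α) (ω : Ω) : P ω ≤ law P X (X ω) := by
  classical
  have := Finset.single_le_sum (f := fun ω' => if X ω' = X ω then P ω' else 0)
    (fun ω' _ => by split_ifs <;> simp [hP]) (Finset.mem_univ ω)
  simpa [law] using this

theorem law_self_pos (hP : ∀ ω, 0 ≤ P ω) (X : Ω → α) {ω : Ω} (h : P ω ≠ 0) :
    0 < law P X (X ω) :=
  ((hP ω).lt_of_ne' h).trans_le (le_law_self hP X ω)

theorem law_comp_le (hP : ∀ ω, 0 ≤ P ω) (X : Ω → α) (f : α → β) (a : α) :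
    law P X a ≤ law P (fun ω => f (X ω)) (f a) := by
  rw [law_comp P X f]
  exact le_law_self (law_nonneg hP X) f a

theorem law_equiv (P : Ω → ℝ) (e : Ω ≃ α) (a : α) : law P e a = P (e.symm a) := by
  classical
  simp only [law]
  rw [Finset.sum_eq_single (e.symm a)]
  · simp
  · intro b _ hb
    rw [if_neg]
    rintro rfl
    simp at hb
  · simp

theorem law_id (P : Ω → ℝ) : law P (fun ω => ω) = P :=
  funext fun a => law_equiv P (Equiv.refl Ω) a

/-- A random variable `(A, B)` where `B` has conditional law `κ (A)`: to identify the kernel it is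
enough to test it against functions. -/
theorem law_prod_eq_of_forall {A : Ω → α} {B : Ω → β} {κ : α → β → ℝ}
    (h : ∀ F : α → β → ℝ, ∑ ω, P ω * F (A ω) (B ω) = ∑ ω, P ω * ∑ b, κ (A ω) b * F (A ω) b)
    (a : α) (b : β) : law P (fun ω => (A ω, B ω)) (a, b) = law P A a * κ a b := by
  classical
  have := h fun a' b' => (if a' = a then 1 else 0) * if b' = b then 1 else 0
  rw [law_eq_sum_mul, law_eq_sum_mul, Finset.sum_mul]
  convert this using 2 with ω _ ω _
  · by_cases h1 : A ω = a <;> by_cases h2 : B ω = b <;> simp [h1, h2]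
  · by_cases h1 : A ω = a <;> simp [h1]

end Law

/-! ### Entropy -/

section Entropy

variable {Ω α β γ δ : Type*} [Fintype Ω] [Fintype α] [Fintype β] [Fintype γ] [Fintype δ]
  {P : Ω → ℝ}

/-- Entropy, in bits, of a finite mass function. -/
def entropy (f : α → ℝ) : ℝ := -∑ a, f a * Real.logb 2 (f a)

/-- Entropy, in bits, of the random variable `X` on the finite space `(Ω, P)`. -/
def ent (P : Ω → ℝ) (X : Ω → α) : ℝ := entropy (law P X)

/-- Conditional entropy `H(B | C)` in bits. -/
def condEnt (P : Ω → ℝ) (B : Ω → β) (C : Ω → γ) : ℝ := ent P (fun ω => (C ω, B ω)) - ent P C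

theorem ent_eq_sum (P : Ω → ℝ) (X : Ω → α) :
    ent P X = -∑ ω, P ω * Real.logb 2 (law P X (X ω)) := by
  rw [ent, entropy, sum_law_mul P X fun a => Real.logb 2 (law P X a)]

theorem ent_comp_le (hP : ∀ ω, 0 ≤ P ω) (X : Ω → α) (f : α → β) :
    ent P (fun ω => f (X ω)) ≤ ent P X := by
  rw [ent_eq_sum, ent_eq_sum]
  refine neg_le_neg (Finset.sum_le_sum fun ω _ => ?_)
  by_cases h : P ω = 0
  · simp [h]
  refine mul_le_mul_of_nonneg_left ?_ (hP ω)
  exact Real.logb_le_logb_of_le one_lt_two (law_self_pos hP X h) (law_comp_le hP X f (X ω))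

theorem ent_mono (hP : ∀ ω, 0 ≤ P ω) {X : Ω → α} {Y : Ω → β} (f : α → β)
    (h : ∀ ω, Y ω = f (X ω)) : ent P Y ≤ ent P X := by
  obtain rfl : Y = fun ω => f (X ω) := funext h
  exact ent_comp_le hP X f

theorem ent_congr (hP : ∀ ω, 0 ≤ P ω) {X : Ω → α} {Y : Ω → β} (f : α → β) (g : β → α)
    (h : ∀ ω, Y ω = f (X ω)) (h' : ∀ ω, X ω = g (Y ω)) : ent P X = ent P Y :=
  le_antisymm (ent_mono hP g h') (ent_mono hP f h)

theorem condEnt_congr (hP : ∀ ω, 0 ≤ P ω) {B : Ω → β} {B' : Ω → δ} (C : Ω → γ)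
    (f : γ → β → δ) (g : γ → δ → β) (h : ∀ ω, B' ω = f (C ω) (B ω))
    (h' : ∀ ω, B ω = g (C ω) (B' ω)) : condEnt P B C = condEnt P B' C := by
  rw [condEnt, condEnt, ent_congr hP (X := fun ω => (C ω, B ω)) (Y := fun ω => (C ω, B' ω))
    (fun x => (x.1, f x.1 x.2)) (fun x => (x.1, g x.1 x.2))]
  · intro ω; simp [h]
  · intro ω; simp [← h']

/-- Conditional entropy is at most the cross entropy with any conditional (sub-)distribution. -/
theorem condEnt_le_cross (hP : P ∈ stdSimplex ℝ Ω) (B : Ω → β) (C : Ω → γ) (Q : γ → β → ℝ)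
    (hQ : ∀ c b, 0 ≤ Q c b) (hQ1 : ∀ c, ∑ b, Q c b ≤ 1)
    (hpos : ∀ ω, P ω ≠ 0 → Q (C ω) (B ω) ≠ 0) :
    condEnt P B C ≤ -∑ ω, P ω * Real.logb 2 (Q (C ω) (B ω)) := by
  rw [condEnt, ent_eq_sum, ent_eq_sum]
  set p : γ × β → ℝ := law P fun ω => (C ω, B ω) with hp
  set r : γ → ℝ := law P C with hr
  -- Gibbs' inequality: log x ≤ x - 1 at x = Q r / p, after which the masses Q r sum to at most 1.
  have key : ∑ ω, P ω * (Real.logb 2 (Q (C ω) (B ω)) + Real.logb 2 (r (C ω)) -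
      Real.logb 2 (p (C ω, B ω))) ≤ 0 := by
    have h1 : ∀ ω, P ω * (Real.logb 2 (Q (C ω) (B ω)) + Real.logb 2 (r (C ω)) -
      Real.logb 2 (p (C ω, B ω))) ≤
        P ω * ((Q (C ω) (B ω) * r (C ω) / p (C ω, B ω) - 1) / Real.log 2) := by
      intro ω
      by_cases h : P ω = 0
      · simp [h]
      have hq : 0 < Q (C ω) (B ω) := (hQ _ _).lt_of_ne' (hpos ω h)
      have h2 : 0 < r (C ω) := law_self_pos hP.1 C h
      have h3 : 0 < p (C ω, B ω) := law_self_pos hP.1 (fun ω => (C ω, B ω)) h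
      refine mul_le_mul_of_nonneg_left ?_ (hP.1 ω)
      rw [← Real.logb_mul hq.ne' h2.ne', ← Real.logb_div (mul_pos hq h2).ne' h3.ne', Real.logb]
      exact div_le_div_of_nonneg_right (Real.log_le_sub_one_of_pos (by positivity))
        (Real.log_nonneg one_le_two)
    refine (Finset.sum_le_sum fun ω _ => h1 ω).trans ?_
    have h4 : ∑ ω, P ω * ((Q (C ω) (B ω) * r (C ω) / p (C ω, B ω) - 1) / Real.log 2) =
        (∑ ω, P ω * (Q (C ω) (B ω) * r (C ω) / p (C ω, B ω)) - ∑ ω, P ω) / Real.log 2 := by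
      rw [← Finset.sum_sub_distrib, Finset.sum_div]
      exact Finset.sum_congr rfl fun ω _ => by ring
    rw [h4]
    refine div_nonpos_of_nonpos_of_nonneg ?_ (Real.log_nonneg one_le_two)
    rw [← sum_law_mul P (fun ω => (C ω, B ω)) fun x => Q x.1 x.2 * r x.1 / p x, sub_nonpos, hP.2]
    calc ∑ x, p x * (Q x.1 x.2 * r x.1 / p x) ≤ ∑ x : γ × β, Q x.1 x.2 * r x.1 := by
          refine Finset.sum_le_sum fun x _ => ?_
          have hx : 0 ≤ Q x.1 x.2 * r x.1 := mul_nonneg (hQ _ _) (law_nonneg hP.1 _ _)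
          by_cases h : p x = 0
          · simpa [h] using hx
          · rw [mul_div_cancel₀ _ h]
      _ = ∑ c, (∑ b, Q c b) * r c := by
          rw [Fintype.sum_prod_type]
          exact Finset.sum_congr rfl fun c _ => by rw [Finset.sum_mul]
      _ ≤ ∑ c, 1 * r c := Finset.sum_le_sum fun c _ =>
          mul_le_mul_of_nonneg_right (hQ1 c) (law_nonneg hP.1 _ _)
      _ = 1 := by simp [hr, sum_law, hP.2]
  simp only [mul_sub, mul_add, Finset.sum_sub_distrib, Finset.sum_add_distrib] at key
  linarith

/-- Conditioning reduces entropy. -/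
theorem condEnt_le_of_comp (hP : P ∈ stdSimplex ℝ Ω) (B : Ω → β) {C : Ω → γ} {C' : Ω → δ}
    (f : γ → δ) (h : ∀ ω, C' ω = f (C ω)) : condEnt P B C ≤ condEnt P B C' := by
  obtain rfl : C' = fun ω => f (C ω) := funext h
  set p : δ × β → ℝ := law P fun ω => (f (C ω), B ω) with hp
  set r : δ → ℝ := law P (fun ω => f (C ω)) with hr
  have hp0 : ∀ x, 0 ≤ p x := law_nonneg hP.1 _
  have hr0 : ∀ x, 0 ≤ r x := law_nonneg hP.1 _
  have hrp : ∀ d, r d = ∑ b, p (d, b) := fun d => law_eq_sum_snd P _ B d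
  -- The comparison kernel is the conditional law of B given f(C). Where r vanishes it is 0 / 0 = 0,
  -- which is why a sub-distribution has to be allowed.
  refine (condEnt_le_cross hP B C (fun c b => p (f c, b) / r (f c))
    (fun c b => div_nonneg (hp0 _) (hr0 _)) (fun c => ?_) (fun ω h => ?_)).trans (le_of_eq ?_)
  · rw [← Finset.sum_div, ← hrp]
    exact div_self_le_one _
  · exact (div_pos (law_self_pos hP.1 (fun ω => (f (C ω), B ω)) h)
      (law_self_pos hP.1 (fun ω => f (C ω)) h)).ne'
  · rw [condEnt, ent_eq_sum, ent_eq_sum, neg_sub_neg, ← Finset.sum_sub_distrib,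
      ← Finset.sum_neg_distrib]
    refine Finset.sum_congr rfl fun ω _ => ?_
    by_cases h : P ω = 0
    · simp [h]
    rw [Real.logb_div (law_self_pos hP.1 (fun ω => (f (C ω), B ω)) h).ne'
      (law_self_pos hP.1 (fun ω => f (C ω)) h).ne']
    ring

theorem condEnt_le_ent (hP : P ∈ stdSimplex ℝ Ω) (B : Ω → β) (C : Ω → γ) :
    condEnt P B C ≤ ent P B := by
  have h := condEnt_le_of_comp hP B (C := C) (C' := fun _ => ()) (fun _ => ()) fun _ => rfl
  refine h.trans (le_of_eq ?_)
  have h0 : ent P (fun _ : Ω => ()) = 0 := by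
    rw [ent_eq_sum]
    simp [law, hP.2]
  rw [condEnt, h0, sub_zero]
  exact ent_congr hP.1 Prod.snd (fun b => ((), b)) (fun _ => rfl) fun _ => rfl

/-- All exact evaluations below go through this: once a kernel is recognized, a conditional entropy
is an average of explicit entropies. -/
theorem condEnt_eq_of_kernel {A : Ω → α} {B : Ω → β} {κ : α → β → ℝ}
    (hκ : ∀ a, ∑ b, κ a b = 1)
    (h : ∀ a b, law P (fun ω => (A ω, B ω)) (a, b) = law P A a * κ a b) :
    condEnt P B A = ∑ ω, P ω * entropy (κ (A ω)) := by
  rw [← sum_law_mul P A fun a => entropy (κ a), condEnt, ent, ent, entropy, entropy,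
    Fintype.sum_prod_type, neg_sub_neg, ← Finset.sum_sub_distrib]
  refine Finset.sum_congr rfl fun a _ => ?_
  rw [entropy, mul_neg, Finset.mul_sum, sub_eq_iff_eq_add]
  have : law P A a * Real.logb 2 (law P A a) =
      ∑ b, law P A a * κ a b * Real.logb 2 (law P A a) := by
    rw [← Finset.sum_mul, ← Finset.mul_sum, hκ, mul_one]
  rw [this, neg_add_eq_sub, ← Finset.sum_sub_distrib]
  refine Finset.sum_congr rfl fun b _ => ?_
  rw [h]
  by_cases h1 : law P A a = 0
  · simp [h1]
  by_cases h2 : κ a b = 0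
  · simp [h2]
  rw [Real.logb_mul h1 h2]
  ring

theorem condEnt_nonneg (hP : ∀ ω, 0 ≤ P ω) (B : Ω → β) (C : Ω → γ) : 0 ≤ condEnt P B C :=
  sub_nonneg.2 (ent_mono hP Prod.fst fun _ => rfl)

theorem condMutualInfo_eq_sum (P : Ω → ℝ) (X : Ω → α) (Y : Ω → β) (Z : Ω → γ) :
    condMutualInfo P X Y Z = ∑ ω, P ω * Real.logb 2
      (law P (fun ω => (X ω, Y ω, Z ω)) (X ω, Y ω, Z ω) * law P Z (Z ω) /
        (law P (fun ω => (X ω, Z ω)) (X ω, Z ω) * law P (fun ω => (Y ω, Z ω)) (Y ω, Z ω))) := by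
  rw [← sum_law_mul P (fun ω => (X ω, Y ω, Z ω)) fun x => Real.logb 2
      (law P (fun ω => (X ω, Y ω, Z ω)) x * law P Z x.2.2 /
        (law P (fun ω => (X ω, Z ω)) (x.1, x.2.2) * law P (fun ω => (Y ω, Z ω)) x.2)),
    Fintype.sum_prod_type]
  simp only [Fintype.sum_prod_type]
  rfl

theorem condMutualInfo_eq_condEnt (hP : ∀ ω, 0 ≤ P ω) (X : Ω → α) (Y : Ω → β) (Z : Ω → γ) :
    condMutualInfo P X Y Z = condEnt P Y Z - condEnt P Y (fun ω => (X ω, Z ω)) := by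
  have h1 : ent P (fun ω => (Z ω, Y ω)) = ent P (fun ω => (Y ω, Z ω)) :=
    ent_congr hP Prod.swap Prod.swap (fun _ => rfl) fun _ => rfl
  have h2 : ent P (fun ω => ((X ω, Z ω), Y ω)) = ent P (fun ω => (X ω, Y ω, Z ω)) :=
    ent_congr hP (fun x => (x.1.1, x.2, x.1.2)) (fun x => ((x.1, x.2.2), x.2.1))
      (fun _ => rfl) fun _ => rfl
  rw [condEnt, condEnt, h1, h2, ent_eq_sum, ent_eq_sum, ent_eq_sum, ent_eq_sum,
    condMutualInfo_eq_sum, neg_sub_neg, neg_sub_neg, ← Finset.sum_sub_distrib,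
    ← Finset.sum_sub_distrib, ← Finset.sum_sub_distrib]
  refine Finset.sum_congr rfl fun ω _ => ?_
  by_cases h : P ω = 0
  · simp [h]
  have a1 := (law_self_pos hP (fun ω => (X ω, Y ω, Z ω)) h).ne'
  have a2 := (law_self_pos hP (fun ω => (X ω, Z ω)) h).ne'
  have a3 := (law_self_pos hP (fun ω => (Y ω, Z ω)) h).ne'
  have a4 := (law_self_pos hP Z h).ne'
  rw [Real.logb_div (mul_ne_zero a1 a4) (mul_ne_zero a2 a3), Real.logb_mul a1 a4,
    Real.logb_mul a2 a3]
  ring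

theorem condMutualInfo_nonneg (hP : P ∈ stdSimplex ℝ Ω) (X : Ω → α) (Y : Ω → β) (Z : Ω → γ) :
    0 ≤ condMutualInfo P X Y Z := by
  rw [condMutualInfo_eq_condEnt hP.1, sub_nonneg]
  exact condEnt_le_of_comp hP Y Prod.snd fun _ => rfl

theorem condMutualInfo_law (P : Ω → ℝ) {σ : Type*} [Fintype σ] (T : Ω → σ) (X : σ → α)
    (Y : σ → β) (Z : σ → γ) :
    condMutualInfo (law P T) X Y Z =
      condMutualInfo P (fun ω => X (T ω)) (fun ω => Y (T ω)) (fun ω => Z (T ω)) := by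
  simp only [condMutualInfo]
  rw [← law_comp P T (fun ω => (X ω, Y ω, Z ω)), ← law_comp P T Z,
    ← law_comp P T (fun ω => (X ω, Z ω)), ← law_comp P T (fun ω => (Y ω, Z ω))]

theorem law_comp_injective (P : Ω → ℝ) (X : Ω → α) {f : α → β} (hf : Function.Injective f)
    (a : α) : law P (fun ω => f (X ω)) (f a) = law P X a := by
  refine Finset.sum_congr rfl fun ω _ => ?_
  by_cases h : X ω = a
  · rw [if_pos h, if_pos (congrArg f h)]
  · rw [if_neg h, if_neg (hf.ne h)]

theorem law_prod_unit (P : Ω → ℝ) (X : Ω → α) (a : α) (u : Unit) :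
    law P (fun ω => (X ω, ())) (a, u) = law P X a := by
  exact law_comp_injective P X (f := fun a => (a, ())) (fun _ _ h => congrArg Prod.fst h) a

theorem mutualInfo_eq_condMutualInfo (hP : P ∈ stdSimplex ℝ Ω) (X : Ω → α) (Y : Ω → β) :
    mutualInfo P X Y = condMutualInfo P X Y fun _ => () := by
  simp only [mutualInfo, condMutualInfo, Finset.univ_unique, Finset.sum_singleton]
  refine Finset.sum_congr rfl fun a _ => Finset.sum_congr rfl fun b _ => ?_
  have h1 : law P (fun ω => (X ω, Y ω, ())) (a, b, default) =
      law P (fun ω => (X ω, Y ω)) (a, b) :=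
    law_comp_injective P (fun ω => (X ω, Y ω)) (f := fun x => (x.1, x.2, ()))
      (fun _ _ h => by simpa [Prod.ext_iff] using h) (a, b)
  have h2 : law P (fun _ : Ω => ()) default = 1 := by simp [law, hP.2]
  rw [h1, h2, law_prod_unit, law_prod_unit, mul_one]

theorem mutualInfo_eq_ent (hP : P ∈ stdSimplex ℝ Ω) (X : Ω → α) (Y : Ω → β) :
    mutualInfo P X Y = ent P Y - condEnt P Y X := by
  rw [mutualInfo_eq_condMutualInfo hP, condMutualInfo_eq_condEnt hP.1]
  have h0 : ent P (fun _ : Ω => ()) = 0 := by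
    rw [ent_eq_sum]
    simp [law, hP.2]
  have h1 : ent P (fun ω => ((), Y ω)) = ent P Y :=
    ent_congr hP.1 Prod.snd (fun b => ((), b)) (fun _ => rfl) fun _ => rfl
  have h2 : ent P (fun ω => (X ω, ())) = ent P X :=
    ent_congr hP.1 Prod.fst (fun b => (b, ())) (fun _ => rfl) fun _ => rfl
  have h3 : ent P (fun ω => ((X ω, ()), Y ω)) = ent P (fun ω => (X ω, Y ω)) :=
    ent_congr hP.1 (fun x => (x.1.1, x.2)) (fun x => ((x.1, ()), x.2)) (fun _ => rfl) fun _ => rfl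
  simp only [condEnt, h0, h1, h2, h3, sub_zero]

/-- Fano's inequality. -/
theorem condEnt_le_fano (hP : P ∈ stdSimplex ℝ Ω) [Nonempty β] (B : Ω → β) (C : Ω → γ)
    (g : γ → β) (err : ℝ)
    (herr : (open Classical in ∑ ω, if g (C ω) ≠ B ω then P ω else 0) ≤ err) :
    condEnt P B C ≤ 1 + err * Real.logb 2 (Fintype.card β) := by
  classical
  have hM : (1 : ℝ) ≤ Fintype.card β := by exact_mod_cast Fintype.card_pos
  have hM0 : (0 : ℝ) < Fintype.card β := by linarith
  -- The comparison puts weight 1/2 on the guess g c and spreads the other half evenly: a correct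
  -- guess costs one bit, a wrong one log₂ of the alphabet size more.
  refine (condEnt_le_cross hP B C
    (fun c b => if g c = b then 1 / 2 else 1 / 2 * (1 / Fintype.card β)) (fun c b => ?_)
    (fun c => ?_) (fun ω _ => ?_)).trans ?_
  · split_ifs <;> positivity
  · calc ∑ b, (if g c = b then 1 / 2 else 1 / 2 * (1 / (Fintype.card β : ℝ)))
        ≤ ∑ b, ((if g c = b then 1 / 2 else 0) + 1 / 2 * (1 / (Fintype.card β : ℝ))) := by
          refine Finset.sum_le_sum fun b _ => ?_
          split_ifs
          · simp
          · simp
      _ = 1 := by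
          rw [Finset.sum_add_distrib]
          simp
          field_simp
          norm_num
  · split_ifs <;> positivity
  · have h1 : ∀ ω, -(P ω * Real.logb 2 (if g (C ω) = B ω then 1 / 2 else
        1 / 2 * (1 / (Fintype.card β : ℝ)))) =
        P ω + (if g (C ω) ≠ B ω then P ω else 0) * Real.logb 2 (Fintype.card β) := by
      intro ω
      have h2 : Real.logb 2 (1 / 2) = -1 := by
        rw [one_div, Real.logb_inv, Real.logb_self_eq_one one_lt_two]
      by_cases h : g (C ω) = B ω
      · simp only [h, if_true, h2, ne_eq, not_true_eq_false, if_false]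
        ring
      · simp only [h, if_false, ne_eq, not_false_eq_true, if_true]
        rw [Real.logb_mul (by norm_num) (by positivity), h2, one_div, Real.logb_inv]
        ring
    rw [← Finset.sum_neg_distrib, Finset.sum_congr rfl fun ω _ => h1 ω, Finset.sum_add_distrib,
      hP.2, ← Finset.sum_mul]
    gcongr
    exact Real.logb_nonneg one_lt_two hM

theorem entropy_equiv (f : α → ℝ) (e : β ≃ α) : entropy (fun b => f (e b)) = entropy f := by
  rw [entropy, entropy, Equiv.sum_comp e fun a => f a * Real.logb 2 (f a)]

theorem concaveOn_entropy : ConcaveOn ℝ {f : α → ℝ | ∀ a, 0 ≤ f a} entropy := by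
  refine ⟨fun f hf g hg s t hs ht _ a => ?_, fun f hf g hg s t hs ht hst => ?_⟩
  · exact add_nonneg (mul_nonneg hs (hf a)) (mul_nonneg ht (hg a))
  · have hlog : 0 < Real.log 2 := Real.log_pos one_lt_two
    have e : ∀ f : α → ℝ, entropy f = ∑ a, Real.negMulLog (f a) / Real.log 2 := by
      intro f
      rw [entropy, ← Finset.sum_neg_distrib]
      refine Finset.sum_congr rfl fun a _ => ?_
      rw [Real.logb, Real.negMulLog]
      ring
    rw [e, e, e, smul_eq_mul, smul_eq_mul, Finset.mul_sum, Finset.mul_sum,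
      ← Finset.sum_add_distrib]
    refine Finset.sum_le_sum fun a _ => ?_
    have := Real.concaveOn_negMulLog.2 (hf a) (hg a) hs ht hst
    simp only [smul_eq_mul] at this
    simp only [Pi.add_apply, Pi.smul_apply, smul_eq_mul]
    rw [mul_div_assoc', mul_div_assoc', ← add_div]
    exact div_le_div_of_nonneg_right this hlog.le

end Entropy

/-! ### Comparison of laws; kernels on the support; chain rule. -/

section LawExt

variable {Ω Ω' α β γ δ : Type*} [Fintype Ω] [Fintype Ω'] [Fintype α] [Fintype β] [Fintype γ]
  [Fintype δ] {P : Ω → ℝ}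

theorem law_eq_of_forall {P' : Ω' → ℝ} {X : Ω → α} {X' : Ω' → α}
    (h : ∀ F : α → ℝ, ∑ ω, P ω * F (X ω) = ∑ ω, P' ω * F (X' ω)) : law P X = law P' X' := by
  classical
  funext a
  rw [law_eq_sum_mul, law_eq_sum_mul]
  convert h fun x => if x = a then 1 else 0

/-- Tested against the indicator of the zero set of κ, the kernel identity shows that this set
carries no mass. This supplies the support condition of `condEnt_le_cross`. -/
theorem kernel_ne_zero (hP : ∀ ω, 0 ≤ P ω) {A : Ω → α} {B : Ω → β} {κ : α → β → ℝ}
    (h : ∀ F : α → β → ℝ, ∑ ω, P ω * F (A ω) (B ω) = ∑ ω, P ω * ∑ b, κ (A ω) b * F (A ω) b)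
    {ω : Ω} (hω : P ω ≠ 0) : κ (A ω) (B ω) ≠ 0 := by
  classical
  intro h0
  have h1 := h fun a b => if κ a b = 0 then 1 else 0
  have h2 : ∀ ω, ∑ b, κ (A ω) b * (if κ (A ω) b = 0 then 1 else 0) = 0 :=
    fun ω => Finset.sum_eq_zero fun b _ => by split_ifs with hb <;> simp [hb]
  simp only [h2, mul_zero, Finset.sum_const_zero] at h1
  have h3 := (Finset.sum_eq_zero_iff_of_nonneg fun ω _ =>
    mul_nonneg (hP ω) (by split_ifs <;> simp)).1 h1 ω (Finset.mem_univ ω)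
  simp [h0, hω] at h3

theorem condEnt_prod (hP : ∀ ω, 0 ≤ P ω) (B : Ω → β) (D : Ω → δ) (C : Ω → γ) :
    condEnt P (fun ω => (B ω, D ω)) C = condEnt P B C + condEnt P D (fun ω => (C ω, B ω)) := by
  have : ent P (fun ω => (C ω, B ω, D ω)) = ent P (fun ω => ((C ω, B ω), D ω)) :=
    ent_congr hP (fun x => ((x.1, x.2.1), x.2.2)) (fun x => (x.1.1, x.1.2, x.2))
      (fun _ => rfl) fun _ => rfl
  rw [condEnt, condEnt, condEnt, this]
  ring

end LawExt

/-! ### Symmetric channels -/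

section Symmetric

variable {A Y : Type*} [Fintype A] [Fintype Y] {K : A → Y → ℝ}

/-- The output law of the channel `K` for the uniform input. -/
def average (K : A → Y → ℝ) (y : Y) : ℝ := (∑ a, K a y) / Fintype.card A

theorem average_mem_stdSimplex [Nonempty A] (hK : ∀ a, K a ∈ stdSimplex ℝ Y) :
    average K ∈ stdSimplex ℝ Y := by
  refine ⟨fun y => div_nonneg (Finset.sum_nonneg fun a _ => (hK a).1 y) (Nat.cast_nonneg _), ?_⟩
  simp only [average]
  rw [← Finset.sum_div, Finset.sum_comm, Finset.sum_congr rfl fun a _ => (hK a).2]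
  simp

theorem average_ne_zero (hK : ∀ a, K a ∈ stdSimplex ℝ Y) {a : A} {y : Y} (h : K a y ≠ 0) :
    average K y ≠ 0 := by
  have h1 : 0 < K a y := ((hK a).1 y).lt_of_ne' h
  have h2 : 0 < ∑ a, K a y := h1.trans_le
    (Finset.single_le_sum (f := fun a => K a y) (fun a _ => (hK a).1 y) (Finset.mem_univ a))
  have : Nonempty A := ⟨a⟩
  exact (div_pos h2 (by exact_mod_cast Fintype.card_pos)).ne'

/-- A channel whose input letters are permuted transitively by symmetries. -/
def IsSymmetricChannel (K : A → Y → ℝ) : Prop :=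
  ∀ a b, ∃ (σ : Equiv.Perm A) (π : Equiv.Perm Y), σ a = b ∧ ∀ x y, K x y = K (σ x) (π y)

theorem IsSymmetricChannel.entropy_eq (h : IsSymmetricChannel K) (a b : A) :
    entropy (K a) = entropy (K b) := by
  obtain ⟨σ, π, rfl, hσ⟩ := h a b
  rw [← entropy_equiv (K (σ a)) π]
  exact congrArg entropy (funext fun y => hσ a y)

theorem average_perm {σ : Equiv.Perm A} {π : Equiv.Perm Y} (h : ∀ x y, K x y = K (σ x) (π y))
    (y : Y) : average K (π y) = average K y := by
  rw [average, average, ← Equiv.sum_comp σ fun a => K a (π y)]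
  exact congrArg (· / _) (Finset.sum_congr rfl fun a _ => (h a y).symm)

/-- The symmetries preserve the average output law, so all input letters have the same cross entropy
against it. The mean of these equal numbers over the input letters is the entropy of the average law
up to sign, hence so is each of them. -/
theorem IsSymmetricChannel.cross_eq (h : IsSymmetricChannel K) (a : A) :
    ∑ y, K a y * Real.logb 2 (average K y) = -entropy (average K) := by
  have h1 : ∀ b, ∑ y, K b y * Real.logb 2 (average K y) =
      ∑ y, K a y * Real.logb 2 (average K y) := by
    intro b
    obtain ⟨σ, π, rfl, hσ⟩ := h a b
    rw [← Equiv.sum_comp π]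
    exact Finset.sum_congr rfl fun y _ => by rw [average_perm hσ, ← hσ]
  have : Nonempty A := ⟨a⟩
  have hc : (Fintype.card A : ℝ) ≠ 0 := by exact_mod_cast Fintype.card_ne_zero
  rw [entropy, neg_neg]
  have h2 : ∑ y, average K y * Real.logb 2 (average K y) =
      (∑ b, ∑ y, K b y * Real.logb 2 (average K y)) / Fintype.card A := by
    rw [Finset.sum_comm, Finset.sum_div]
    refine Finset.sum_congr rfl fun y _ => ?_
    rw [← Finset.sum_mul]
    nth_rw 1 [average]
    ring
  rw [h2, Finset.sum_congr rfl fun b _ => h1 b]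
  simp [hc]

end Symmetric

/-! ### The symmetric multiple-access channel -/

section Mac

variable {q : ℕ} [NeZero q] {Y : Type*} [Fintype Y] {W : ZMod q → ZMod q → ZMod q → Y → ℝ}

/-- The symmetry conditions, for all permutations of the two input alphabets. -/
structure IsSymmetricMac (W : ZMod q → ZMod q → ZMod q → Y → ℝ) : Prop where
  mem : ∀ x₁ x₂ x₃, W x₁ x₂ x₃ ∈ stdSimplex ℝ Y
  fst : ∀ σ : Equiv.Perm (ZMod q), ∃ π : Equiv.Perm Y, ∀ x₁ x₂ x₃ y,
    W x₁ x₂ x₃ y = W (σ x₁) x₂ x₃ (π y)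
  snd : ∀ σ : Equiv.Perm (ZMod q), ∃ π : Equiv.Perm Y, ∀ x₁ x₂ x₃ y,
    W x₁ x₂ x₃ y = W x₁ (σ x₂) x₃ (π y)

/-- Transpositions generate the symmetric group, and the output permutations compose along with
them. -/
theorem isSymmetricMac_of_swap (hW : ∀ x₁ x₂ x₃, W x₁ x₂ x₃ ∈ stdSimplex ℝ Y)
    (h₁ : ∀ a b : ZMod q, ∃ π : Equiv.Perm Y, ∀ x₁ x₂ x₃ y,
      W x₁ x₂ x₃ y = W (Equiv.swap a b x₁) x₂ x₃ (π y))
    (h₂ : ∀ a b : ZMod q, ∃ π : Equiv.Perm Y, ∀ x₁ x₂ x₃ y,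
      W x₁ x₂ x₃ y = W x₁ (Equiv.swap a b x₂) x₃ (π y)) : IsSymmetricMac W := by
  refine ⟨hW, fun σ => ?_, fun σ => ?_⟩
  · induction σ using Equiv.Perm.swap_induction_on with
    | one => exact ⟨1, fun _ _ _ _ => rfl⟩
    | swap_mul f a b _ ih =>
      obtain ⟨π, hπ⟩ := ih
      obtain ⟨π', hπ'⟩ := h₁ a b
      exact ⟨π' * π, fun x₁ x₂ x₃ y => by rw [hπ, hπ']; rfl⟩
  · induction σ using Equiv.Perm.swap_induction_on with
    | one => exact ⟨1, fun _ _ _ _ => rfl⟩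
    | swap_mul f a b _ ih =>
      obtain ⟨π, hπ⟩ := ih
      obtain ⟨π', hπ'⟩ := h₂ a b
      exact ⟨π' * π, fun x₁ x₂ x₃ y => by rw [hπ, hπ']; rfl⟩

/-- Output entropy of `Y₃` given all inputs. -/
def noiseEnt (W : ZMod q → ZMod q → ZMod q → Y → ℝ) (x₃ : ZMod q) : ℝ := entropy (W 0 0 x₃)

/-- Output entropy of `Y₃` for uniform `X₁`. -/
def outEnt₁ (W : ZMod q → ZMod q → ZMod q → Y → ℝ) (x₃ : ZMod q) : ℝ :=
  entropy (average fun x₁ => W x₁ 0 x₃)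

/-- Output entropy of `Y₃` for uniform `X₂`. -/
def outEnt₂ (W : ZMod q → ZMod q → ZMod q → Y → ℝ) (x₃ : ZMod q) : ℝ :=
  entropy (average fun x₂ => W 0 x₂ x₃)

/-- Output entropy of `Y₃` for uniform `(X₁, X₂)`. -/
def outEnt₁₂ (W : ZMod q → ZMod q → ZMod q → Y → ℝ) (x₃ : ZMod q) : ℝ :=
  entropy (average fun x : ZMod q × ZMod q => W x.1 x.2 x₃)

namespace IsSymmetricMac

variable (hW : IsSymmetricMac W)
include hW

theorem symm₁ (x₂ x₃ : ZMod q) : IsSymmetricChannel fun x₁ => W x₁ x₂ x₃ := fun a b => by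
  obtain ⟨π, hπ⟩ := hW.fst (Equiv.swap a b)
  exact ⟨_, π, Equiv.swap_apply_left a b, fun x y => hπ x x₂ x₃ y⟩

theorem symm₂ (x₁ x₃ : ZMod q) : IsSymmetricChannel fun x₂ => W x₁ x₂ x₃ := fun a b => by
  obtain ⟨π, hπ⟩ := hW.snd (Equiv.swap a b)
  exact ⟨_, π, Equiv.swap_apply_left a b, fun x y => hπ x₁ x x₃ y⟩

theorem symm₁₂ (x₃ : ZMod q) :
    IsSymmetricChannel fun x : ZMod q × ZMod q => W x.1 x.2 x₃ := fun a b => by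
  obtain ⟨π, hπ⟩ := hW.fst (Equiv.swap a.1 b.1)
  obtain ⟨π', hπ'⟩ := hW.snd (Equiv.swap a.2 b.2)
  refine ⟨(Equiv.swap a.1 b.1).prodCongr (Equiv.swap a.2 b.2), π.trans π', ?_, fun x y => ?_⟩
  · ext <;> simp
  · simp [hπ x.1, hπ' _ x.2]

theorem entropy_eq (x₁ x₂ x₃ : ZMod q) : entropy (W x₁ x₂ x₃) = noiseEnt W x₃ :=
  ((hW.symm₁ x₂ x₃).entropy_eq x₁ 0).trans ((hW.symm₂ 0 x₃).entropy_eq x₂ 0)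

/-- Moving x₂ to the reference letter 0 permutes the output letters by a π that does not depend on
x₁, so the averaged law is only relabeled. -/
theorem average₁_eq (x₂ x₃ : ZMod q) :
    entropy (average fun x₁ => W x₁ x₂ x₃) = outEnt₁ W x₃ := by
  obtain ⟨π, hπ⟩ := hW.snd (Equiv.swap x₂ 0)
  rw [outEnt₁, ← entropy_equiv (average fun x₁ => W x₁ 0 x₃) π]
  refine congrArg entropy (funext fun y => ?_)
  rw [average, average]
  exact congrArg (· / _) (Finset.sum_congr rfl fun x₁ _ => by rw [hπ, Equiv.swap_apply_left])

theorem average₂_eq (x₁ x₃ : ZMod q) :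
    entropy (average fun x₂ => W x₁ x₂ x₃) = outEnt₂ W x₃ := by
  obtain ⟨π, hπ⟩ := hW.fst (Equiv.swap x₁ 0)
  rw [outEnt₂, ← entropy_equiv (average fun x₂ => W 0 x₂ x₃) π]
  refine congrArg entropy (funext fun y => ?_)
  rw [average, average]
  exact congrArg (· / _) (Finset.sum_congr rfl fun x₁ _ => by rw [hπ, Equiv.swap_apply_left])

end IsSymmetricMac

/-- `Y` is the output of the channel `W` with inputs `X₁, X₂, X₃`. -/
def IsOutput {Ω : Type*} [Fintype Ω] (P : Ω → ℝ) (W : ZMod q → ZMod q → ZMod q → Y → ℝ)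
    (X : Ω → ZMod q × ZMod q × ZMod q) (B : Ω → Y) : Prop :=
  ∀ F : ZMod q × ZMod q × ZMod q → Y → ℝ, ∑ ω, P ω * F (X ω) (B ω) =
    ∑ ω, P ω * ∑ y, W (X ω).1 (X ω).2.1 (X ω).2.2 y * F (X ω) y

section Output

variable {Ω γ : Type*} [Fintype Ω] [Fintype γ] {P : Ω → ℝ} {X : Ω → ZMod q × ZMod q × ZMod q}
  {B : Ω → Y}

theorem IsOutput.cross_eq (h : IsOutput P W X B) {Q : ZMod q × ZMod q × ZMod q → Y → ℝ}
    {e : ZMod q → ℝ}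
    (hQ : ∀ x, ∑ y, W x.1 x.2.1 x.2.2 y * Real.logb 2 (Q x y) = -e x.2.2) :
    -∑ ω, P ω * Real.logb 2 (Q (X ω) (B ω)) = ∑ ω, P ω * e (X ω).2.2 := by
  rw [h fun x y => Real.logb 2 (Q x y), ← Finset.sum_neg_distrib]
  exact Finset.sum_congr rfl fun ω _ => by rw [hQ, mul_neg, neg_neg]

theorem IsOutput.ne_zero (h : IsOutput P W X B) (hP : P ∈ stdSimplex ℝ Ω) {ω : Ω}
    (hω : P ω ≠ 0) : W (X ω).1 (X ω).2.1 (X ω).2.2 (B ω) ≠ 0 :=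
  kernel_ne_zero (A := X) (κ := fun x : ZMod q × ZMod q × ZMod q => W x.1 x.2.1 x.2.2) hP.1 h hω

variable (hW : IsSymmetricMac W) (hP : P ∈ stdSimplex ℝ Ω)
include hW hP

/-- Compare with the output law for uniform X₁. By symmetry the cross entropy does not depend on the
actual X₁, so no independence is needed: C may be any observation that determines X₂ and X₃, as
happens with feedback. -/
theorem IsOutput.condEnt_le₁ (h : IsOutput P W X B) {C : Ω → γ} (x₂ x₃ : γ → ZMod q)
    (h₂ : ∀ ω, (X ω).2.1 = x₂ (C ω)) (h₃ : ∀ ω, (X ω).2.2 = x₃ (C ω)) :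
    condEnt P B C ≤ ∑ ω, P ω * outEnt₁ W (X ω).2.2 := by
  have hm := fun c : γ => average_mem_stdSimplex fun x₁ => hW.mem x₁ (x₂ c) (x₃ c)
  refine (condEnt_le_cross hP B C (fun c => average fun x₁ => W x₁ (x₂ c) (x₃ c))
    (fun c => (hm c).1) (fun c => (hm c).2.le) fun ω hω => ?_).trans ?_
  · rw [← h₂, ← h₃]
    exact average_ne_zero (K := fun x₁ => W x₁ (X ω).2.1 (X ω).2.2)
      (fun x₁ => hW.mem x₁ _ _) (h.ne_zero hP hω)
  · simp only [← h₂, ← h₃]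
    refine (h.cross_eq (Q := fun x => average fun x₁ => W x₁ x.2.1 x.2.2) fun x => ?_).le
    rw [← hW.average₁_eq x.2.1]
    exact (hW.symm₁ x.2.1 x.2.2).cross_eq x.1

theorem IsOutput.condEnt_le₂ (h : IsOutput P W X B) {C : Ω → γ} (x₁ x₃ : γ → ZMod q)
    (h₁ : ∀ ω, (X ω).1 = x₁ (C ω)) (h₃ : ∀ ω, (X ω).2.2 = x₃ (C ω)) :
    condEnt P B C ≤ ∑ ω, P ω * outEnt₂ W (X ω).2.2 := by
  have hm := fun c : γ => average_mem_stdSimplex fun x₂ => hW.mem (x₁ c) x₂ (x₃ c)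
  refine (condEnt_le_cross hP B C (fun c => average fun x₂ => W (x₁ c) x₂ (x₃ c))
    (fun c => (hm c).1) (fun c => (hm c).2.le) fun ω hω => ?_).trans ?_
  · rw [← h₁, ← h₃]
    exact average_ne_zero (K := fun x₂ => W (X ω).1 x₂ (X ω).2.2)
      (fun x₂ => hW.mem _ x₂ _) (h.ne_zero hP hω)
  · simp only [← h₁, ← h₃]
    refine (h.cross_eq (Q := fun x => average fun x₂ => W x.1 x₂ x.2.2) fun x => ?_).le
    rw [← hW.average₂_eq x.1]
    exact (hW.symm₂ x.1 x.2.2).cross_eq x.2.1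

theorem IsOutput.condEnt_le₁₂ (h : IsOutput P W X B) {C : Ω → γ} (x₃ : γ → ZMod q)
    (h₃ : ∀ ω, (X ω).2.2 = x₃ (C ω)) :
    condEnt P B C ≤ ∑ ω, P ω * outEnt₁₂ W (X ω).2.2 := by
  have hm := fun c : γ => average_mem_stdSimplex
    fun x : ZMod q × ZMod q => hW.mem x.1 x.2 (x₃ c)
  refine (condEnt_le_cross hP B C (fun c => average fun x : ZMod q × ZMod q => W x.1 x.2 (x₃ c))
    (fun c => (hm c).1) (fun c => (hm c).2.le) fun ω hω => ?_).trans ?_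
  · rw [← h₃]
    exact average_ne_zero (K := fun x : ZMod q × ZMod q => W x.1 x.2 (X ω).2.2)
      (a := ((X ω).1, (X ω).2.1)) (fun x => hW.mem _ _ _) (h.ne_zero hP hω)
  · simp only [← h₃]
    refine (h.cross_eq
      (Q := fun x => average fun x' : ZMod q × ZMod q => W x'.1 x'.2 x.2.2) fun x => ?_).le
    exact (hW.symm₁₂ x.2.2).cross_eq (x.1, x.2.1)

/-- Given all the inputs (and anything on which the output depends only through the inputs), the
output has entropy `noiseEnt`. -/
theorem IsOutput.condEnt_eq {C : Ω → γ} (x : γ → ZMod q × ZMod q × ZMod q)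
    (hX : ∀ ω, X ω = x (C ω))
    (h : ∀ F : γ → Y → ℝ, ∑ ω, P ω * F (C ω) (B ω) =
      ∑ ω, P ω * ∑ y, W (X ω).1 (X ω).2.1 (X ω).2.2 y * F (C ω) y) :
    condEnt P B C = ∑ ω, P ω * noiseEnt W (X ω).2.2 := by
  rw [condEnt_eq_of_kernel (κ := fun c => W (x c).1 (x c).2.1 (x c).2.2)
    (fun c => (hW.mem _ _ _).2)]
  · simp only [hX, hW.entropy_eq]
  · refine law_prod_eq_of_forall fun F => ?_
    simp only [h F, hX]

end Output

end Mac

/-! ### Additive noise -/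

section Conv

variable {q : ℕ} [NeZero q]

/-- The law of `X + Z` for independent `X ∼ f` and `Z ∼ g`. -/
def conv (f g : ZMod q → ℝ) (s : ZMod q) : ℝ := ∑ x, f x * g (s - x)

theorem sum_conv_mul (f g F : ZMod q → ℝ) :
    ∑ s, conv f g s * F s = ∑ x, f x * ∑ z, g z * F (x + z) := by
  simp only [conv, Finset.sum_mul]
  rw [Finset.sum_comm]
  refine Finset.sum_congr rfl fun x _ => ?_
  rw [← Equiv.sum_comp (Equiv.addLeft x), Finset.mul_sum]
  refine Finset.sum_congr rfl fun z _ => ?_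
  simp [mul_assoc]

theorem conv_mem_stdSimplex {f g : ZMod q → ℝ} (hf : f ∈ stdSimplex ℝ (ZMod q))
    (hg : g ∈ stdSimplex ℝ (ZMod q)) : conv f g ∈ stdSimplex ℝ (ZMod q) := by
  refine ⟨fun s => Finset.sum_nonneg fun x _ => mul_nonneg (hf.1 _) (hg.1 _), ?_⟩
  simpa [hf.2, hg.2] using sum_conv_mul f g fun _ => 1

theorem law_add_eq {Ω : Type*} [Fintype Ω] {P : Ω → ℝ} {X Z : Ω → ZMod q} {g : ZMod q → ℝ}
    (h : ∀ F : ZMod q → ZMod q → ℝ, ∑ ω, P ω * F (X ω) (Z ω) =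
      ∑ ω, P ω * ∑ z, g z * F (X ω) z) :
    law P (fun ω => X ω + Z ω) = conv (law P X) g := by
  have : law P (fun ω => X ω + Z ω) = law (conv (law P X) g) fun s => s := by
    refine law_eq_of_forall fun F => ?_
    rw [sum_conv_mul, sum_law_mul P X fun x => ∑ z, g z * F (x + z)]
    exact h fun x z => F (x + z)
  rw [this, law_id]

end Conv

/-! ### The single-letter joint distribution -/

section JointDist

open Outcome

variable {q : ℕ} [NeZero q] {Y V : Type*} [Fintype Y] [Fintype V]
  {W : ZMod q → ZMod q → ZMod q → Y → ℝ} {pZ₁ pZ₂ : ZMod q → ℝ}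
  {p : ZMod q × ZMod q × ZMod q × V → ℝ}

theorem sum_jointDist_mul (p : ZMod q × ZMod q × ZMod q × V → ℝ)
    (W : ZMod q → ZMod q → ZMod q → Y → ℝ) (pZ₁ pZ₂ : ZMod q → ℝ) (F : Outcome q V Y → ℝ) :
    ∑ ω, jointDist p W pZ₁ pZ₂ ω * F ω = ∑ t : ZMod q × ZMod q × ZMod q × V, p t *
      ∑ y, W t.1 t.2.1 t.2.2.1 y * ∑ z₁, pZ₁ z₁ * ∑ z₂, pZ₂ z₂ *
        F (t.1, t.2.1, t.2.2.1, t.2.2.2, y, z₁, z₂) := by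
  simp only [Fintype.sum_prod_type, Finset.mul_sum, jointDist, X₁, X₂, X₃, aux, Y₃, Z₁, Z₂,
    mul_assoc]

theorem jointDist_mem_stdSimplex (hp : p ∈ stdSimplex ℝ _)
    (hW : ∀ x₁ x₂ x₃, W x₁ x₂ x₃ ∈ stdSimplex ℝ Y)
    (hZ₁ : pZ₁ ∈ stdSimplex ℝ (ZMod q)) (hZ₂ : pZ₂ ∈ stdSimplex ℝ (ZMod q)) :
    jointDist p W pZ₁ pZ₂ ∈ stdSimplex ℝ (Outcome q V Y) := by
  refine ⟨fun ω => mul_nonneg (mul_nonneg (mul_nonneg (hp.1 _) ((hW _ _ _).1 _)) (hZ₁.1 _))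
    (hZ₂.1 _), ?_⟩
  have := sum_jointDist_mul p W pZ₁ pZ₂ fun _ => 1
  simpa [hZ₁.2, hZ₂.2, (hW _ _ _).2, hp.2] using this

theorem prodInput_mem_stdSimplex {p₁ p₂ : ZMod q → ℝ} {r : V × ZMod q → ℝ}
    (h₁ : p₁ ∈ stdSimplex ℝ (ZMod q)) (h₂ : p₂ ∈ stdSimplex ℝ (ZMod q))
    (hr : r ∈ stdSimplex ℝ (V × ZMod q)) : prodInput p₁ p₂ r ∈ stdSimplex ℝ _ := by
  refine ⟨fun t => mul_nonneg (mul_nonneg (h₁.1 _) (h₂.1 _)) (hr.1 _), ?_⟩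
  simp only [prodInput, Fintype.sum_prod_type, mul_assoc, ← Finset.mul_sum]
  rw [← Finset.sum_mul, ← Finset.sum_mul, h₁.2, h₂.2, Finset.sum_comm,
    ← Fintype.sum_prod_type, hr.2]
  norm_num

theorem unif_mem_stdSimplex : unif q ∈ stdSimplex ℝ (ZMod q) := by
  refine ⟨fun x => by simp [unif], ?_⟩
  have : (q : ℝ) ≠ 0 := by exact_mod_cast NeZero.ne q
  simp [unif, ZMod.card, this]

section Facts

variable (hW : IsSymmetricMac W) (hZ₁ : pZ₁ ∈ stdSimplex ℝ (ZMod q))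
  (hZ₂ : pZ₂ ∈ stdSimplex ℝ (ZMod q))
include hW hZ₁ hZ₂

theorem sum_jointDist_Y₃ {γ : Type*} (C : ZMod q × ZMod q × ZMod q × V → γ) (F : γ → Y → ℝ) :
    ∑ ω, jointDist p W pZ₁ pZ₂ ω * F (C (X₁ ω, X₂ ω, X₃ ω, aux ω)) (Y₃ ω) =
    ∑ ω, jointDist p W pZ₁ pZ₂ ω * ∑ y, W (X₁ ω) (X₂ ω) (X₃ ω) y *
      F (C (X₁ ω, X₂ ω, X₃ ω, aux ω)) y := by
  rw [sum_jointDist_mul, sum_jointDist_mul]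
  refine Finset.sum_congr rfl fun t _ => ?_
  simp [X₁, X₂, X₃, aux, Y₃, ← Finset.sum_mul, hZ₁.2, hZ₂.2, (hW.mem _ _ _).2]

theorem isOutput_jointDist : IsOutput (jointDist p W pZ₁ pZ₂) W
    (fun ω => (X₁ ω, X₂ ω, X₃ ω)) Y₃ :=
  fun F => sum_jointDist_Y₃ hW hZ₁ hZ₂ (fun t => (t.1, t.2.1, t.2.2.1)) F

variable (hp : p ∈ stdSimplex ℝ (ZMod q × ZMod q × ZMod q × V))

theorem condEnt_jointDist_inputs : condEnt (jointDist p W pZ₁ pZ₂) Y₃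
    (fun ω => (X₁ ω, X₂ ω, X₃ ω)) = ∑ ω, jointDist p W pZ₁ pZ₂ ω * noiseEnt W (X₃ ω) := by
  rw [condEnt_eq_of_kernel (κ := fun x : ZMod q × ZMod q × ZMod q => W x.1 x.2.1 x.2.2)
    (fun x => (hW.mem _ _ _).2)]
  · simp only [hW.entropy_eq]
  · exact law_prod_eq_of_forall (isOutput_jointDist hW hZ₁ hZ₂)

include hp

theorem condMutualInfo₁_eq : condMutualInfo (jointDist p W pZ₁ pZ₂) X₁ Y₃
    (fun ω => (X₂ ω, X₃ ω)) = condEnt (jointDist p W pZ₁ pZ₂) Y₃ (fun ω => (X₂ ω, X₃ ω)) -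
      ∑ ω, jointDist p W pZ₁ pZ₂ ω * noiseEnt W (X₃ ω) := by
  rw [condMutualInfo_eq_condEnt (jointDist_mem_stdSimplex hp hW.mem hZ₁ hZ₂).1,
    condEnt_jointDist_inputs hW hZ₁ hZ₂]

theorem condMutualInfo₂_eq : condMutualInfo (jointDist p W pZ₁ pZ₂) X₂ Y₃
    (fun ω => (X₁ ω, X₃ ω)) = condEnt (jointDist p W pZ₁ pZ₂) Y₃ (fun ω => (X₁ ω, X₃ ω)) -
      ∑ ω, jointDist p W pZ₁ pZ₂ ω * noiseEnt W (X₃ ω) := by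
  have hP := jointDist_mem_stdSimplex hp hW.mem hZ₁ hZ₂
  rw [condMutualInfo_eq_condEnt hP.1, ← condEnt_jointDist_inputs hW hZ₁ hZ₂]
  congr 1
  refine le_antisymm ?_ ?_
  · exact condEnt_le_of_comp hP Y₃ (fun x => (x.2.1, x.1, x.2.2)) fun _ => rfl
  · exact condEnt_le_of_comp hP Y₃ (fun x => (x.2.1, x.1, x.2.2)) fun _ => rfl

theorem condMutualInfo₁₂_eq : condMutualInfo (jointDist p W pZ₁ pZ₂) (fun ω => (X₁ ω, X₂ ω)) Y₃
    X₃ = condEnt (jointDist p W pZ₁ pZ₂) Y₃ X₃ -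
      ∑ ω, jointDist p W pZ₁ pZ₂ ω * noiseEnt W (X₃ ω) := by
  have hP := jointDist_mem_stdSimplex hp hW.mem hZ₁ hZ₂
  rw [condMutualInfo_eq_condEnt hP.1, ← condEnt_jointDist_inputs hW hZ₁ hZ₂]
  congr 1
  refine le_antisymm ?_ ?_
  · exact condEnt_le_of_comp hP Y₃ (fun x => (x.1.1, x.1.2, x.2)) fun _ => rfl
  · exact condEnt_le_of_comp hP Y₃ (fun x => ((x.1, x.2.1), x.2.2)) fun _ => rfl

theorem condEnt_jointDist_le₁ : condEnt (jointDist p W pZ₁ pZ₂) Y₃ (fun ω => (X₂ ω, X₃ ω)) ≤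
    ∑ ω, jointDist p W pZ₁ pZ₂ ω * outEnt₁ W (X₃ ω) :=
  (isOutput_jointDist hW hZ₁ hZ₂).condEnt_le₁ hW (jointDist_mem_stdSimplex hp hW.mem hZ₁ hZ₂)
    Prod.fst Prod.snd (fun _ => rfl) fun _ => rfl

theorem condEnt_jointDist_le₂ : condEnt (jointDist p W pZ₁ pZ₂) Y₃ (fun ω => (X₁ ω, X₃ ω)) ≤
    ∑ ω, jointDist p W pZ₁ pZ₂ ω * outEnt₂ W (X₃ ω) :=
  (isOutput_jointDist hW hZ₁ hZ₂).condEnt_le₂ hW (jointDist_mem_stdSimplex hp hW.mem hZ₁ hZ₂)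
    Prod.fst Prod.snd (fun _ => rfl) fun _ => rfl

theorem condEnt_jointDist_le₁₂ : condEnt (jointDist p W pZ₁ pZ₂) Y₃ X₃ ≤
    ∑ ω, jointDist p W pZ₁ pZ₂ ω * outEnt₁₂ W (X₃ ω) :=
  (isOutput_jointDist hW hZ₁ hZ₂).condEnt_le₁₂ hW (jointDist_mem_stdSimplex hp hW.mem hZ₁ hZ₂)
    id fun _ => rfl

end Facts

section Uniform

variable (hW : IsSymmetricMac W) (hZ₁ : pZ₁ ∈ stdSimplex ℝ (ZMod q))
  (hZ₂ : pZ₂ ∈ stdSimplex ℝ (ZMod q)) {r : V × ZMod q → ℝ}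
include hW hZ₁ hZ₂

theorem sum_jointDist_unif (F : ZMod q → ZMod q → ZMod q → V → Y → ℝ) :
    ∑ ω, jointDist (prodInput (unif q) (unif q) r) W pZ₁ pZ₂ ω *
      F (X₁ ω) (X₂ ω) (X₃ ω) (aux ω) (Y₃ ω) =
    ∑ x₃, ∑ v, r (v, x₃) * ∑ x₁, ∑ x₂, ∑ y, W x₁ x₂ x₃ y / (q * q) * F x₁ x₂ x₃ v y := by
  rw [sum_jointDist_mul]
  simp only [X₁, X₂, X₃, aux, Y₃, ← Finset.sum_mul, hZ₁.2, hZ₂.2, one_mul]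
  simp only [Fintype.sum_prod_type, prodInput, unif]
  have e : ∀ G : ZMod q → ZMod q → ZMod q → V → ℝ, ∑ x₁, ∑ x₂, ∑ x₃, ∑ v, G x₁ x₂ x₃ v =
      ∑ x₃, ∑ v, ∑ x₁, ∑ x₂, G x₁ x₂ x₃ v := by
    intro G
    calc ∑ x₁, ∑ x₂, ∑ x₃, ∑ v, G x₁ x₂ x₃ v = ∑ x₁, ∑ x₃, ∑ v, ∑ x₂, G x₁ x₂ x₃ v := by
          refine Finset.sum_congr rfl fun x₁ _ => ?_
          rw [Finset.sum_comm]
          exact Finset.sum_congr rfl fun x₃ _ => Finset.sum_comm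
      _ = _ := by
          rw [Finset.sum_comm]
          exact Finset.sum_congr rfl fun x₃ _ => Finset.sum_comm
  rw [e]
  refine Finset.sum_congr rfl fun x₃ _ => Finset.sum_congr rfl fun v _ => ?_
  simp only [Finset.mul_sum]
  refine Finset.sum_congr rfl fun x₁ _ => Finset.sum_congr rfl fun x₂ _ =>
    Finset.sum_congr rfl fun y _ => ?_
  ring

/-- For uniform X₁ independent of (X₂, X₃), the kernel from (X₂, X₃) to Y₃ is exactly the averaged
channel, so the cross-entropy bound is attained. -/
theorem condEnt_unif₁ : condEnt (jointDist (prodInput (unif q) (unif q) r) W pZ₁ pZ₂) Y₃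
    (fun ω => (X₂ ω, X₃ ω)) =
      ∑ ω, jointDist (prodInput (unif q) (unif q) r) W pZ₁ pZ₂ ω * outEnt₁ W (X₃ ω) := by
  have hq : (q : ℝ) ≠ 0 := by exact_mod_cast NeZero.ne q
  rw [condEnt_eq_of_kernel (κ := fun x : ZMod q × ZMod q => average fun x₁ => W x₁ x.1 x.2)]
  · simp only [hW.average₁_eq]
  · exact fun x => (average_mem_stdSimplex fun x₁ => hW.mem _ _ _).2
  · refine law_prod_eq_of_forall fun F => ?_
    rw [sum_jointDist_unif hW hZ₁ hZ₂ fun _ x₂ x₃ _ y => F (x₂, x₃) y,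
      sum_jointDist_unif hW hZ₁ hZ₂ fun _ x₂ x₃ _ _ =>
        ∑ b, average (fun x₁ => W x₁ x₂ x₃) b * F (x₂, x₃) b]
    refine Finset.sum_congr rfl fun x₃ _ => Finset.sum_congr rfl fun v _ => ?_
    congr 1
    rw [Finset.sum_comm]
    conv_rhs => rw [Finset.sum_comm]
    refine Finset.sum_congr rfl fun x₂ _ => ?_
    simp only [← Finset.sum_mul, ← Finset.sum_div, (hW.mem _ _ _).2]
    rw [Finset.sum_comm, Finset.mul_sum]
    refine Finset.sum_congr rfl fun y _ => ?_
    rw [average, ← Finset.sum_mul, ← Finset.sum_div]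
    simp only [Finset.sum_const, Finset.card_univ, ZMod.card, nsmul_eq_mul]
    field_simp

theorem condEnt_unif₂ : condEnt (jointDist (prodInput (unif q) (unif q) r) W pZ₁ pZ₂) Y₃
    (fun ω => (X₁ ω, X₃ ω)) =
      ∑ ω, jointDist (prodInput (unif q) (unif q) r) W pZ₁ pZ₂ ω * outEnt₂ W (X₃ ω) := by
  have hq : (q : ℝ) ≠ 0 := by exact_mod_cast NeZero.ne q
  rw [condEnt_eq_of_kernel (κ := fun x : ZMod q × ZMod q => average fun x₂ => W x.1 x₂ x.2)]
  · simp only [hW.average₂_eq]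
  · exact fun x => (average_mem_stdSimplex fun x₂ => hW.mem _ _ _).2
  · refine law_prod_eq_of_forall fun F => ?_
    rw [sum_jointDist_unif hW hZ₁ hZ₂ fun x₁ _ x₃ _ y => F (x₁, x₃) y,
      sum_jointDist_unif hW hZ₁ hZ₂ fun x₁ _ x₃ _ _ =>
        ∑ b, average (fun x₂ => W x₁ x₂ x₃) b * F (x₁, x₃) b]
    refine Finset.sum_congr rfl fun x₃ _ => Finset.sum_congr rfl fun v _ => ?_
    congr 1
    refine Finset.sum_congr rfl fun x₁ _ => ?_
    simp only [← Finset.sum_mul, ← Finset.sum_div, (hW.mem _ _ _).2]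
    rw [Finset.sum_comm, Finset.mul_sum]
    refine Finset.sum_congr rfl fun y _ => ?_
    rw [average, ← Finset.sum_mul, ← Finset.sum_div]
    simp only [Finset.sum_const, Finset.card_univ, ZMod.card, nsmul_eq_mul]
    field_simp

theorem condEnt_unif₁₂ : condEnt (jointDist (prodInput (unif q) (unif q) r) W pZ₁ pZ₂) Y₃ X₃ =
      ∑ ω, jointDist (prodInput (unif q) (unif q) r) W pZ₁ pZ₂ ω * outEnt₁₂ W (X₃ ω) := by
  have hq : (q : ℝ) ≠ 0 := by exact_mod_cast NeZero.ne q
  rw [condEnt_eq_of_kernel (κ := fun x₃ => average fun x : ZMod q × ZMod q => W x.1 x.2 x₃)]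
  · rfl
  · exact fun x => (average_mem_stdSimplex fun x₂ => hW.mem _ _ _).2
  · refine law_prod_eq_of_forall fun F => ?_
    rw [sum_jointDist_unif hW hZ₁ hZ₂ fun _ _ x₃ _ y => F x₃ y,
      sum_jointDist_unif hW hZ₁ hZ₂ fun _ _ x₃ _ _ =>
        ∑ b, average (fun x : ZMod q × ZMod q => W x.1 x.2 x₃) b * F x₃ b]
    refine Finset.sum_congr rfl fun x₃ _ => Finset.sum_congr rfl fun v _ => ?_
    congr 1
    simp only [← Finset.sum_mul, ← Finset.sum_div, (hW.mem _ _ _).2]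
    rw [← Fintype.sum_prod_type' fun x₁ x₂ => ∑ y, W x₁ x₂ x₃ y / (q * q) * F x₃ y,
      Finset.sum_comm, Finset.mul_sum]
    refine Finset.sum_congr rfl fun y _ => ?_
    rw [average, ← Finset.sum_mul, ← Finset.sum_div]
    simp only [Finset.sum_const, Finset.card_univ, Fintype.card_prod, ZMod.card, nsmul_eq_mul]
    push_cast
    field_simp

end Uniform

end JointDist

/-! ### Noise independent of the conditioning variable. -/

section Independent

variable {Ω γ ζ : Type*} [Fintype Ω] [Fintype γ] [Fintype ζ] {P : Ω → ℝ}

theorem condEnt_eq_entropy (hP : P ∈ stdSimplex ℝ Ω) {Z : Ω → ζ} {C : Ω → γ} {g : ζ → ℝ}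
    (hg : ∑ z, g z = 1)
    (h : ∀ F : γ → ζ → ℝ, ∑ ω, P ω * F (C ω) (Z ω) = ∑ ω, P ω * ∑ z, g z * F (C ω) z) :
    condEnt P Z C = entropy g := by
  rw [condEnt_eq_of_kernel (κ := fun _ => g) (fun _ => hg)
    (law_prod_eq_of_forall (κ := fun _ => g) h), ← Finset.sum_mul, hP.2, one_mul]

end Independent

/-! ### The broadcast direction sees only the law of (V, X₃). -/

section Broadcast

open Outcome

variable {q : ℕ} [NeZero q] {Y V : Type*} [Fintype Y] [Fintype V]
  {W : ZMod q → ZMod q → ZMod q → Y → ℝ} {pZ₁ pZ₂ : ZMod q → ℝ}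
  {p : ZMod q × ZMod q × ZMod q × V → ℝ}

theorem sum_prodInput_mul {p₁ p₂ : ZMod q → ℝ} (h₁ : p₁ ∈ stdSimplex ℝ (ZMod q))
    (h₂ : p₂ ∈ stdSimplex ℝ (ZMod q)) (r : V × ZMod q → ℝ) (G : V × ZMod q → ℝ) :
    ∑ t, prodInput p₁ p₂ r t * G (t.2.2.2, t.2.2.1) = ∑ u, r u * G u := by
  simp only [prodInput, Fintype.sum_prod_type, mul_assoc, ← Finset.mul_sum]
  rw [← Finset.sum_mul, ← Finset.sum_mul, h₁.2, h₂.2, one_mul, one_mul, Finset.sum_comm]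

variable (hW : ∀ x₁ x₂ x₃, W x₁ x₂ x₃ ∈ stdSimplex ℝ Y) (hZ₁ : pZ₁ ∈ stdSimplex ℝ (ZMod q))
  (hZ₂ : pZ₂ ∈ stdSimplex ℝ (ZMod q))
include hW

theorem sum_jointDist_bc (F : V → ZMod q → ZMod q → ZMod q → ℝ) :
    ∑ ω, jointDist p W pZ₁ pZ₂ ω * F (aux ω) (X₃ ω) (Z₁ ω) (Z₂ ω) =
      ∑ t, p t * ∑ z₁, pZ₁ z₁ * ∑ z₂, pZ₂ z₂ * F t.2.2.2 t.2.2.1 z₁ z₂ := by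
  rw [sum_jointDist_mul]
  refine Finset.sum_congr rfl fun t _ => ?_
  simp [X₃, aux, Z₁, Z₂, ← Finset.sum_mul, (hW _ _ _).2]

theorem sum_jointDist_prod_bc {p₁ p₂ : ZMod q → ℝ} (h₁ : p₁ ∈ stdSimplex ℝ (ZMod q))
    (h₂ : p₂ ∈ stdSimplex ℝ (ZMod q)) (r : V × ZMod q → ℝ)
    (F : V → ZMod q → ZMod q → ZMod q → ℝ) :
    ∑ ω, jointDist (prodInput p₁ p₂ r) W pZ₁ pZ₂ ω * F (aux ω) (X₃ ω) (Z₁ ω) (Z₂ ω) =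
      ∑ u, r u * ∑ z₁, pZ₁ z₁ * ∑ z₂, pZ₂ z₂ * F u.1 u.2 z₁ z₂ := by
  rw [sum_jointDist_bc hW, ← sum_prodInput_mul h₁ h₂]

/-- The variables `(V, X₃, Z₁, Z₂)` have the same law when users 1 and 2 use independent inputs. -/
theorem law_bc_eq {p₁ p₂ : ZMod q → ℝ} (h₁ : p₁ ∈ stdSimplex ℝ (ZMod q))
    (h₂ : p₂ ∈ stdSimplex ℝ (ZMod q)) :
    law (jointDist p W pZ₁ pZ₂) (fun ω => (aux ω, X₃ ω, Z₁ ω, Z₂ ω)) =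
      law (jointDist (prodInput p₁ p₂ (law p fun t => (t.2.2.2, t.2.2.1))) W pZ₁ pZ₂)
        (fun ω => (aux ω, X₃ ω, Z₁ ω, Z₂ ω)) := by
  refine law_eq_of_forall fun F => ?_
  rw [sum_jointDist_bc hW fun v x z₁ z₂ => F (v, x, z₁, z₂),
    sum_jointDist_prod_bc hW h₁ h₂ _ fun v x z₁ z₂ => F (v, x, z₁, z₂),
    sum_law_mul p (fun t => (t.2.2.2, t.2.2.1))
      fun u => ∑ z₁, pZ₁ z₁ * ∑ z₂, pZ₂ z₂ * F (u.1, u.2, z₁, z₂)]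

end Broadcast

/-! ### Inner, outer and uniform-input regions. -/

section OuterBound

open Outcome

variable {q : ℕ} [NeZero q] {Y V : Type*} [Fintype Y] [Fintype V]
  {W : ZMod q → ZMod q → ZMod q → Y → ℝ} {pZ₁ pZ₂ : ZMod q → ℝ}
  (hW : IsSymmetricMac W) (hZ₁ : pZ₁ ∈ stdSimplex ℝ (ZMod q))
  (hZ₂ : pZ₂ ∈ stdSimplex ℝ (ZMod q))
include hW hZ₁ hZ₂

/-- With the law of (V, X₃) kept, the means of functions of X₃ and the two broadcast terms are
unchanged, while the three conditional entropies of Y₃ rise to their maxima. -/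
theorem rateRegion_subset_unif {p : ZMod q × ZMod q × ZMod q × V → ℝ}
    (hp : p ∈ stdSimplex ℝ _) : rateRegion p W pZ₁ pZ₂ ⊆ rateRegion
      (prodInput (unif q) (unif q) (law p fun t => (t.2.2.2, t.2.2.1))) W pZ₁ pZ₂ := by
  rintro ⟨R₁, R₂, R₃, R₄⟩ ⟨h0, h1, h2, h12, h3, h4⟩
  have hr := law_mem_stdSimplex hp fun t : ZMod q × ZMod q × ZMod q × V => (t.2.2.2, t.2.2.1)
  set r := law p fun t => (t.2.2.2, t.2.2.1) with hr_def
  have hp' : prodInput (unif q) (unif q) r ∈ stdSimplex ℝ _ :=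
    prodInput_mem_stdSimplex unif_mem_stdSimplex unif_mem_stdSimplex hr
  have hlaw := law_bc_eq (p := p) (pZ₁ := pZ₁) (pZ₂ := pZ₂) hW.mem
    (unif_mem_stdSimplex (q := q)) (unif_mem_stdSimplex (q := q))
  rw [← hr_def] at hlaw
  set P := jointDist p W pZ₁ pZ₂
  set P' := jointDist (prodInput (unif q) (unif q) r) W pZ₁ pZ₂ with hP'_def
  -- Both input laws induce the same law of X₃, hence the same mean noise entropy and the same upper
  -- bounds.
  have hsum : ∀ e : ZMod q → ℝ, ∑ ω, P ω * e (X₃ ω) = ∑ ω, P' ω * e (X₃ ω) := by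
    intro e
    rw [← sum_law_mul P (fun ω => (aux ω, X₃ ω, Z₁ ω, Z₂ ω)) fun t => e t.2.1, hlaw, sum_law_mul]
  refine ⟨h0, ?_, ?_, ?_, ?_, ?_⟩
  · refine h1.trans ?_
    rw [condMutualInfo₁_eq hW hZ₁ hZ₂ hp, condMutualInfo₁_eq hW hZ₁ hZ₂ hp',
      condEnt_unif₁ hW hZ₁ hZ₂, ← hP'_def, ← hsum (noiseEnt W), ← hsum (outEnt₁ W)]
    exact sub_le_sub_right (condEnt_jointDist_le₁ hW hZ₁ hZ₂ hp) _
  · refine h2.trans ?_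
    rw [condMutualInfo₂_eq hW hZ₁ hZ₂ hp, condMutualInfo₂_eq hW hZ₁ hZ₂ hp',
      condEnt_unif₂ hW hZ₁ hZ₂, ← hP'_def, ← hsum (noiseEnt W), ← hsum (outEnt₂ W)]
    exact sub_le_sub_right (condEnt_jointDist_le₂ hW hZ₁ hZ₂ hp) _
  · refine h12.trans ?_
    rw [condMutualInfo₁₂_eq hW hZ₁ hZ₂ hp, condMutualInfo₁₂_eq hW hZ₁ hZ₂ hp',
      condEnt_unif₁₂ hW hZ₁ hZ₂, ← hP'_def, ← hsum (noiseEnt W), ← hsum (outEnt₁₂ W)]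
    exact sub_le_sub_right (condEnt_jointDist_le₁₂ hW hZ₁ hZ₂ hp) _
  · refine h3.trans (le_of_eq ?_)
    have := fun Q : Outcome q V Y → ℝ => condMutualInfo_law Q
      (fun ω => (aux ω, X₃ ω, Z₁ ω, Z₂ ω)) (fun t => t.2.1) (fun t => t.2.1 + t.2.2.1) Prod.fst
    rw [← this, hlaw, this]
  · refine h4.trans (le_of_eq ?_)
    rw [mutualInfo_eq_condMutualInfo (jointDist_mem_stdSimplex hp hW.mem hZ₁ hZ₂),
      mutualInfo_eq_condMutualInfo (jointDist_mem_stdSimplex hp' hW.mem hZ₁ hZ₂)]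
    have := fun Q : Outcome q V Y → ℝ => condMutualInfo_law Q
      (fun ω => (aux ω, X₃ ω, Z₁ ω, Z₂ ω)) Prod.fst (fun t => t.2.1 + t.2.2.1 + t.2.2.2)
      fun _ => ()
    rw [← this, hlaw, this]

theorem outerBound_subset_uniformInputRegion :
    outerBound W pZ₁ pZ₂ ⊆ uniformInputRegion W pZ₁ pZ₂ := by
  refine closure_mono (convexHull_mono ?_)
  rintro R ⟨k, hk, p, hp, hR⟩
  exact ⟨k, hk, _, law_mem_stdSimplex hp _, rateRegion_subset_unif hW hZ₁ hZ₂ hp hR⟩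

omit hW hZ₁ hZ₂ in
theorem uniformInputRegion_subset_innerBound :
    uniformInputRegion W pZ₁ pZ₂ ⊆ innerBound W pZ₁ pZ₂ := by
  refine closure_mono (convexHull_mono ?_)
  rintro R ⟨k, hk, r, hr, hR⟩
  exact ⟨k, hk, _, unif_mem_stdSimplex, _, unif_mem_stdSimplex, r, hr, hR⟩

omit hW hZ₁ hZ₂ in
theorem innerBound_subset_outerBound :
    innerBound W pZ₁ pZ₂ ⊆ outerBound W pZ₁ pZ₂ := by
  refine closure_mono (convexHull_mono ?_)
  rintro R ⟨k, hk, p₁, h₁, p₂, h₂, r, hr, hR⟩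
  exact ⟨k, hk, _, prodInput_mem_stdSimplex h₁ h₂ hr, hR⟩

/-- The rate region of a mixture `∑ w v • f v` of input laws of user 3, in terms of entropies. -/
theorem mem_rateRegion_unif {w : V → ℝ} {f : V → ZMod q → ℝ} (hw : w ∈ stdSimplex ℝ V)
    (hf : ∀ v, f v ∈ stdSimplex ℝ (ZMod q)) {R₁ R₂ R₃ R₄ : ℝ}
    (h0 : 0 ≤ R₁ ∧ 0 ≤ R₂ ∧ 0 ≤ R₃ ∧ 0 ≤ R₄)
    (h1 : R₁ ≤ ∑ v, w v * ∑ x, f v x * (outEnt₁ W x - noiseEnt W x))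
    (h2 : R₂ ≤ ∑ v, w v * ∑ x, f v x * (outEnt₂ W x - noiseEnt W x))
    (h12 : R₁ + R₂ ≤ ∑ v, w v * ∑ x, f v x * (outEnt₁₂ W x - noiseEnt W x))
    (h3 : R₃ ≤ ∑ v, w v * entropy (conv (f v) pZ₁) - entropy pZ₁)
    (h4 : R₄ ≤ entropy (conv (fun x => ∑ v, w v * f v x) (conv pZ₁ pZ₂)) -
      ∑ v, w v * entropy (conv (f v) (conv pZ₁ pZ₂))) :
    (R₁, R₂, R₃, R₄) ∈ rateRegion (prodInput (unif q) (unif q)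
      (fun u : V × ZMod q => w u.1 * f u.1 u.2)) W pZ₁ pZ₂ := by
  have hr : (fun u : V × ZMod q => w u.1 * f u.1 u.2) ∈ stdSimplex ℝ _ := by
    refine ⟨fun u => mul_nonneg (hw.1 _) ((hf _).1 _), ?_⟩
    simp [Fintype.sum_prod_type, ← Finset.mul_sum, (hf _).2, hw.2]
  set r : V × ZMod q → ℝ := fun u => w u.1 * f u.1 u.2 with hr_def
  have hp : prodInput (unif q) (unif q) r ∈ stdSimplex ℝ _ :=
    prodInput_mem_stdSimplex unif_mem_stdSimplex unif_mem_stdSimplex hr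
  have hP := jointDist_mem_stdSimplex (W := W) hp hW.mem hZ₁ hZ₂
  have hbc := sum_jointDist_prod_bc (pZ₁ := pZ₁) (pZ₂ := pZ₂) hW.mem
    (unif_mem_stdSimplex (q := q)) (unif_mem_stdSimplex (q := q)) r
  set P := jointDist (prodInput (unif q) (unif q) r) W pZ₁ pZ₂ with hP_def
  have hconv := conv_mem_stdSimplex hZ₁ hZ₂
  have hsum : ∀ e : ZMod q → ℝ, ∑ ω, P ω * e (X₃ ω) = ∑ v, w v * ∑ x, f v x * e x := by
    intro e
    rw [hbc fun _ x _ _ => e x]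
    simp [← Finset.sum_mul, hZ₁.2, hZ₂.2, hr_def, Fintype.sum_prod_type, Finset.mul_sum, mul_assoc]
  have hsub : ∀ e : ZMod q → ℝ, ∑ v, w v * ∑ x, f v x * (e x - noiseEnt W x) =
      ∑ ω, P ω * e (X₃ ω) - ∑ ω, P ω * noiseEnt W (X₃ ω) := by
    intro e
    rw [← hsum fun x => e x - noiseEnt W x, ← Finset.sum_sub_distrib]
    simp only [mul_sub]
  have hS1 : condEnt P (fun ω => X₃ ω + Z₁ ω) (fun ω => (X₃ ω, aux ω)) = entropy pZ₁ := by
    rw [condEnt_congr hP.1 (fun ω => (X₃ ω, aux ω)) (B' := Z₁) (fun c b => b - c.1)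
      (fun c b => c.1 + b) (fun ω => by simp) fun ω => rfl]
    refine condEnt_eq_entropy hP hZ₁.2 fun F => ?_
    rw [hbc fun v x z₁ _ => F (x, v) z₁, hbc fun v x _ _ => ∑ z, pZ₁ z * F (x, v) z]
    simp [← Finset.sum_mul, hZ₁.2, hZ₂.2]
  have hS1V : condEnt P (fun ω => X₃ ω + Z₁ ω) aux = ∑ v, w v * entropy (conv (f v) pZ₁) := by
    rw [condEnt_eq_of_kernel (κ := fun v => conv (f v) pZ₁)
      (fun v => (conv_mem_stdSimplex (hf v) hZ₁).2)]
    · rw [hbc fun v _ _ _ => entropy (conv (f v) pZ₁)]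
      simp [← Finset.sum_mul, hZ₁.2, hZ₂.2, hr_def, Fintype.sum_prod_type, ← Finset.mul_sum,
        (hf _).2]
    · refine law_prod_eq_of_forall fun F => ?_
      rw [hbc fun v x z₁ _ => F v (x + z₁), hbc fun v _ _ _ => ∑ s, conv (f v) pZ₁ s * F v s]
      simp only [sum_conv_mul]
      simp [← Finset.sum_mul, hZ₁.2, hZ₂.2, hr_def, Fintype.sum_prod_type, ← Finset.mul_sum,
        (hf _).2, mul_assoc]
  have hS2V : condEnt P (fun ω => X₃ ω + Z₁ ω + Z₂ ω) aux =
      ∑ v, w v * entropy (conv (f v) (conv pZ₁ pZ₂)) := by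
    rw [condEnt_eq_of_kernel (κ := fun v => conv (f v) (conv pZ₁ pZ₂))
      (fun v => (conv_mem_stdSimplex (hf v) hconv).2)]
    · rw [hbc fun v _ _ _ => entropy (conv (f v) (conv pZ₁ pZ₂))]
      simp [← Finset.sum_mul, hZ₁.2, hZ₂.2, hr_def, Fintype.sum_prod_type, ← Finset.mul_sum,
        (hf _).2]
    · refine law_prod_eq_of_forall fun F => ?_
      rw [hbc fun v x z₁ z₂ => F v (x + z₁ + z₂),
        hbc fun v _ _ _ => ∑ s, conv (f v) (conv pZ₁ pZ₂) s * F v s]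
      simp only [sum_conv_mul]
      simp [← Finset.sum_mul, hZ₁.2, hZ₂.2, hr_def, Fintype.sum_prod_type, ← Finset.mul_sum,
        (hf _).2, mul_assoc, add_assoc]
  have hS2 : ent P (fun ω => X₃ ω + Z₁ ω + Z₂ ω) =
      entropy (conv (fun x => ∑ v, w v * f v x) (conv pZ₁ pZ₂)) := by
    have : law P (fun ω => X₃ ω + Z₁ ω + Z₂ ω) =
        law (conv (fun x => ∑ v, w v * f v x) (conv pZ₁ pZ₂)) fun s => s := by
      refine law_eq_of_forall fun F => ?_
      rw [hbc fun _ x z₁ z₂ => F (x + z₁ + z₂), sum_conv_mul]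
      simp only [sum_conv_mul, hr_def, Fintype.sum_prod_type, Finset.sum_mul]
      rw [Finset.sum_comm]
      simp only [add_assoc]
    rw [ent, this, law_id]
  refine ⟨h0, ?_, ?_, ?_, ?_, ?_⟩
  · rwa [condMutualInfo₁_eq hW hZ₁ hZ₂ hp, condEnt_unif₁ hW hZ₁ hZ₂, ← hP_def, ← hsub]
  · rwa [condMutualInfo₂_eq hW hZ₁ hZ₂ hp, condEnt_unif₂ hW hZ₁ hZ₂, ← hP_def, ← hsub]
  · rwa [condMutualInfo₁₂_eq hW hZ₁ hZ₂ hp, condEnt_unif₁₂ hW hZ₁ hZ₂, ← hP_def, ← hsub]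
  · rwa [condMutualInfo_eq_condEnt hP.1, hS1, hS1V]
  · rwa [mutualInfo_eq_ent hP, hS2, hS2V]

end OuterBound

/-! ### Cardinality of the auxiliary variable -/

section Cardinality

open Classical in
/-- A linear program with nonnegative variables and bounded feasible set is improved by a
feasible point whose support is no larger than the number of linear constraints. -/
theorem exists_small_support {ι E : Type*} [Fintype ι] [AddCommGroup E] [Module ℝ E]
    [FiniteDimensional ℝ E] (g : ι → E) (φ : ι → ℝ)
    (hg : ∀ d : ι → ℝ, ∑ i, d i • g i = 0 → ∑ i, d i = 0) (w : ι → ℝ) (hw : ∀ i, 0 ≤ w i) :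
    ∃ w' : ι → ℝ, (∀ i, 0 ≤ w' i) ∧ ∑ i, w' i • g i = ∑ i, w i • g i ∧
      ∑ i, w i * φ i ≤ ∑ i, w' i * φ i ∧
      (Finset.univ.filter fun i => w' i ≠ 0).card ≤ Module.finrank ℝ E := by
  induction hn : (Finset.univ.filter fun i => w i ≠ 0).card using Nat.strong_induction_on
    generalizing w with
  | _ n ih =>
  by_cases hle : n ≤ Module.finrank ℝ E
  · exact ⟨w, hw, rfl, le_rfl, hn ▸ hle⟩
  have hdep : ¬LinearIndependent ℝ (fun i : {i // w i ≠ 0} => g i) := by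
    intro h
    have := h.fintype_card_le_finrank
    rw [Fintype.card_subtype, hn] at this
    exact hle this
  -- A linear dependence among the constraint vectors of the support, with its sign chosen so that
  -- the objective does not decrease along d.
  obtain ⟨d, hd0, hdsupp, hdne, hdφ⟩ : ∃ d : ι → ℝ, ∑ i, d i • g i = 0 ∧
      (∀ i, w i = 0 → d i = 0) ∧ (∃ i, d i ≠ 0) ∧ 0 ≤ ∑ i, d i * φ i := by
    obtain ⟨c, hc, j, hj⟩ := Fintype.not_linearIndependent_iff.1 hdep
    obtain ⟨d, hd0, hds, hdn⟩ : ∃ d : ι → ℝ, ∑ i, d i • g i = 0 ∧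
        (∀ i, w i = 0 → d i = 0) ∧ (∃ i, d i ≠ 0) := by
      refine ⟨fun i => if h : w i ≠ 0 then c ⟨i, h⟩ else 0, ?_, fun i hi => by simp [hi],
        j, by simpa [j.2] using hj⟩
      rw [← hc, ← Finset.sum_filter_of_ne (p := fun i => w i ≠ 0),
        Finset.sum_subtype _ (p := fun i => w i ≠ 0) (by simp)]
      · exact Finset.sum_congr rfl fun i _ => by simp [i.2]
      · intro i _ h h'
        simp [h'] at h
    rcases le_total 0 (∑ i, d i * φ i) with h | h
    · exact ⟨d, hd0, hds, hdn, h⟩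
    · refine ⟨-d, ?_, fun i hi => by simp [hds i hi], ?_, ?_⟩
      · simp [hd0]
      · simpa using hdn
      · simpa using h
  -- The coordinates of d sum to 0 by `hg`, so a nonzero d has a negative coordinate and the move
  -- along d must stop.
  have hneg : (Finset.univ.filter fun i => d i < 0).Nonempty := by
    by_contra hne
    rw [Finset.not_nonempty_iff_eq_empty, Finset.filter_eq_empty_iff] at hne
    obtain ⟨i, hi⟩ := hdne
    have := (Finset.sum_eq_zero_iff_of_nonneg
      fun i hi => not_lt.1 (hne hi)).1 (hg d hd0) i (Finset.mem_univ i)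
    exact hi this
  -- The ratio test: the longest step that keeps all weights nonnegative, at which the weight of j
  -- becomes 0.
  obtain ⟨j, hj, hmin⟩ := Finset.exists_min_image _ (fun i => w i / -d i) hneg
  rw [Finset.mem_filter] at hj
  have hdj : 0 < -d j := by linarith [hj.2]
  set t := w j / -d j with ht
  have ht0 : 0 ≤ t := div_nonneg (hw j) hdj.le
  have hnew : ∀ i, 0 ≤ w i + t * d i := by
    intro i
    rcases le_or_gt 0 (d i) with h | h
    · exact add_nonneg (hw i) (mul_nonneg ht0 h)
    · have := hmin i (by simpa using h)
      rw [le_div_iff₀ (by linarith)] at this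
      linarith
  have hj0 : w j + t * d j = 0 := by
    have : t * -d j = w j := div_mul_cancel₀ _ hdj.ne'
    linarith
  have hwj : w j ≠ 0 := fun h => by linarith [hdsupp j h]
  obtain ⟨w', h1, h2, h3, h4⟩ := ih _ (by
    rw [← hn]
    refine Finset.card_lt_card (Finset.ssubset_iff_of_subset ?_ |>.2 ⟨j, ?_, ?_⟩)
    · intro i
      simp only [Finset.mem_filter, Finset.mem_univ, true_and]
      exact fun h h' => h (by rw [h', hdsupp i h']; ring)
    · simpa using hwj
    · simpa using hj0) (fun i => w i + t * d i) hnew rfl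
  refine ⟨w', h1, ?_, ?_, h4⟩
  · rw [h2]
    simp only [add_smul, Finset.sum_add_distrib, mul_smul, ← Finset.smul_sum, hd0, smul_zero,
      add_zero]
  · refine le_trans ?_ h3
    simp only [add_mul, Finset.sum_add_distrib, mul_assoc, ← Finset.mul_sum]
    exact le_add_of_nonneg_right (mul_nonneg ht0 hdφ)

end Cardinality

/-! ### Mixtures of input laws of user 3. -/

section Hull

variable {q : ℕ} [NeZero q] {Y : Type*} [Fintype Y]
  {W : ZMod q → ZMod q → ZMod q → Y → ℝ} {pZ₁ pZ₂ : ZMod q → ℝ}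

/-- An input law of user 3, with the output entropies of users 1 and 2. -/
def bcPoint (pZ₁ pZ₂ f : ZMod q → ℝ) : (ZMod q → ℝ) × ℝ × ℝ :=
  (f, entropy (conv f pZ₁), entropy (conv f (conv pZ₁ pZ₂)))

/-- The triples of a law of `X₃` and conditional output entropies of users 1 and 2 given some
auxiliary variable. -/
def bcHull (pZ₁ pZ₂ : ZMod q → ℝ) : Set ((ZMod q → ℝ) × ℝ × ℝ) :=
  convexHull ℝ (bcPoint pZ₁ pZ₂ '' stdSimplex ℝ (ZMod q))

theorem mem_bcHull_of_mixture {V : Type*} [Fintype V] {w : V → ℝ} (hw : w ∈ stdSimplex ℝ V)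
    {f : V → ZMod q → ℝ} (hf : ∀ v, f v ∈ stdSimplex ℝ (ZMod q)) :
    (fun x => ∑ v, w v * f v x, ∑ v, w v * entropy (conv (f v) pZ₁),
      ∑ v, w v * entropy (conv (f v) (conv pZ₁ pZ₂))) ∈ bcHull pZ₁ pZ₂ := by
  have := (convex_convexHull ℝ (bcPoint pZ₁ pZ₂ '' stdSimplex ℝ (ZMod q))).sum_mem
    (t := Finset.univ) (w := w) (z := fun v => bcPoint pZ₁ pZ₂ (f v)) (fun v _ => hw.1 v) hw.2
    fun v _ => subset_convexHull _ _ ⟨f v, hf v, rfl⟩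
  rw [bcHull]
  convert this using 1
  refine Prod.ext ?_ (Prod.ext ?_ ?_)
  · funext x
    simp [bcPoint, Prod.fst_sum]
  · simp [bcPoint, Prod.fst_sum, Prod.snd_sum]
  · simp [bcPoint, Prod.snd_sum]

/-- The q masses of the law of X₃ and the value of H(X₃ + Z₁ + Z₂ | V) are q + 1 linear constraints
on the mixture weights. H(X₃ + Z₁ | V) is not fixed but maximized, because a larger value only
relaxes the bound on R₃₁; this is what gives q + 1 rather than q + 2. Total weight 1 is no extra
constraint, as it follows from the law of X₃. -/
theorem mem_uniform_of_mem_bcHull (hW : IsSymmetricMac W) (hZ₁ : pZ₁ ∈ stdSimplex ℝ (ZMod q))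
    (hZ₂ : pZ₂ ∈ stdSimplex ℝ (ZMod q)) {p : ZMod q → ℝ} {a b : ℝ}
    (hp : (p, a, b) ∈ bcHull pZ₁ pZ₂) {R₁ R₂ R₃ R₄ : ℝ}
    (h0 : 0 ≤ R₁ ∧ 0 ≤ R₂ ∧ 0 ≤ R₃ ∧ 0 ≤ R₄)
    (h1 : R₁ ≤ ∑ x, p x * (outEnt₁ W x - noiseEnt W x))
    (h2 : R₂ ≤ ∑ x, p x * (outEnt₂ W x - noiseEnt W x))
    (h12 : R₁ + R₂ ≤ ∑ x, p x * (outEnt₁₂ W x - noiseEnt W x))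
    (h3 : R₃ ≤ a - entropy pZ₁)
    (h4 : R₄ ≤ entropy (conv p (conv pZ₁ pZ₂)) - b) :
    ∃ k ≤ q + 1, ∃ r ∈ stdSimplex ℝ (Fin k × ZMod q),
      (R₁, R₂, R₃, R₄) ∈ rateRegion (prodInput (unif q) (unif q) r) W pZ₁ pZ₂ := by
  classical
  obtain ⟨ι, _, w, z, hw0, hw1, hz, hsum⟩ := mem_convexHull_iff_exists_fintype.1 hp
  choose f hf hfz using hz
  simp only [← hfz] at hsum
  obtain ⟨w', hw'0, hlin, hobj, hcard⟩ := exists_small_support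
    (fun i => ((f i, entropy (conv (f i) (conv pZ₁ pZ₂))) : (ZMod q → ℝ) × ℝ))
    (fun i => entropy (conv (f i) pZ₁)) (fun d hd => by
      have h : ∀ x, ∑ i, d i * f i x = 0 := fun x => by
        simpa [Prod.fst_sum] using congrFun (congrArg Prod.fst hd) x
      calc ∑ i, d i = ∑ i, d i * ∑ x, f i x := by simp [(hf _).2]
        _ = ∑ x, ∑ i, d i * f i x := by simp only [Finset.mul_sum]; rw [Finset.sum_comm]
        _ = 0 := by simp [h]) w hw0
  have hp1 : ∀ x, ∑ i, w' i * f i x = p x := fun x => by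
    have e1 := congrFun (congrArg Prod.fst hlin) x
    have e2 := congrFun (congrArg Prod.fst hsum) x
    simp only [Prod.fst_sum, Prod.smul_fst, Finset.sum_apply, Pi.smul_apply, smul_eq_mul,
      bcPoint] at e1 e2
    rw [e1, e2]
  have hb : ∑ i, w' i * entropy (conv (f i) (conv pZ₁ pZ₂)) = b := by
    have e1 := congrArg Prod.snd hlin
    have e2 := congrArg (fun x => x.2.2) hsum
    simp only [Prod.snd_sum, Prod.smul_snd, smul_eq_mul, bcPoint] at e1 e2
    rw [e1, e2]
  have ha : a ≤ ∑ i, w' i * entropy (conv (f i) pZ₁) := by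
    have e2 := congrArg (fun x => x.2.1) hsum
    simp only [Prod.snd_sum, Prod.fst_sum, Prod.smul_snd, Prod.smul_fst, smul_eq_mul,
      bcPoint] at e2
    rwa [← e2]
  have hw'1 : ∑ i, w' i = 1 := by
    have hpsum : ∀ u : ι → ℝ, ∑ x, ∑ i, u i * f i x = ∑ i, u i := by
      intro u
      rw [Finset.sum_comm]
      simp [← Finset.mul_sum, (hf _).2]
    have e2 : ∀ x, ∑ i, w i * f i x = p x := fun x => by
      simpa [Prod.fst_sum, bcPoint] using congrFun (congrArg Prod.fst hsum) x
    rw [← hpsum w', ← hw1, ← hpsum w]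
    simp only [hp1, e2]
  set k := (Finset.univ.filter fun i => w' i ≠ 0).card with hk
  have hcard' : Fintype.card {i // w' i ≠ 0} = k := by rw [Fintype.card_subtype]
  -- The auxiliary alphabet is the support of the new weights, so dropped indices contribute nothing
  -- to any of the sums.
  let e : Fin k ≃ {i // w' i ≠ 0} := (Fintype.equivFinOfCardEq hcard').symm
  have hred : ∀ G : ι → ℝ, ∑ j : Fin k, w' (e j) * G (e j) = ∑ i, w' i * G i := by
    intro G
    rw [Equiv.sum_comp e fun i : {i // w' i ≠ 0} => w' i * G i]
    rw [← Finset.sum_subtype (Finset.univ.filter fun i => w' i ≠ 0) (by simp)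
      fun i => w' i * G i]
    exact Finset.sum_filter_of_ne fun i _ h h' => h (by simp [h'])
  have hwk : (fun j => w' (e j)) ∈ stdSimplex ℝ (Fin k) :=
    ⟨fun j => hw'0 _, by simpa [hw'1] using hred fun _ => 1⟩
  have hswap : ∀ G : ZMod q → ℝ, ∑ j : Fin k, w' (e j) * ∑ x, f (e j) x * G x =
      ∑ x, p x * G x := by
    intro G
    rw [hred fun i => ∑ x, f i x * G x]
    simp only [← hp1, Finset.mul_sum, Finset.sum_mul, mul_assoc]
    exact Finset.sum_comm
  refine ⟨k, ?_, _, ?_, mem_rateRegion_unif hW hZ₁ hZ₂ hwk (fun j => hf (e j)) h0 ?_ ?_ ?_ ?_ ?_⟩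
  · simpa [ZMod.card] using hcard
  · refine ⟨fun u => mul_nonneg (hw'0 _) ((hf _).1 _), ?_⟩
    simp [Fintype.sum_prod_type, ← Finset.mul_sum, (hf _).2, hwk.2]
  · rwa [hswap]
  · rwa [hswap]
  · rwa [hswap]
  · rw [hred fun i => entropy (conv (f i) pZ₁)]
    linarith
  · rw [hred fun i => entropy (conv (f i) (conv pZ₁ pZ₂)), hb]
    have : (fun x => ∑ j : Fin k, w' (e j) * f (e j) x) = p :=
      funext fun x => by rw [hred fun i => f i x, hp1]
    rwa [this]

end Hull

/-! ### Chain rules and disintegration. -/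

section Chain

variable {Ω α β γ δ ε : Type*} [Fintype Ω] [Fintype α] [Fintype β] [Fintype γ] [Fintype δ]
  [Fintype ε] {P : Ω → ℝ}

theorem condEnt_chain (hP : ∀ ω, 0 ≤ P ω) {U : Ω → β} {B : Ω → δ} {U' : Ω → ε} (C : Ω → γ)
    (f : β → δ → ε) (g : ε → β × δ) (hf : ∀ ω, U' ω = f (U ω) (B ω))
    (hg : ∀ u b, g (f u b) = (u, b)) :
    condEnt P U' C = condEnt P U C + condEnt P B (fun ω => (C ω, U ω)) := by
  rw [← condEnt_prod hP]
  exact condEnt_congr hP C (fun _ e => g e) (fun _ x => f x.1 x.2) (fun ω => by rw [hf, hg]) hf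

/-- Chain rule for the information about `A` in an observation `U'` that amounts to `(U, B)`. -/
theorem condMutualInfo_chain (hP : ∀ ω, 0 ≤ P ω) (A : Ω → α) {U : Ω → β} {B : Ω → δ}
    {U' : Ω → ε} (C : Ω → γ) (f : β → δ → ε) (g : ε → β × δ) (hf : ∀ ω, U' ω = f (U ω) (B ω))
    (hg : ∀ u b, g (f u b) = (u, b)) :
    condMutualInfo P A U' C = condMutualInfo P A U C +
      (condEnt P B (fun ω => (C ω, U ω)) - condEnt P B (fun ω => ((A ω, C ω), U ω))) := by
  rw [condMutualInfo_eq_condEnt hP, condMutualInfo_eq_condEnt hP, condEnt_chain hP C f g hf hg,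
    condEnt_chain hP (fun ω => (A ω, C ω)) f g hf hg]
  ring

theorem exists_disintegration {q : ℕ} [NeZero q] (hP : P ∈ stdSimplex ℝ Ω) (V : Ω → α)
    (X : Ω → ZMod q) : ∃ f : α → ZMod q → ℝ, (∀ v, f v ∈ stdSimplex ℝ (ZMod q)) ∧
      ∀ v x, law P (fun ω => (V ω, X ω)) (v, x) = law P V v * f v x := by
  classical
  -- On null values of V the conditional law is immaterial; the uniform law keeps it in the simplex.
  refine ⟨fun v => if law P V v = 0 then unif q else
    fun x => law P (fun ω => (V ω, X ω)) (v, x) / law P V v, fun v => ?_, fun v x => ?_⟩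
  · dsimp only
    split_ifs with h
    · exact unif_mem_stdSimplex
    · refine ⟨fun x => div_nonneg (law_nonneg hP.1 _ _) (law_nonneg hP.1 _ _), ?_⟩
      rw [← Finset.sum_div, ← law_eq_sum_snd, div_self h]
  · dsimp only
    split_ifs with h
    · rw [h, zero_mul]
      refine le_antisymm ?_ (law_nonneg hP.1 _ _)
      rw [← h, law_eq_sum_snd P V X v]
      exact Finset.single_le_sum (f := fun x => law P (fun ω => (V ω, X ω)) (v, x))
        (fun x _ => law_nonneg hP.1 _ _) (Finset.mem_univ x)
    · rw [mul_div_cancel₀ _ h]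

end Chain

/-! ### One use of the channel -/

section Step

variable {q : ℕ} [NeZero q] {Y : Type*} [Fintype Y]
  {W : ZMod q → ZMod q → ZMod q → Y → ℝ} {pZ₁ pZ₂ : ZMod q → ℝ}
  {Ω γ γ' : Type*} [Fintype Ω] [Fintype γ] [Fintype γ'] {P : Ω → ℝ}

/-- The law of a history `ω ∼ P` together with `Y₃` and the noises `Z₁`, `Z₂` in one channel use with
inputs `x₁ ω, x₂ ω, x₃ ω`. -/
def stepDist (P : Ω → ℝ) (W : ZMod q → ZMod q → ZMod q → Y → ℝ) (pZ₁ pZ₂ : ZMod q → ℝ)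
    (x₁ x₂ x₃ : Ω → ZMod q) (s : Ω × Y × ZMod q × ZMod q) : ℝ :=
  P s.1 * W (x₁ s.1) (x₂ s.1) (x₃ s.1) s.2.1 * pZ₁ s.2.2.1 * pZ₂ s.2.2.2

variable {x₁ x₂ x₃ : Ω → ZMod q}

theorem sum_stepDist_mul (F : Ω × Y × ZMod q × ZMod q → ℝ) :
    ∑ s, stepDist P W pZ₁ pZ₂ x₁ x₂ x₃ s * F s = ∑ ω, P ω * ∑ y, W (x₁ ω) (x₂ ω) (x₃ ω) y *
      ∑ z₁, pZ₁ z₁ * ∑ z₂, pZ₂ z₂ * F (ω, y, z₁, z₂) := by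
  simp only [Fintype.sum_prod_type, Finset.mul_sum, stepDist, mul_assoc]

variable (hW : IsSymmetricMac W) (hZ₁ : pZ₁ ∈ stdSimplex ℝ (ZMod q))
  (hZ₂ : pZ₂ ∈ stdSimplex ℝ (ZMod q)) (hP : P ∈ stdSimplex ℝ Ω)
include hW hZ₁ hZ₂

theorem sum_stepDist_fst (F : Ω → ℝ) :
    ∑ s, stepDist P W pZ₁ pZ₂ x₁ x₂ x₃ s * F s.1 = ∑ ω, P ω * F ω := by
  rw [sum_stepDist_mul]
  simp [← Finset.sum_mul, hZ₁.2, hZ₂.2, (hW.mem _ _ _).2]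

theorem law_stepDist_fst : law (stepDist P W pZ₁ pZ₂ x₁ x₂ x₃) Prod.fst = P := by
  rw [← law_id P]
  exact law_eq_of_forall fun F => by rw [sum_stepDist_fst hW hZ₁ hZ₂, law_id]

include hP

theorem stepDist_mem_stdSimplex : stepDist P W pZ₁ pZ₂ x₁ x₂ x₃ ∈ stdSimplex ℝ _ := by
  refine ⟨fun s => mul_nonneg (mul_nonneg (mul_nonneg (hP.1 _) ((hW.mem _ _ _).1 _)) (hZ₁.1 _))
    (hZ₂.1 _), ?_⟩
  simpa [hP.2] using sum_stepDist_fst (P := P) (x₁ := x₁) (x₂ := x₂) (x₃ := x₃) hW hZ₁ hZ₂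
    fun _ => 1

theorem condEnt_stepDist_Z₁ (C : Ω → Y → γ) :
    condEnt (stepDist P W pZ₁ pZ₂ x₁ x₂ x₃) (fun s => s.2.2.1) (fun s => C s.1 s.2.1) =
      entropy pZ₁ := by
  refine condEnt_eq_entropy (stepDist_mem_stdSimplex hW hZ₁ hZ₂ hP) hZ₁.2 fun F => ?_
  rw [sum_stepDist_mul, sum_stepDist_mul]
  simp [← Finset.sum_mul, hZ₁.2, hZ₂.2]

theorem condEnt_stepDist_Z₂ (C : Ω → Y → ZMod q → γ) :
    condEnt (stepDist P W pZ₁ pZ₂ x₁ x₂ x₃) (fun s => s.2.2.2)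
      (fun s => C s.1 s.2.1 s.2.2.1) = entropy pZ₂ := by
  refine condEnt_eq_entropy (stepDist_mem_stdSimplex hW hZ₁ hZ₂ hP) hZ₂.2 fun F => ?_
  rw [sum_stepDist_mul, sum_stepDist_mul]
  simp [← Finset.sum_mul, hZ₂.2]

theorem condEnt_stepDist_Z₁₂ (C : Ω → Y → γ) :
    condEnt (stepDist P W pZ₁ pZ₂ x₁ x₂ x₃) (fun s => s.2.2.1 + s.2.2.2)
      (fun s => C s.1 s.2.1) = entropy (conv pZ₁ pZ₂) := by
  refine condEnt_eq_entropy (stepDist_mem_stdSimplex hW hZ₁ hZ₂ hP)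
    (conv_mem_stdSimplex hZ₁ hZ₂).2 fun F => ?_
  rw [sum_stepDist_mul, sum_stepDist_mul]
  simp [← Finset.sum_mul, sum_conv_mul, hZ₁.2, hZ₂.2]

omit hP in
theorem isOutput_stepDist : IsOutput (stepDist P W pZ₁ pZ₂ x₁ x₂ x₃) W
    (fun s => (x₁ s.1, x₂ s.1, x₃ s.1)) (fun s => s.2.1) := by
  intro F
  rw [sum_stepDist_mul, sum_stepDist_mul]
  simp [← Finset.sum_mul, hZ₁.2, hZ₂.2, (hW.mem _ _ _).2]

theorem condEnt_stepDist_Y₃_fst : condEnt (stepDist P W pZ₁ pZ₂ x₁ x₂ x₃) (fun s => s.2.1)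
    (fun s => s.1) = ∑ ω, P ω * noiseEnt W (x₃ ω) := by
  rw [← sum_stepDist_fst (x₁ := x₁) (x₂ := x₂) (x₃ := x₃) hW hZ₁ hZ₂ fun ω => noiseEnt W (x₃ ω)]
  refine IsOutput.condEnt_eq hW (stepDist_mem_stdSimplex hW hZ₁ hZ₂ hP)
    (X := fun s => (x₁ s.1, x₂ s.1, x₃ s.1)) (fun ω => (x₁ ω, x₂ ω, x₃ ω)) (fun _ => rfl)
    fun F => ?_
  rw [sum_stepDist_mul, sum_stepDist_mul]
  simp [← Finset.sum_mul, hZ₁.2, hZ₂.2, (hW.mem _ _ _).2]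

/-- When x₂ and x₃ are known, Y₂ amounts to Z₁ + Z₂, which is independent of the history and of Y₃.
It adds a constant that cancels in differences, so giving Y₂ to user 3 is free. -/
theorem condEnt_stepDist_Y₃Y₂ {C : Ω → γ} (e₂ e₃ : γ → ZMod q) (h₂ : ∀ ω, x₂ ω = e₂ (C ω))
    (h₃ : ∀ ω, x₃ ω = e₃ (C ω)) :
    condEnt (stepDist P W pZ₁ pZ₂ x₁ x₂ x₃)
      (fun s => (s.2.1, x₂ s.1 + x₃ s.1 + (s.2.2.1 + s.2.2.2))) (fun s => C s.1) =
    condEnt (stepDist P W pZ₁ pZ₂ x₁ x₂ x₃) (fun s => s.2.1) (fun s => C s.1) +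
      entropy (conv pZ₁ pZ₂) := by
  have hS := stepDist_mem_stdSimplex (x₁ := x₁) (x₂ := x₂) (x₃ := x₃) hW hZ₁ hZ₂ hP
  rw [← condEnt_stepDist_Z₁₂ (x₁ := x₁) (x₂ := x₂) (x₃ := x₃) hW hZ₁ hZ₂ hP
    (fun ω y => (C ω, y)), ← condEnt_prod hS.1]
  exact condEnt_congr hS.1 _ (fun c b => (b.1, b.2 - e₂ c - e₃ c))
    (fun c b => (b.1, e₂ c + e₃ c + b.2))
    (fun s => Prod.ext rfl (by simp only [h₂, h₃]; ring)) fun s => by simp only [h₂, h₃]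

theorem condEnt_stepDist_Y₃Y₁ {C : Ω → γ} (e₁ e₃ : γ → ZMod q) (h₁ : ∀ ω, x₁ ω = e₁ (C ω))
    (h₃ : ∀ ω, x₃ ω = e₃ (C ω)) :
    condEnt (stepDist P W pZ₁ pZ₂ x₁ x₂ x₃)
      (fun s => (s.2.1, x₁ s.1 + x₃ s.1 + s.2.2.1)) (fun s => C s.1) =
    condEnt (stepDist P W pZ₁ pZ₂ x₁ x₂ x₃) (fun s => s.2.1) (fun s => C s.1) +
      entropy pZ₁ := by
  have hS := stepDist_mem_stdSimplex (x₁ := x₁) (x₂ := x₂) (x₃ := x₃) hW hZ₁ hZ₂ hP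
  rw [← condEnt_stepDist_Z₁ (x₁ := x₁) (x₂ := x₂) (x₃ := x₃) hW hZ₁ hZ₂ hP
    (fun ω y => (C ω, y)), ← condEnt_prod hS.1]
  exact condEnt_congr hS.1 _ (fun c b => (b.1, b.2 - e₁ c - e₃ c))
    (fun c b => (b.1, e₁ c + e₃ c + b.2))
    (fun s => Prod.ext rfl (by simp only [h₁, h₃]; ring)) fun s => by simp only [h₁, h₃]

/-- Degradedness: when x₁ and x₂ are known, (Y₁, Y₂) amounts to X₃ + Z₁ and Z₂, where Z₂ = (Y₂ - x₂)
- (Y₁ - x₁) is fresh noise. -/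
theorem condEnt_stepDist_Y₁Y₂ {C : Ω → γ} (e₁ e₂ : γ → ZMod q) (h₁ : ∀ ω, x₁ ω = e₁ (C ω))
    (h₂ : ∀ ω, x₂ ω = e₂ (C ω)) :
    condEnt (stepDist P W pZ₁ pZ₂ x₁ x₂ x₃)
      (fun s => (x₁ s.1 + x₃ s.1 + s.2.2.1, x₂ s.1 + x₃ s.1 + (s.2.2.1 + s.2.2.2)))
      (fun s => C s.1) =
    condEnt (stepDist P W pZ₁ pZ₂ x₁ x₂ x₃) (fun s => x₃ s.1 + s.2.2.1) (fun s => C s.1) +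
      entropy pZ₂ := by
  have hS := stepDist_mem_stdSimplex (x₁ := x₁) (x₂ := x₂) (x₃ := x₃) hW hZ₁ hZ₂ hP
  rw [← condEnt_stepDist_Z₂ (x₁ := x₁) (x₂ := x₂) (x₃ := x₃) hW hZ₁ hZ₂ hP
    (fun ω y z => (C ω, x₃ ω + z)), ← condEnt_prod hS.1]
  exact condEnt_congr hS.1 _ (fun c b => (b.1 - e₁ c, b.2 - e₂ c - (b.1 - e₁ c)))
    (fun c b => (e₁ c + b.1, e₂ c + b.1 + b.2))
    (fun s => by ext <;> simp only [h₁, h₂] <;> ring)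
    (fun s => by ext <;> simp only [h₁, h₂] <;> ring)

theorem condEnt_stepDist_Y₂ {C : Ω → γ} (e₂ : γ → ZMod q) (h₂ : ∀ ω, x₂ ω = e₂ (C ω)) :
    condEnt (stepDist P W pZ₁ pZ₂ x₁ x₂ x₃)
      (fun s => x₂ s.1 + x₃ s.1 + (s.2.2.1 + s.2.2.2)) (fun s => C s.1) =
    condEnt (stepDist P W pZ₁ pZ₂ x₁ x₂ x₃) (fun s => x₃ s.1 + (s.2.2.1 + s.2.2.2))
      (fun s => C s.1) := by
  have hS := stepDist_mem_stdSimplex (x₁ := x₁) (x₂ := x₂) (x₃ := x₃) hW hZ₁ hZ₂ hP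
  exact condEnt_congr hS.1 _ (fun c b => b - e₂ c) (fun c b => e₂ c + b)
    (fun s => by simp only [h₂]; ring) (fun s => by simp only [h₂]; ring)

theorem ent_stepDist_X₃Z₁₂ : ent (stepDist P W pZ₁ pZ₂ x₁ x₂ x₃)
    (fun s => x₃ s.1 + (s.2.2.1 + s.2.2.2)) = entropy (conv (law P x₃) (conv pZ₁ pZ₂)) := by
  have h : law (stepDist P W pZ₁ pZ₂ x₁ x₂ x₃) (fun s => x₃ s.1) = law P x₃ := by
    rw [law_comp (stepDist P W pZ₁ pZ₂ x₁ x₂ x₃) Prod.fst x₃, law_stepDist_fst hW hZ₁ hZ₂]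
  rw [ent, ← h, law_add_eq (X := fun s : Ω × Y × ZMod q × ZMod q => x₃ s.1)
    (Z := fun s => s.2.2.1 + s.2.2.2) (g := conv pZ₁ pZ₂) fun F => ?_]
  rw [sum_stepDist_mul, sum_stepDist_mul]
  simp [← Finset.sum_mul, sum_conv_mul, hZ₁.2, hZ₂.2]

/-- Disintegrating X₃ over V writes the triple as a mixture of points `bcPoint`. The alphabet of V
may be huge here, since it includes the past outputs; only the triple is retained. -/
theorem mem_bcHull_stepDist (V : Ω → γ) : (law P x₃,
    condEnt (stepDist P W pZ₁ pZ₂ x₁ x₂ x₃) (fun s => x₃ s.1 + s.2.2.1) (fun s => V s.1),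
    condEnt (stepDist P W pZ₁ pZ₂ x₁ x₂ x₃) (fun s => x₃ s.1 + (s.2.2.1 + s.2.2.2))
      (fun s => V s.1)) ∈ bcHull pZ₁ pZ₂ := by
  obtain ⟨f, hf, hfv⟩ := exists_disintegration hP V x₃
  have hconv := conv_mem_stdSimplex hZ₁ hZ₂
  have hw := law_mem_stdSimplex hP V
  -- One computation serves both receivers: N is Z₁ or Z₁ + Z₂, and g is its law.
  have key : ∀ g : ZMod q → ℝ, g ∈ stdSimplex ℝ (ZMod q) →
      ∀ N : ZMod q → ZMod q → ZMod q, (∀ F : ZMod q → ℝ,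
        ∑ z₁, pZ₁ z₁ * ∑ z₂, pZ₂ z₂ * F (N z₁ z₂) = ∑ z, g z * F z) →
      condEnt (stepDist P W pZ₁ pZ₂ x₁ x₂ x₃) (fun s => x₃ s.1 + N s.2.2.1 s.2.2.2)
        (fun s => V s.1) = ∑ v, law P V v * entropy (conv (f v) g) := by
    intro g hg N hN
    rw [condEnt_eq_of_kernel (κ := fun v => conv (f v) g)
      (fun v => (conv_mem_stdSimplex (hf v) hg).2)]
    · rw [sum_stepDist_fst hW hZ₁ hZ₂ fun ω => entropy (conv (f (V ω)) g), sum_law_mul P V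
        fun v => entropy (conv (f v) g)]
    · refine law_prod_eq_of_forall fun F => ?_
      rw [sum_stepDist_fst hW hZ₁ hZ₂ fun ω => ∑ b, conv (f (V ω)) g b * F (V ω) b,
        sum_stepDist_mul]
      simp only [sum_conv_mul]
      simp only [← Finset.sum_mul, (hW.mem _ _ _).2, one_mul]
      rw [← sum_law_mul P V fun v => ∑ x, f v x * ∑ z, g z * F v (x + z)]
      have hN' := fun ω => hN fun z => F (V ω) (x₃ ω + z)
      simp only [hN']
      rw [← sum_law_mul P (fun ω => (V ω, x₃ ω)) fun u => ∑ z, g z * F u.1 (u.2 + z)]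
      simp only [Fintype.sum_prod_type, hfv, Finset.mul_sum, mul_assoc]
  have h1 := key pZ₁ hZ₁ (fun z _ => z) fun F => by simp [← Finset.sum_mul, hZ₂.2]
  have h2 := key (conv pZ₁ pZ₂) hconv (fun z z' => z + z') fun F => by rw [sum_conv_mul]
  have h3 : law P x₃ = fun x => ∑ v, law P V v * f v x := by
    funext x
    have := law_comp_injective P (fun ω => (x₃ ω, V ω)) (f := Prod.swap) Prod.swap_injective
    rw [law_eq_sum_snd P x₃ V x]
    exact Finset.sum_congr rfl fun v _ => by rw [← this, ← hfv]; rfl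
  rw [h1, h2, h3]
  exact mem_bcHull_of_mixture hw hf

end Step

/-! ### Growth of information in one channel use. -/

section Increment

variable {q : ℕ} [NeZero q] {Y : Type*} [Fintype Y]
  {W : ZMod q → ZMod q → ZMod q → Y → ℝ} {pZ₁ pZ₂ : ZMod q → ℝ}
  {Ω γ γ' : Type*} [Fintype Ω] [Fintype γ] [Fintype γ'] {P : Ω → ℝ} {x₁ x₂ x₃ : Ω → ZMod q}
  (hW : IsSymmetricMac W) (hZ₁ : pZ₁ ∈ stdSimplex ℝ (ZMod q))
  (hZ₂ : pZ₂ ∈ stdSimplex ℝ (ZMod q)) (hP : P ∈ stdSimplex ℝ Ω)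
include hW hZ₁ hZ₂

theorem sum_stepDist_law (e e' : ZMod q → ℝ) :
    ∑ x, law P x₃ x * (e x - e' x) =
      ∑ s, stepDist P W pZ₁ pZ₂ x₁ x₂ x₃ s * e (x₃ s.1) - ∑ ω, P ω * e' (x₃ ω) := by
  rw [sum_law_mul P x₃ fun x => e x - e' x,
    sum_stepDist_fst hW hZ₁ hZ₂ fun ω => e (x₃ ω), ← Finset.sum_sub_distrib]
  simp only [mul_sub]

include hP

/-- The subtracted entropy is lowered by conditioning on the full history, where it becomes the mean
of `noiseEnt` plus H(Z₁ + Z₂); the first is bounded by the mean of `outEnt₁` plus the same constant.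
-/
theorem increment₁ {C : Ω → γ} (C' : Ω → γ') (e₂ e₃ : γ → ZMod q) (h₂ : ∀ ω, x₂ ω = e₂ (C ω))
    (h₃ : ∀ ω, x₃ ω = e₃ (C ω)) :
    condEnt (stepDist P W pZ₁ pZ₂ x₁ x₂ x₃)
      (fun s => (s.2.1, x₂ s.1 + x₃ s.1 + (s.2.2.1 + s.2.2.2))) (fun s => C s.1) -
    condEnt (stepDist P W pZ₁ pZ₂ x₁ x₂ x₃)
      (fun s => (s.2.1, x₂ s.1 + x₃ s.1 + (s.2.2.1 + s.2.2.2))) (fun s => C' s.1) ≤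
      ∑ x, law P x₃ x * (outEnt₁ W x - noiseEnt W x) := by
  have hS := stepDist_mem_stdSimplex (x₁ := x₁) (x₂ := x₂) (x₃ := x₃) hW hZ₁ hZ₂ hP
  have h := condEnt_le_of_comp hS (fun s => (s.2.1, x₂ s.1 + x₃ s.1 + (s.2.2.1 + s.2.2.2)))
    (C := fun s => s.1) (C' := fun s => C' s.1) C' fun _ => rfl
  rw [condEnt_stepDist_Y₃Y₂ hW hZ₁ hZ₂ hP (C := fun ω => ω) x₂ x₃ (fun _ => rfl) fun _ => rfl,
    condEnt_stepDist_Y₃_fst hW hZ₁ hZ₂ hP] at h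
  rw [condEnt_stepDist_Y₃Y₂ hW hZ₁ hZ₂ hP e₂ e₃ h₂ h₃,
    sum_stepDist_law (x₁ := x₁) (x₂ := x₂) hW hZ₁ hZ₂]
  have h' := (isOutput_stepDist (P := P) (x₁ := x₁) (x₂ := x₂) (x₃ := x₃) hW hZ₁ hZ₂).condEnt_le₁
    hW hS (C := fun s => C s.1) e₂ e₃ (fun s => h₂ s.1) fun s => h₃ s.1
  linarith

theorem increment₂ {C : Ω → γ} (C' : Ω → γ') (e₁ e₃ : γ → ZMod q) (h₁ : ∀ ω, x₁ ω = e₁ (C ω))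
    (h₃ : ∀ ω, x₃ ω = e₃ (C ω)) :
    condEnt (stepDist P W pZ₁ pZ₂ x₁ x₂ x₃)
      (fun s => (s.2.1, x₁ s.1 + x₃ s.1 + s.2.2.1)) (fun s => C s.1) -
    condEnt (stepDist P W pZ₁ pZ₂ x₁ x₂ x₃)
      (fun s => (s.2.1, x₁ s.1 + x₃ s.1 + s.2.2.1)) (fun s => C' s.1) ≤
      ∑ x, law P x₃ x * (outEnt₂ W x - noiseEnt W x) := by
  have hS := stepDist_mem_stdSimplex (x₁ := x₁) (x₂ := x₂) (x₃ := x₃) hW hZ₁ hZ₂ hP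
  have h := condEnt_le_of_comp hS (fun s => (s.2.1, x₁ s.1 + x₃ s.1 + s.2.2.1))
    (C := fun s => s.1) (C' := fun s => C' s.1) C' fun _ => rfl
  rw [condEnt_stepDist_Y₃Y₁ hW hZ₁ hZ₂ hP (C := fun ω => ω) x₁ x₃ (fun _ => rfl) fun _ => rfl,
    condEnt_stepDist_Y₃_fst hW hZ₁ hZ₂ hP] at h
  rw [condEnt_stepDist_Y₃Y₁ hW hZ₁ hZ₂ hP e₁ e₃ h₁ h₃,
    sum_stepDist_law (x₁ := x₁) (x₂ := x₂) hW hZ₁ hZ₂]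
  have h' := (isOutput_stepDist (P := P) (x₁ := x₁) (x₂ := x₂) (x₃ := x₃) hW hZ₁ hZ₂).condEnt_le₂
    hW hS (C := fun s => C s.1) e₁ e₃ (fun s => h₁ s.1) fun s => h₃ s.1
  linarith

theorem increment₁₂ {C : Ω → γ} (C' : Ω → γ') (e₃ : γ → ZMod q)
    (h₃ : ∀ ω, x₃ ω = e₃ (C ω)) :
    condEnt (stepDist P W pZ₁ pZ₂ x₁ x₂ x₃) (fun s => s.2.1) (fun s => C s.1) -
    condEnt (stepDist P W pZ₁ pZ₂ x₁ x₂ x₃) (fun s => s.2.1) (fun s => C' s.1) ≤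
      ∑ x, law P x₃ x * (outEnt₁₂ W x - noiseEnt W x) := by
  have hS := stepDist_mem_stdSimplex (x₁ := x₁) (x₂ := x₂) (x₃ := x₃) hW hZ₁ hZ₂ hP
  have h := condEnt_le_of_comp hS (fun s => s.2.1)
    (C := fun s => s.1) (C' := fun s => C' s.1) C' fun _ => rfl
  rw [condEnt_stepDist_Y₃_fst hW hZ₁ hZ₂ hP] at h
  rw [sum_stepDist_law (x₁ := x₁) (x₂ := x₂) hW hZ₁ hZ₂]
  have h' := (isOutput_stepDist (P := P) (x₁ := x₁) (x₂ := x₂) (x₃ := x₃) hW hZ₁ hZ₂).condEnt_le₁₂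
    hW hS (C := fun s => C s.1) e₃ fun s => h₃ s.1
  linarith

/-- By degradedness both entropies carry the same summand H(Z₂). Given the full history, X₃ is known
as well and only H(Z₁) is left of the subtracted one. Here C plays the role of V. -/
theorem increment₃ {C : Ω → γ} (C' : Ω → γ') (e₁ e₂ : γ → ZMod q) (h₁ : ∀ ω, x₁ ω = e₁ (C ω))
    (h₂ : ∀ ω, x₂ ω = e₂ (C ω)) :
    condEnt (stepDist P W pZ₁ pZ₂ x₁ x₂ x₃)
      (fun s => (x₁ s.1 + x₃ s.1 + s.2.2.1, x₂ s.1 + x₃ s.1 + (s.2.2.1 + s.2.2.2)))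
      (fun s => C s.1) -
    condEnt (stepDist P W pZ₁ pZ₂ x₁ x₂ x₃)
      (fun s => (x₁ s.1 + x₃ s.1 + s.2.2.1, x₂ s.1 + x₃ s.1 + (s.2.2.1 + s.2.2.2)))
      (fun s => C' s.1) ≤
    condEnt (stepDist P W pZ₁ pZ₂ x₁ x₂ x₃) (fun s => x₃ s.1 + s.2.2.1) (fun s => C s.1) -
      entropy pZ₁ := by
  have hS := stepDist_mem_stdSimplex (x₁ := x₁) (x₂ := x₂) (x₃ := x₃) hW hZ₁ hZ₂ hP
  have h := condEnt_le_of_comp hS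
    (fun s => (x₁ s.1 + x₃ s.1 + s.2.2.1, x₂ s.1 + x₃ s.1 + (s.2.2.1 + s.2.2.2)))
    (C := fun s => s.1) (C' := fun s => C' s.1) C' fun _ => rfl
  have h' : condEnt (stepDist P W pZ₁ pZ₂ x₁ x₂ x₃) (fun s => x₃ s.1 + s.2.2.1)
      (fun s => s.1) = entropy pZ₁ := by
    rw [← condEnt_stepDist_Z₁ (x₁ := x₁) (x₂ := x₂) (x₃ := x₃) hW hZ₁ hZ₂ hP fun ω _ => ω]
    exact condEnt_congr hS.1 _ (fun c b => b - x₃ c) (fun c b => x₃ c + b)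
      (fun s => by simp) fun s => rfl
  rw [condEnt_stepDist_Y₁Y₂ hW hZ₁ hZ₂ hP (C := fun ω => ω) x₁ x₂ (fun _ => rfl) fun _ => rfl,
    h'] at h
  rw [condEnt_stepDist_Y₁Y₂ hW hZ₁ hZ₂ hP e₁ e₂ h₁ h₂]
  linarith

/-- The first entropy increases when C is dropped after x₂ has been subtracted; the second decreases
when C' is refined to V. Enlarging V by the outputs of user 1 lets the same V serve in `increment₃`.
-/
theorem increment₄ {δ : Type*} [Fintype δ] {C : Ω → γ} {C' : Ω → γ'} {V : Ω → δ}
    (e₂ : γ → ZMod q) (e₂' : δ → ZMod q) (k : δ → γ') (h₂ : ∀ ω, x₂ ω = e₂ (C ω))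
    (h₂' : ∀ ω, x₂ ω = e₂' (V ω)) (hk : ∀ ω, C' ω = k (V ω)) :
    condEnt (stepDist P W pZ₁ pZ₂ x₁ x₂ x₃)
      (fun s => x₂ s.1 + x₃ s.1 + (s.2.2.1 + s.2.2.2)) (fun s => C s.1) -
    condEnt (stepDist P W pZ₁ pZ₂ x₁ x₂ x₃)
      (fun s => x₂ s.1 + x₃ s.1 + (s.2.2.1 + s.2.2.2)) (fun s => C' s.1) ≤
    entropy (conv (law P x₃) (conv pZ₁ pZ₂)) -
      condEnt (stepDist P W pZ₁ pZ₂ x₁ x₂ x₃) (fun s => x₃ s.1 + (s.2.2.1 + s.2.2.2))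
        (fun s => V s.1) := by
  have hS := stepDist_mem_stdSimplex (x₁ := x₁) (x₂ := x₂) (x₃ := x₃) hW hZ₁ hZ₂ hP
  have h := condEnt_le_of_comp hS (fun s => x₂ s.1 + x₃ s.1 + (s.2.2.1 + s.2.2.2))
    (C := fun s => V s.1) (C' := fun s => C' s.1) k fun s => hk s.1
  have h' := condEnt_le_ent hS (fun s => x₃ s.1 + (s.2.2.1 + s.2.2.2)) (fun s => C s.1)
  rw [condEnt_stepDist_Y₂ hW hZ₁ hZ₂ hP e₂' h₂'] at h
  rw [condEnt_stepDist_Y₂ hW hZ₁ hZ₂ hP e₂ h₂]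
  rw [ent_stepDist_X₃Z₁₂ hW hZ₁ hZ₂ hP] at h'
  linarith

end Increment

/-! ### Concavity of the single-letter bounds -/

section Concavity

variable {q : ℕ} [NeZero q] {pZ₁ pZ₂ : ZMod q → ℝ}

theorem stdSimplex_of_mem_bcHull {t : (ZMod q → ℝ) × ℝ × ℝ} (ht : t ∈ bcHull pZ₁ pZ₂) :
    t.1 ∈ stdSimplex ℝ (ZMod q) := by
  have h : bcHull pZ₁ pZ₂ ⊆ LinearMap.fst ℝ (ZMod q → ℝ) (ℝ × ℝ) ⁻¹' stdSimplex ℝ (ZMod q) := by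
    refine convexHull_min ?_ ((convex_stdSimplex ℝ (ZMod q)).linear_preimage _)
    rintro _ ⟨f, hf, rfl⟩
    exact hf
  exact h ht

theorem concaveOn_entropy_conv {g : ZMod q → ℝ} (hg : g ∈ stdSimplex ℝ (ZMod q)) :
    ConcaveOn ℝ (bcHull pZ₁ pZ₂) fun t => entropy (conv t.1 g) := by
  refine ⟨convex_convexHull _ _, fun t ht t' ht' a b ha hb hab => ?_⟩
  have h := concaveOn_entropy.2 (conv_mem_stdSimplex (stdSimplex_of_mem_bcHull ht) hg).1
    (conv_mem_stdSimplex (stdSimplex_of_mem_bcHull ht') hg).1 ha hb hab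
  refine h.trans (le_of_eq (congrArg entropy ?_))
  funext s
  simp only [conv, Pi.add_apply, Pi.smul_apply, smul_eq_mul, Prod.fst_add, Prod.smul_fst, add_mul,
    Finset.sum_add_distrib, Finset.mul_sum, mul_assoc]

/-- The update of a running mean: x averages n uses, y is the next one, and concavity lets a bound n
φ(x) absorb one more term. Iterating it replaces a time-sharing variable. -/
theorem nat_mul_add_le_of_concaveOn {E : Type*} [AddCommGroup E] [Module ℝ E] {s : Set E}
    {φ : E → ℝ} (h : ConcaveOn ℝ s φ) {x y : E} (hx : x ∈ s) (hy : y ∈ s) (n : ℕ) {u v w : ℝ}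
    (hu : u ≤ n * φ x) (hv : v ≤ φ y) (hw : w = u + v) : w ≤ ((n + 1 : ℕ) : ℝ) *
      φ (((n : ℝ) / (n + 1)) • x + ((1 : ℝ) / (n + 1)) • y) := by
  have hn : (0 : ℝ) < n + 1 := by positivity
  have := h.2 hx hy (show (0 : ℝ) ≤ n / (n + 1) by positivity)
    (show (0 : ℝ) ≤ 1 / (n + 1) by positivity) (by field_simp)
  have h' := mul_le_mul_of_nonneg_left this hn.le
  simp only [smul_eq_mul] at h'
  have e : ((n : ℝ) + 1) * ((n : ℝ) / (n + 1) * φ x + (1 : ℝ) / (n + 1) * φ y) =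
      n * φ x + φ y := by field_simp
  rw [e] at h'
  push_cast
  linarith

end Concavity

/-! ### The distribution of messages and outputs -/

section Path

variable {q : ℕ} [NeZero q] {Y A B C D : Type*} [Fintype Y] [Fintype A] [Fintype B] [Fintype C]
  [Fintype D] {W : ZMod q → ZMod q → ZMod q → Y → ℝ} {pZ₁ pZ₂ : ZMod q → ℝ}

/-- The messages, and the outputs of the three users in `n` channel uses. -/
abbrev History (q : ℕ) (Y A B C D : Type*) (n : ℕ) : Type _ :=
  (A × B × C × D) × (Fin n → ZMod q) × (Fin n → ZMod q) × (Fin n → Y)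

/-- Causal encoders for an unlimited number of channel uses. -/
structure Encoders (q : ℕ) (Y A B C D : Type*) where
  /-- encoder of user 1 -/
  f₁ : (i : ℕ) → A → (Fin i → ZMod q) → ZMod q
  /-- encoder of user 2 -/
  f₂ : (i : ℕ) → B → (Fin i → ZMod q) → ZMod q
  /-- encoder of user 3 -/
  f₃ : (i : ℕ) → C → D → (Fin i → Y) → ZMod q

namespace Encoders

variable (E : Encoders q Y A B C D)

/-- The next input of user 1. -/
def x₁ (n : ℕ) (h : History q Y A B C D n) : ZMod q := E.f₁ n h.1.1 h.2.1

/-- The next input of user 2. -/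
def x₂ (n : ℕ) (h : History q Y A B C D n) : ZMod q := E.f₂ n h.1.2.1 h.2.2.1

/-- The next input of user 3. -/
def x₃ (n : ℕ) (h : History q Y A B C D n) : ZMod q := E.f₃ n h.1.2.2.1 h.1.2.2.2 h.2.2.2

/-- The joint law of messages (with law `μ`) and outputs in `n` channel uses. -/
def pathDist (W : ZMod q → ZMod q → ZMod q → Y → ℝ) (pZ₁ pZ₂ : ZMod q → ℝ)
    (μ : A × B × C × D → ℝ) (n : ℕ) (h : History q Y A B C D n) : ℝ :=
  μ h.1 * ∏ i : Fin n, channel W pZ₁ pZ₂ (E.f₁ i h.1.1 (past h.2.1 i))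
    (E.f₂ i h.1.2.1 (past h.2.2.1 i)) (E.f₃ i h.1.2.2.1 h.1.2.2.2 (past h.2.2.2 i))
    (h.2.1 i) (h.2.2.1 i) (h.2.2.2 i)

/-- Extend a history by one channel use, given `Y₃` and the noises. -/
def next (n : ℕ) : (History q Y A B C D n × Y × ZMod q × ZMod q) ≃ History q Y A B C D (n + 1) where
  toFun s := (s.1.1, Fin.snoc s.1.2.1 (E.x₁ n s.1 + E.x₃ n s.1 + s.2.2.1),
    Fin.snoc s.1.2.2.1 (E.x₂ n s.1 + E.x₃ n s.1 + (s.2.2.1 + s.2.2.2)),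
    Fin.snoc s.1.2.2.2 s.2.1)
  -- The noises are recovered from the outputs as Z₁ = Y₁ - x₁ - x₃ and Z₂ = (Y₂ - x₂) - (Y₁ - x₁).
  invFun h :=
    let h' : History q Y A B C D n := (h.1, Fin.init h.2.1, Fin.init h.2.2.1, Fin.init h.2.2.2)
    (h', h.2.2.2 (Fin.last n), h.2.1 (Fin.last n) - E.x₁ n h' - E.x₃ n h',
      h.2.2.1 (Fin.last n) - E.x₂ n h' - h.2.1 (Fin.last n) + E.x₁ n h')
  left_inv s := by
    obtain ⟨⟨m, y₁, y₂, y₃⟩, y, z₁, z₂⟩ := s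
    simp only [Fin.init_snoc, Fin.snoc_last, Prod.mk.injEq, true_and]
    constructor <;> ring
  right_inv h := by
    obtain ⟨m, y₁, y₂, y₃⟩ := h
    refine Prod.ext rfl (Prod.ext ?_ (Prod.ext ?_ ?_))
    · dsimp only
      conv_rhs => rw [← Fin.snoc_init_self y₁]
      congr 1
      ring
    · dsimp only
      conv_rhs => rw [← Fin.snoc_init_self y₂]
      congr 1
      ring
    · exact Fin.snoc_init_self y₃

theorem past_snoc_castSucc {α : Type*} {n : ℕ} (y : Fin n → α) (a : α) (i : Fin n) :
    past (Fin.snoc y a : Fin (n + 1) → α) i.castSucc = past y i := by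
  funext j
  exact Fin.snoc_castSucc (α := fun _ => α) a y (Fin.castLE i.isLt.le j)

theorem past_snoc_last {α : Type*} {n : ℕ} (y : Fin n → α) (a : α) :
    past (Fin.snoc y a : Fin (n + 1) → α) (Fin.last n) = y := by
  funext j
  exact Fin.snoc_castSucc (α := fun _ => α) a y j

variable {μ : A × B × C × D → ℝ}

/-- Causality and lack of memory: the first n factors ignore the new outputs, and the last one is
the law of a single use with inputs computed from the history. The converse can thus proceed by
induction on the number of uses. -/
theorem pathDist_next (n : ℕ) (s : History q Y A B C D n × Y × ZMod q × ZMod q) :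
    E.pathDist W pZ₁ pZ₂ μ (n + 1) (E.next n s) =
      stepDist (E.pathDist W pZ₁ pZ₂ μ n) W pZ₁ pZ₂ (E.x₁ n) (E.x₂ n) (E.x₃ n) s := by
  obtain ⟨⟨m, y₁, y₂, y₃⟩, y, z₁, z₂⟩ := s
  simp only [pathDist, stepDist, next, Equiv.coe_fn_mk, Fin.prod_univ_castSucc, Fin.snoc_castSucc,
    Fin.snoc_last, past_snoc_castSucc]
  rw [← mul_assoc, mul_assoc _ (pZ₁ z₁), mul_assoc _ (W _ _ _ _)]
  refine congrArg₂ (· * ·) rfl ?_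
  have e₁ := past_snoc_last y₁ (E.x₁ n (m, y₁, y₂, y₃) + E.x₃ n (m, y₁, y₂, y₃) + z₁)
  have e₂ := past_snoc_last y₂ (E.x₂ n (m, y₁, y₂, y₃) + E.x₃ n (m, y₁, y₂, y₃) + (z₁ + z₂))
  have e₃ := past_snoc_last y₃ y
  have e₁' : E.f₁ (Fin.last n) m.1 (past (Fin.snoc y₁ (E.x₁ n (m, y₁, y₂, y₃) +
      E.x₃ n (m, y₁, y₂, y₃) + z₁) : Fin (n + 1) → ZMod q) (Fin.last n)) =
      E.x₁ n (m, y₁, y₂, y₃) := congrArg (E.f₁ n m.1) e₁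
  have e₂' : E.f₂ (Fin.last n) m.2.1 (past (Fin.snoc y₂ (E.x₂ n (m, y₁, y₂, y₃) +
      E.x₃ n (m, y₁, y₂, y₃) + (z₁ + z₂)) : Fin (n + 1) → ZMod q) (Fin.last n)) =
      E.x₂ n (m, y₁, y₂, y₃) := congrArg (E.f₂ n m.2.1) e₂
  have e₃' : E.f₃ (Fin.last n) m.2.2.1 m.2.2.2 (past (Fin.snoc y₃ y : Fin (n + 1) → Y)
      (Fin.last n)) = E.x₃ n (m, y₁, y₂, y₃) := congrArg (E.f₃ n m.2.2.1 m.2.2.2) e₃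
  rw [channel, e₁', e₂', e₃', mul_assoc]
  congr 3 <;> ring

theorem law_next (n : ℕ) :
    law (stepDist (E.pathDist W pZ₁ pZ₂ μ n) W pZ₁ pZ₂ (E.x₁ n) (E.x₂ n) (E.x₃ n)) (E.next n) =
      E.pathDist W pZ₁ pZ₂ μ (n + 1) := by
  funext h
  rw [law_equiv, ← pathDist_next, Equiv.apply_symm_apply]

end Encoders

end Path

/-! ### Trivial observations. -/

section Constant

variable {Ω α β γ : Type*} [Fintype Ω] [Fintype α] [Fintype β] [Fintype γ] {P : Ω → ℝ}

/-- Starts the induction on the number of uses: before the first use all output sequences are empty.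
-/
theorem condMutualInfo_nonpos_of_subsingleton [Subsingleton β] (hP : P ∈ stdSimplex ℝ Ω)
    (A : Ω → α) (U : Ω → β) (C : Ω → γ) : condMutualInfo P A U C ≤ 0 := by
  have h : condEnt P U C ≤ 0 := by
    rw [condEnt, sub_nonpos]
    have hne : Nonempty Ω := by
      by_contra h
      have := not_nonempty_iff.1 h
      simpa using hP.2
    obtain ⟨ω⟩ := hne
    exact ent_mono hP.1 (fun c => (c, U ω)) fun ω' => Prod.ext rfl (Subsingleton.elim _ _)
  rw [condMutualInfo_eq_condEnt hP.1]
  linarith [condEnt_nonneg hP.1 U fun ω => (A ω, C ω)]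

end Constant

/-! ### Concavity of the bounds on `bcHull`. -/

section Concavity

variable {q : ℕ} [NeZero q] {pZ₁ pZ₂ : ZMod q → ℝ}

theorem concaveOn_bcHull_sum (c : ZMod q → ℝ) :
    ConcaveOn ℝ (bcHull pZ₁ pZ₂) fun t => ∑ x, t.1 x * c x := by
  refine ⟨convex_convexHull _ _, fun t _ t' _ a b _ _ _ => le_of_eq ?_⟩
  simp only [Prod.fst_add, Prod.smul_fst, Pi.add_apply, Pi.smul_apply, smul_eq_mul, add_mul,
    Finset.sum_add_distrib, Finset.mul_sum, mul_assoc]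

theorem concaveOn_bcHull_fst (c : ℝ) :
    ConcaveOn ℝ (bcHull pZ₁ pZ₂) fun t => t.2.1 - c := by
  refine ⟨convex_convexHull _ _, fun t _ t' _ a b _ _ hab => le_of_eq ?_⟩
  simp only [Prod.fst_add, Prod.smul_fst, Prod.snd_add, Prod.smul_snd, smul_eq_mul]
  linear_combination -c * hab

theorem concaveOn_bcHull_snd (hZ₁ : pZ₁ ∈ stdSimplex ℝ (ZMod q))
    (hZ₂ : pZ₂ ∈ stdSimplex ℝ (ZMod q)) :
    ConcaveOn ℝ (bcHull pZ₁ pZ₂) fun t => entropy (conv t.1 (conv pZ₁ pZ₂)) - t.2.2 := by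
  have h := concaveOn_entropy_conv (pZ₁ := pZ₁) (pZ₂ := pZ₂) (conv_mem_stdSimplex hZ₁ hZ₂)
  refine ⟨h.1, fun t ht t' ht' a b ha hb hab => ?_⟩
  have := h.2 ht ht' ha hb hab
  simp only [Prod.snd_add, Prod.smul_snd, smul_eq_mul] at this ⊢
  linarith

end Concavity

/-! ### Information about messages over many uses. -/

section Path

variable {q : ℕ} [NeZero q] {Y A B C D : Type*} [Fintype Y] [Fintype A] [Fintype B] [Fintype C]
  [Fintype D] {W : ZMod q → ZMod q → ZMod q → Y → ℝ} {pZ₁ pZ₂ : ZMod q → ℝ}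

namespace Encoders

variable (E : Encoders q Y A B C D) {μ : A × B × C × D → ℝ}
  (hW : IsSymmetricMac W) (hZ₁ : pZ₁ ∈ stdSimplex ℝ (ZMod q))
  (hZ₂ : pZ₂ ∈ stdSimplex ℝ (ZMod q)) (hμ : μ ∈ stdSimplex ℝ (A × B × C × D))
include hW hZ₁ hZ₂ hμ

theorem pathDist_mem_stdSimplex (n : ℕ) :
    E.pathDist W pZ₁ pZ₂ μ n ∈ stdSimplex ℝ (History q Y A B C D n) := by
  induction n with
  | zero =>
    refine ⟨fun h => by simpa [pathDist] using hμ.1 h.1, ?_⟩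
    simp only [pathDist, Finset.univ_eq_empty, Finset.prod_empty, mul_one]
    rw [Fintype.sum_prod_type]
    simpa using hμ.2
  | succ n ih =>
    rw [← law_next]
    exact law_mem_stdSimplex (stepDist_mem_stdSimplex hW hZ₁ hZ₂ ih) _

/-- User 3 is given the outputs of user 2 as a genie. Together with the other messages, the
observation then determines the next x₂ and x₃, as `increment₁` requires. -/
theorem information_step₁ (n : ℕ) :
    condMutualInfo (E.pathDist W pZ₁ pZ₂ μ (n + 1)) (fun h => h.1.1) (fun h => (h.2.2.2, h.2.2.1))
      (fun h => h.1.2) ≤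
    condMutualInfo (E.pathDist W pZ₁ pZ₂ μ n) (fun h => h.1.1) (fun h => (h.2.2.2, h.2.2.1))
      (fun h => h.1.2) +
    (∑ x, law (E.pathDist W pZ₁ pZ₂ μ n) (E.x₃ n) x * (outEnt₁ W x - noiseEnt W x)) := by
  have hP := E.pathDist_mem_stdSimplex hW hZ₁ hZ₂ hμ n
  have hS := stepDist_mem_stdSimplex (x₁ := E.x₁ n) (x₂ := E.x₂ n) (x₃ := E.x₃ n) hW hZ₁ hZ₂ hP
  have hchain := condMutualInfo_chain hS.1 (fun s => (fun h : History q Y A B C D n => h.1.1) s.1)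
    (U := fun s => (fun h : History q Y A B C D n => (h.2.2.2, h.2.2.1)) s.1)
    (B := fun s => (s.2.1, E.x₂ n s.1 + E.x₃ n s.1 + (s.2.2.1 + s.2.2.2)))
    (U' := fun s => (fun h : History q Y A B C D (n + 1) => (h.2.2.2, h.2.2.1)) (E.next n s))
    (fun s => (fun h : History q Y A B C D n => h.1.2) s.1)
    (fun u b => (Fin.snoc u.1 b.1, Fin.snoc u.2 b.2)) (fun e => ((Fin.init e.1, Fin.init e.2), (e.1 (Fin.last n), e.2 (Fin.last n)))) (fun _ => rfl) (fun u b => by simp)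
  rw [← condMutualInfo_law _ Prod.fst (fun h : History q Y A B C D n => h.1.1)
    (fun h : History q Y A B C D n => (h.2.2.2, h.2.2.1)) (fun h : History q Y A B C D n => h.1.2),
    law_stepDist_fst hW hZ₁ hZ₂] at hchain
  rw [← law_next, condMutualInfo_law]
  refine hchain.le.trans (add_le_add_right ?_ _)
  exact increment₁ hW hZ₁ hZ₂ hP (C := fun h => (h.1.2, (h.2.2.2, h.2.2.1)))
    (fun h => ((h.1.1, h.1.2), (h.2.2.2, h.2.2.1))) (fun c => E.f₂ n c.1.1 c.2.2)
    (fun c => E.f₃ n c.1.2.1 c.1.2.2 c.2.1) (fun _ => rfl) fun _ => rfl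

/-- Here the genie reveals the outputs of user 1, so that x₁ and x₃ are determined. -/
theorem information_step₂ (n : ℕ) :
    condMutualInfo (E.pathDist W pZ₁ pZ₂ μ (n + 1)) (fun h => h.1.2.1) (fun h => (h.2.2.2, h.2.1))
      (fun h => (h.1.1, h.1.2.2)) ≤
    condMutualInfo (E.pathDist W pZ₁ pZ₂ μ n) (fun h => h.1.2.1) (fun h => (h.2.2.2, h.2.1))
      (fun h => (h.1.1, h.1.2.2)) +
    (∑ x, law (E.pathDist W pZ₁ pZ₂ μ n) (E.x₃ n) x * (outEnt₂ W x - noiseEnt W x)) := by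
  have hP := E.pathDist_mem_stdSimplex hW hZ₁ hZ₂ hμ n
  have hS := stepDist_mem_stdSimplex (x₁ := E.x₁ n) (x₂ := E.x₂ n) (x₃ := E.x₃ n) hW hZ₁ hZ₂ hP
  have hchain := condMutualInfo_chain hS.1 (fun s => (fun h : History q Y A B C D n => h.1.2.1) s.1)
    (U := fun s => (fun h : History q Y A B C D n => (h.2.2.2, h.2.1)) s.1)
    (B := fun s => (s.2.1, E.x₁ n s.1 + E.x₃ n s.1 + s.2.2.1))
    (U' := fun s => (fun h : History q Y A B C D (n + 1) => (h.2.2.2, h.2.1)) (E.next n s))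
    (fun s => (fun h : History q Y A B C D n => (h.1.1, h.1.2.2)) s.1)
    (fun u b => (Fin.snoc u.1 b.1, Fin.snoc u.2 b.2)) (fun e => ((Fin.init e.1, Fin.init e.2), (e.1 (Fin.last n), e.2 (Fin.last n)))) (fun _ => rfl) (fun u b => by simp)
  rw [← condMutualInfo_law _ Prod.fst (fun h : History q Y A B C D n => h.1.2.1)
    (fun h : History q Y A B C D n => (h.2.2.2, h.2.1)) (fun h : History q Y A B C D n => (h.1.1, h.1.2.2)),
    law_stepDist_fst hW hZ₁ hZ₂] at hchain
  rw [← law_next, condMutualInfo_law]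
  refine hchain.le.trans (add_le_add_right ?_ _)
  exact increment₂ hW hZ₁ hZ₂ hP (C := fun h => ((h.1.1, h.1.2.2), (h.2.2.2, h.2.1)))
    (fun h => ((h.1.2.1, (h.1.1, h.1.2.2)), (h.2.2.2, h.2.1))) (fun c => E.f₁ n c.1.1 c.2.2)
    (fun c => E.f₃ n c.1.2.1 c.1.2.2 c.2.1) (fun _ => rfl) fun _ => rfl

/-- No genie: only x₃ has to be determined, and user 3 computes it from its own messages and
outputs. -/
theorem information_step₁₂ (n : ℕ) :
    condMutualInfo (E.pathDist W pZ₁ pZ₂ μ (n + 1)) (fun h => (h.1.1, h.1.2.1)) (fun h => h.2.2.2)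
      (fun h => h.1.2.2) ≤
    condMutualInfo (E.pathDist W pZ₁ pZ₂ μ n) (fun h => (h.1.1, h.1.2.1)) (fun h => h.2.2.2)
      (fun h => h.1.2.2) +
    (∑ x, law (E.pathDist W pZ₁ pZ₂ μ n) (E.x₃ n) x * (outEnt₁₂ W x - noiseEnt W x)) := by
  have hP := E.pathDist_mem_stdSimplex hW hZ₁ hZ₂ hμ n
  have hS := stepDist_mem_stdSimplex (x₁ := E.x₁ n) (x₂ := E.x₂ n) (x₃ := E.x₃ n) hW hZ₁ hZ₂ hP
  have hchain := condMutualInfo_chain hS.1 (fun s => (fun h : History q Y A B C D n => (h.1.1, h.1.2.1)) s.1)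
    (U := fun s => (fun h : History q Y A B C D n => h.2.2.2) s.1)
    (B := fun s => s.2.1)
    (U' := fun s => (fun h : History q Y A B C D (n + 1) => h.2.2.2) (E.next n s))
    (fun s => (fun h : History q Y A B C D n => h.1.2.2) s.1)
    (fun u b => Fin.snoc u b) (fun e => (Fin.init e, e (Fin.last n))) (fun _ => rfl) (fun u b => by simp)
  rw [← condMutualInfo_law _ Prod.fst (fun h : History q Y A B C D n => (h.1.1, h.1.2.1))
    (fun h : History q Y A B C D n => h.2.2.2) (fun h : History q Y A B C D n => h.1.2.2),
    law_stepDist_fst hW hZ₁ hZ₂] at hchain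
  rw [← law_next, condMutualInfo_law]
  refine hchain.le.trans (add_le_add_right ?_ _)
  exact increment₁₂ hW hZ₁ hZ₂ hP (C := fun h => (h.1.2.2, h.2.2.2))
    (fun h => (((h.1.1, h.1.2.1), h.1.2.2), h.2.2.2)) (fun c => E.f₃ n c.1.1 c.1.2 c.2)
    fun _ => rfl

/-- Giving the outputs and the messages of both users 1 and 2 determines x₁ and x₂. What is known
before the next use is the auxiliary variable V. -/
theorem information_step₃ (n : ℕ) :
    condMutualInfo (E.pathDist W pZ₁ pZ₂ μ (n + 1)) (fun h => h.1.2.2.1) (fun h => (h.2.1, h.2.2.1))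
      (fun h => (h.1.1, h.1.2.1, h.1.2.2.2)) ≤
    condMutualInfo (E.pathDist W pZ₁ pZ₂ μ n) (fun h => h.1.2.2.1) (fun h => (h.2.1, h.2.2.1))
      (fun h => (h.1.1, h.1.2.1, h.1.2.2.2)) +
    (condEnt (stepDist (E.pathDist W pZ₁ pZ₂ μ n) W pZ₁ pZ₂ (E.x₁ n) (E.x₂ n) (E.x₃ n))
      (fun s => E.x₃ n s.1 + s.2.2.1)
      (fun s => ((s.1.1.1, s.1.1.2.1, s.1.1.2.2.2), (s.1.2.1, s.1.2.2.1))) - entropy pZ₁) := by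
  have hP := E.pathDist_mem_stdSimplex hW hZ₁ hZ₂ hμ n
  have hS := stepDist_mem_stdSimplex (x₁ := E.x₁ n) (x₂ := E.x₂ n) (x₃ := E.x₃ n) hW hZ₁ hZ₂ hP
  have hchain := condMutualInfo_chain hS.1 (fun s => (fun h : History q Y A B C D n => h.1.2.2.1) s.1)
    (U := fun s => (fun h : History q Y A B C D n => (h.2.1, h.2.2.1)) s.1)
    (B := fun s => (E.x₁ n s.1 + E.x₃ n s.1 + s.2.2.1, E.x₂ n s.1 + E.x₃ n s.1 + (s.2.2.1 + s.2.2.2)))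
    (U' := fun s => (fun h : History q Y A B C D (n + 1) => (h.2.1, h.2.2.1)) (E.next n s))
    (fun s => (fun h : History q Y A B C D n => (h.1.1, h.1.2.1, h.1.2.2.2)) s.1)
    (fun u b => (Fin.snoc u.1 b.1, Fin.snoc u.2 b.2)) (fun e => ((Fin.init e.1, Fin.init e.2), (e.1 (Fin.last n), e.2 (Fin.last n)))) (fun _ => rfl) (fun u b => by simp)
  rw [← condMutualInfo_law _ Prod.fst (fun h : History q Y A B C D n => h.1.2.2.1)
    (fun h : History q Y A B C D n => (h.2.1, h.2.2.1)) (fun h : History q Y A B C D n => (h.1.1, h.1.2.1, h.1.2.2.2)),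
    law_stepDist_fst hW hZ₁ hZ₂] at hchain
  rw [← law_next, condMutualInfo_law]
  refine hchain.le.trans (add_le_add_right ?_ _)
  exact increment₃ hW hZ₁ hZ₂ hP
    (C := fun h => ((h.1.1, h.1.2.1, h.1.2.2.2), (h.2.1, h.2.2.1)))
    (fun h => ((h.1.2.2.1, (h.1.1, h.1.2.1, h.1.2.2.2)), (h.2.1, h.2.2.1)))
    (fun c => E.f₁ n c.1.1 c.2.1) (fun c => E.f₂ n c.1.2.1 c.2.2) (fun _ => rfl) fun _ => rfl

/-- User 2 gets no genie; the conditioning variable V of `information_step₃` enters only through the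
negative term, so that both bounds belong to one triple of `bcHull`. -/
theorem information_step₄ (n : ℕ) :
    condMutualInfo (E.pathDist W pZ₁ pZ₂ μ (n + 1)) (fun h => h.1.2.2.2) (fun h => h.2.2.1)
      (fun h => h.1.2.1) ≤
    condMutualInfo (E.pathDist W pZ₁ pZ₂ μ n) (fun h => h.1.2.2.2) (fun h => h.2.2.1)
      (fun h => h.1.2.1) +
    (entropy (conv (law (E.pathDist W pZ₁ pZ₂ μ n) (E.x₃ n)) (conv pZ₁ pZ₂)) -
      condEnt (stepDist (E.pathDist W pZ₁ pZ₂ μ n) W pZ₁ pZ₂ (E.x₁ n) (E.x₂ n) (E.x₃ n))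
      (fun s => E.x₃ n s.1 + (s.2.2.1 + s.2.2.2))
      (fun s => ((s.1.1.1, s.1.1.2.1, s.1.1.2.2.2), (s.1.2.1, s.1.2.2.1)))) := by
  have hP := E.pathDist_mem_stdSimplex hW hZ₁ hZ₂ hμ n
  have hS := stepDist_mem_stdSimplex (x₁ := E.x₁ n) (x₂ := E.x₂ n) (x₃ := E.x₃ n) hW hZ₁ hZ₂ hP
  have hchain := condMutualInfo_chain hS.1 (fun s => (fun h : History q Y A B C D n => h.1.2.2.2) s.1)
    (U := fun s => (fun h : History q Y A B C D n => h.2.2.1) s.1)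
    (B := fun s => E.x₂ n s.1 + E.x₃ n s.1 + (s.2.2.1 + s.2.2.2))
    (U' := fun s => (fun h : History q Y A B C D (n + 1) => h.2.2.1) (E.next n s))
    (fun s => (fun h : History q Y A B C D n => h.1.2.1) s.1)
    (fun u b => Fin.snoc u b) (fun e => (Fin.init e, e (Fin.last n))) (fun _ => rfl) (fun u b => by simp)
  rw [← condMutualInfo_law _ Prod.fst (fun h : History q Y A B C D n => h.1.2.2.2)
    (fun h : History q Y A B C D n => h.2.2.1) (fun h : History q Y A B C D n => h.1.2.1),
    law_stepDist_fst hW hZ₁ hZ₂] at hchain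
  rw [← law_next, condMutualInfo_law]
  refine hchain.le.trans (add_le_add_right ?_ _)
  exact increment₄ hW hZ₁ hZ₂ hP (C := fun h => (h.1.2.1, h.2.2.1))
    (C' := fun h => ((h.1.2.2.2, h.1.2.1), h.2.2.1))
    (V := fun h => ((h.1.1, h.1.2.1, h.1.2.2.2), (h.2.1, h.2.2.1)))
    (fun c => E.f₂ n c.1 c.2) (fun v => E.f₂ n v.1.2.1 v.2.2)
    (fun v => ((v.1.2.2, v.1.2.1), v.2.2)) (fun _ => rfl) (fun _ => rfl) fun _ => rfl

/-- The information that users obtain about their messages is at most `n` times a single-letter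
quantity. -/
theorem exists_information_le (n : ℕ) : ∃ t ∈ bcHull pZ₁ pZ₂,
    condMutualInfo (E.pathDist W pZ₁ pZ₂ μ n) (fun h => h.1.1) (fun h => (h.2.2.2, h.2.2.1))
      (fun h => h.1.2) ≤ n * ∑ x, t.1 x * (outEnt₁ W x - noiseEnt W x) ∧
    condMutualInfo (E.pathDist W pZ₁ pZ₂ μ n) (fun h => h.1.2.1) (fun h => (h.2.2.2, h.2.1))
      (fun h => (h.1.1, h.1.2.2)) ≤ n * ∑ x, t.1 x * (outEnt₂ W x - noiseEnt W x) ∧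
    condMutualInfo (E.pathDist W pZ₁ pZ₂ μ n) (fun h => (h.1.1, h.1.2.1)) (fun h => h.2.2.2)
      (fun h => h.1.2.2) ≤ n * ∑ x, t.1 x * (outEnt₁₂ W x - noiseEnt W x) ∧
    condMutualInfo (E.pathDist W pZ₁ pZ₂ μ n) (fun h => h.1.2.2.1) (fun h => (h.2.1, h.2.2.1))
      (fun h => (h.1.1, h.1.2.1, h.1.2.2.2)) ≤ n * (t.2.1 - entropy pZ₁) ∧
    condMutualInfo (E.pathDist W pZ₁ pZ₂ μ n) (fun h => h.1.2.2.2) (fun h => h.2.2.1)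
      (fun h => h.1.2.1) ≤ n * (entropy (conv t.1 (conv pZ₁ pZ₂)) - t.2.2) := by
  induction n with
  | zero =>
    have h0 := E.pathDist_mem_stdSimplex hW hZ₁ hZ₂ hμ 0
    -- With n = 0 the right-hand sides vanish, so any point of the hull serves.
    refine ⟨_, subset_convexHull _ _ ⟨unif q, unif_mem_stdSimplex, rfl⟩, ?_⟩
    simp only [Nat.cast_zero, zero_mul]
    exact ⟨condMutualInfo_nonpos_of_subsingleton h0 _ _ _,
      condMutualInfo_nonpos_of_subsingleton h0 _ _ _,
      condMutualInfo_nonpos_of_subsingleton h0 _ _ _,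
      condMutualInfo_nonpos_of_subsingleton h0 _ _ _,
      condMutualInfo_nonpos_of_subsingleton h0 _ _ _⟩
  | succ n ih =>
    obtain ⟨t, ht, h1, h2, h12, h3, h4⟩ := ih
    have hP := E.pathDist_mem_stdSimplex hW hZ₁ hZ₂ hμ n
    have hnew := mem_bcHull_stepDist (x₁ := E.x₁ n) (x₂ := E.x₂ n) (x₃ := E.x₃ n) hW hZ₁ hZ₂ hP
      fun h => ((h.1.1, h.1.2.1, h.1.2.2.2), (h.2.1, h.2.2.1))
    -- The new triple is the time average over n + 1 uses, one and the same for all five bounds.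
    refine ⟨_, convex_convexHull ℝ _ ht hnew (show (0 : ℝ) ≤ n / (n + 1) by positivity)
      (show (0 : ℝ) ≤ 1 / (n + 1) by positivity) (by field_simp), ?_, ?_, ?_, ?_, ?_⟩
    · exact (E.information_step₁ hW hZ₁ hZ₂ hμ n).trans
        (nat_mul_add_le_of_concaveOn (concaveOn_bcHull_sum _) ht hnew n h1 le_rfl rfl)
    · exact (E.information_step₂ hW hZ₁ hZ₂ hμ n).trans
        (nat_mul_add_le_of_concaveOn (concaveOn_bcHull_sum _) ht hnew n h2 le_rfl rfl)
    · exact (E.information_step₁₂ hW hZ₁ hZ₂ hμ n).trans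
        (nat_mul_add_le_of_concaveOn (concaveOn_bcHull_sum _) ht hnew n h12 le_rfl rfl)
    · exact (E.information_step₃ hW hZ₁ hZ₂ hμ n).trans
        (nat_mul_add_le_of_concaveOn (concaveOn_bcHull_fst _) ht hnew n h3 le_rfl rfl)
    · exact (E.information_step₄ hW hZ₁ hZ₂ hμ n).trans
        (nat_mul_add_le_of_concaveOn (concaveOn_bcHull_snd hZ₁ hZ₂) ht hnew n h4 le_rfl rfl)

end Encoders

end Path

/-! ### Fano's inequality for uniform messages. -/

section Fano

variable {Ω α β γ : Type*} [Fintype Ω] [Fintype α] [Fintype β] [Fintype γ] {P : Ω → ℝ}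

theorem condMutualInfo_eq_condEnt' (hP : ∀ ω, 0 ≤ P ω) (X : Ω → α) (Y : Ω → β) (Z : Ω → γ) :
    condMutualInfo P X Y Z = condEnt P X Z - condEnt P X (fun ω => (Y ω, Z ω)) := by
  have h1 : ent P (fun ω => (Z ω, Y ω)) = ent P (fun ω => (Y ω, Z ω)) :=
    ent_congr hP Prod.swap Prod.swap (fun _ => rfl) fun _ => rfl
  have h2 : ent P (fun ω => ((X ω, Z ω), Y ω)) = ent P (fun ω => ((Y ω, Z ω), X ω)) :=
    ent_congr hP (fun x => ((x.2, x.1.2), x.1.1)) (fun x => ((x.2, x.1.2), x.1.1))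
      (fun _ => rfl) fun _ => rfl
  have h3 : ent P (fun ω => (X ω, Z ω)) = ent P (fun ω => (Z ω, X ω)) :=
    ent_congr hP Prod.swap Prod.swap (fun _ => rfl) fun _ => rfl
  rw [condMutualInfo_eq_condEnt hP, condEnt, condEnt, condEnt, condEnt, h1, h2, h3]
  ring

theorem entropy_const [Nonempty α] :
    entropy (fun _ : α => 1 / (Fintype.card α : ℝ)) = Real.logb 2 (Fintype.card α) := by
  have h : (Fintype.card α : ℝ) ≠ 0 := by exact_mod_cast Fintype.card_ne_zero
  simp only [entropy, Finset.sum_const, Finset.card_univ, nsmul_eq_mul, one_div, Real.logb_inv]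
  field_simp

/-- Fano's inequality for a message `M`, uniform given the side information, that is decoded from the
observation `U` and the side information. -/
theorem max_le_condMutualInfo [Nonempty α] (hP : P ∈ stdSimplex ℝ Ω) (M : Ω → α) (U : Ω → β)
    (C : Ω → γ) (g : β → γ → α) (err : ℝ)
    (herr : (open Classical in ∑ ω, if g (U ω) (C ω) ≠ M ω then P ω else 0) ≤ err)
    (hM : Real.logb 2 (Fintype.card α) ≤ condEnt P M C) :
    max 0 ((1 - err) * Real.logb 2 (Fintype.card α) - 1) ≤ condMutualInfo P M U C := by
  refine max_le (condMutualInfo_nonneg hP M U C) ?_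
  have := condEnt_le_fano hP M (fun ω => (U ω, C ω)) (fun c => g c.1 c.2) err herr
  rw [condMutualInfo_eq_condEnt' hP.1]
  linarith

/-- A uniform law on a product makes the coordinates independent and uniform. The equivalence e
singles out one message or a pair of messages from the quadruple. -/
theorem condEnt_uniform {κ : Type*} [Fintype κ] [Nonempty α] (hP : P ∈ stdSimplex ℝ Ω)
    {T : Ω → κ} (c : ℝ) (hT : law P T = fun _ => c) (e : κ ≃ α × γ) :
    condEnt P (fun ω => (e (T ω)).1) (fun ω => (e (T ω)).2) = Real.logb 2 (Fintype.card α) := by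
  have h : (Fintype.card α : ℝ) ≠ 0 := by exact_mod_cast Fintype.card_ne_zero
  rw [condEnt_eq_entropy hP (g := fun _ => 1 / (Fintype.card α : ℝ)) (by simp), entropy_const]
  intro F
  rw [← sum_law_mul P T fun m => F (e m).2 (e m).1,
    ← sum_law_mul P T fun m => ∑ z, 1 / (Fintype.card α : ℝ) * F (e m).2 z, hT,
    ← Finset.mul_sum, ← Finset.mul_sum, Equiv.sum_comp e fun x => F x.2 x.1,
    Equiv.sum_comp e fun x => ∑ z, 1 / (Fintype.card α : ℝ) * F x.2 z]
  simp only [Fintype.sum_prod_type, ← Finset.mul_sum, Finset.sum_const, Finset.card_univ,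
    nsmul_eq_mul]
  rw [Finset.sum_comm]
  field_simp

end Fano

/-! ### The messages keep their law. -/

section Path

variable {q : ℕ} [NeZero q] {Y A B C D : Type*} [Fintype Y] [Fintype A] [Fintype B] [Fintype C]
  [Fintype D] {W : ZMod q → ZMod q → ZMod q → Y → ℝ} {pZ₁ pZ₂ : ZMod q → ℝ}

theorem Encoders.law_pathDist_fst (E : Encoders q Y A B C D) {μ : A × B × C × D → ℝ}
    (hW : IsSymmetricMac W) (hZ₁ : pZ₁ ∈ stdSimplex ℝ (ZMod q))
    (hZ₂ : pZ₂ ∈ stdSimplex ℝ (ZMod q)) (n : ℕ) :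
    law (E.pathDist W pZ₁ pZ₂ μ n) Prod.fst = μ := by
  induction n with
  | zero =>
    rw [← law_id μ]
    refine law_eq_of_forall fun F => ?_
    simp only [pathDist, Finset.univ_eq_empty, Finset.prod_empty, mul_one]
    rw [Fintype.sum_prod_type, law_id]
    simp
  | succ n ih =>
    rw [← law_next, ← law_comp]
    have h := law_comp (stepDist (E.pathDist W pZ₁ pZ₂ μ n) W pZ₁ pZ₂ (E.x₁ n) (E.x₂ n) (E.x₃ n))
      Prod.fst (Prod.fst : History q Y A B C D n → _)
    rw [law_stepDist_fst hW hZ₁ hZ₂, ih] at h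
    exact h

end Path

/-! ### The converse. -/

section Converse

variable {q : ℕ} [NeZero q] {Y : Type*} [Fintype Y]
  {W : ZMod q → ZMod q → ZMod q → Y → ℝ} {pZ₁ pZ₂ : ZMod q → ℝ}

/-- The encoders of a code, extended arbitrarily after the last channel use. -/
def Code.encoders {n k₁ k₂ k₃ k₄ : ℕ} (c : Code q Y n k₁ k₂ k₃ k₄) :
    Encoders q Y (Fin k₁) (Fin k₂) (Fin k₃) (Fin k₄) where
  f₁ i m y := if h : i < n then c.f₁ ⟨i, h⟩ m y else 0
  f₂ i m y := if h : i < n then c.f₂ ⟨i, h⟩ m y else 0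
  f₃ i m m' y := if h : i < n then c.f₃ ⟨i, h⟩ m m' y else 0

theorem Code.pathDist_encoders {n k₁ k₂ k₃ k₄ : ℕ} (c : Code q Y n k₁ k₂ k₃ k₄)
    (μ : Fin k₁ × Fin k₂ × Fin k₃ × Fin k₄ → ℝ) (h : History q Y _ _ _ _ n) :
    c.encoders.pathDist W pZ₁ pZ₂ μ n h = μ h.1 * c.outputProb W pZ₁ pZ₂ h.1.1 h.1.2.1 h.1.2.2.1
      h.1.2.2.2 h.2.1 h.2.2.1 h.2.2.2 := by
  simp [Encoders.pathDist, Code.outputProb, Code.encoders]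

open Classical in
theorem Code.errorProb_eq {n k₁ k₂ k₃ k₄ : ℕ} (c : Code q Y n k₁ k₂ k₃ k₄) :
    c.errorProb W pZ₁ pZ₂ = ∑ h : History q Y (Fin k₁) (Fin k₂) (Fin k₃) (Fin k₄) n,
      if (c.g₃ h.1.2.2.1 h.1.2.2.2 h.2.2.2).1 ≠ h.1.1 ∨
        (c.g₃ h.1.2.2.1 h.1.2.2.2 h.2.2.2).2 ≠ h.1.2.1 ∨
        c.g₁ h.1.1 h.2.1 ≠ h.1.2.2.1 ∨ c.g₂ h.1.2.1 h.2.2.1 ≠ h.1.2.2.2 then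
      c.encoders.pathDist W pZ₁ pZ₂ (fun _ => 1 / ((k₁ : ℝ) * k₂ * k₃ * k₄)) n h else 0 := by
  simp only [Code.pathDist_encoders, Code.errorProb, Fintype.sum_prod_type, Finset.mul_sum,
    mul_ite, mul_zero]

/-- Fano's inequality for each decoder meets `exists_information_le`. The maximum with 0 records
that the single-letter bounds are nonnegative, which is needed later for rates truncated at 0. -/
theorem Code.exists_bound (hW : IsSymmetricMac W) (hZ₁ : pZ₁ ∈ stdSimplex ℝ (ZMod q))
    (hZ₂ : pZ₂ ∈ stdSimplex ℝ (ZMod q)) {n k₁ k₂ k₃ k₄ : ℕ} (c : Code q Y n k₁ k₂ k₃ k₄)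
    (h₁ : 0 < k₁) (h₂ : 0 < k₂) (h₃ : 0 < k₃) (h₄ : 0 < k₄) (err : ℝ)
    (herr : c.errorProb W pZ₁ pZ₂ = err) : ∃ t ∈ bcHull pZ₁ pZ₂, 0 ≤ err ∧
    max 0 ((1 - err) * Real.logb 2 k₁ - 1) ≤
      n * ∑ x, t.1 x * (outEnt₁ W x - noiseEnt W x) ∧
    max 0 ((1 - err) * Real.logb 2 k₂ - 1) ≤
      n * ∑ x, t.1 x * (outEnt₂ W x - noiseEnt W x) ∧
    max 0 ((1 - err) * (Real.logb 2 k₁ + Real.logb 2 k₂) - 1) ≤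
      n * ∑ x, t.1 x * (outEnt₁₂ W x - noiseEnt W x) ∧
    max 0 ((1 - err) * Real.logb 2 k₃ - 1) ≤ n * (t.2.1 - entropy pZ₁) ∧
    max 0 ((1 - err) * Real.logb 2 k₄ - 1) ≤
      n * (entropy (conv t.1 (conv pZ₁ pZ₂)) - t.2.2) := by
  classical
  have : Nonempty (Fin k₁) := ⟨⟨0, h₁⟩⟩
  have : Nonempty (Fin k₂) := ⟨⟨0, h₂⟩⟩
  have : Nonempty (Fin k₃) := ⟨⟨0, h₃⟩⟩
  have : Nonempty (Fin k₄) := ⟨⟨0, h₄⟩⟩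
  have h₁' : (k₁ : ℝ) ≠ 0 := by exact_mod_cast h₁.ne'
  have h₂' : (k₂ : ℝ) ≠ 0 := by exact_mod_cast h₂.ne'
  have h₃' : (k₃ : ℝ) ≠ 0 := by exact_mod_cast h₃.ne'
  have h₄' : (k₄ : ℝ) ≠ 0 := by exact_mod_cast h₄.ne'
  have hμ : (fun _ => 1 / ((k₁ : ℝ) * k₂ * k₃ * k₄)) ∈
      stdSimplex ℝ (Fin k₁ × Fin k₂ × Fin k₃ × Fin k₄) := by
    refine ⟨fun _ => by positivity, ?_⟩
    simp only [Finset.sum_const, Finset.card_univ, Fintype.card_prod, Fintype.card_fin,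
      nsmul_eq_mul, Nat.cast_mul]
    field_simp
  rw [c.errorProb_eq] at herr
  have hP := c.encoders.pathDist_mem_stdSimplex hW hZ₁ hZ₂ hμ n
  have hfst := c.encoders.law_pathDist_fst (μ := fun _ => 1 / ((k₁ : ℝ) * k₂ * k₃ * k₄))
    hW hZ₁ hZ₂ n
  obtain ⟨t, ht, b1, b2, b12, b3, b4⟩ := c.encoders.exists_information_le hW hZ₁ hZ₂ hμ n
  set P := c.encoders.pathDist W pZ₁ pZ₂ (fun _ => 1 / ((k₁ : ℝ) * k₂ * k₃ * k₄)) n with hPdef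
  -- The error event of any single decoder lies in the overall error event.
  have herr' : ∀ p : History q Y (Fin k₁) (Fin k₂) (Fin k₃) (Fin k₄) n → Prop,
      (∀ h, p h → (c.g₃ h.1.2.2.1 h.1.2.2.2 h.2.2.2).1 ≠ h.1.1 ∨
        (c.g₃ h.1.2.2.1 h.1.2.2.2 h.2.2.2).2 ≠ h.1.2.1 ∨
        c.g₁ h.1.1 h.2.1 ≠ h.1.2.2.1 ∨ c.g₂ h.1.2.1 h.2.2.1 ≠ h.1.2.2.2) →
      (∑ h, if p h then P h else 0) ≤ err := by
    intro p hp
    rw [← herr]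
    refine Finset.sum_le_sum fun h _ => ?_
    by_cases hh : p h
    · rw [if_pos hh, if_pos (hp h hh)]
    · rw [if_neg hh]
      split_ifs
      exacts [hP.1 h, le_rfl]
  have e1 := condEnt_uniform hP _ hfst (Equiv.refl (Fin k₁ × Fin k₂ × Fin k₃ × Fin k₄))
  have e2 := condEnt_uniform hP _ hfst (α := Fin k₂) (γ := Fin k₁ × Fin k₃ × Fin k₄)
    ⟨fun m => (m.2.1, m.1, m.2.2), fun m => (m.2.1, m.1, m.2.2), fun _ => rfl, fun _ => rfl⟩
  have e12 := condEnt_uniform hP _ hfst (α := Fin k₁ × Fin k₂) (γ := Fin k₃ × Fin k₄)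
    ⟨fun m => ((m.1, m.2.1), m.2.2), fun m => (m.1.1, m.1.2, m.2), fun _ => rfl, fun _ => rfl⟩
  have e3 := condEnt_uniform hP _ hfst (α := Fin k₃) (γ := Fin k₁ × Fin k₂ × Fin k₄)
    ⟨fun m => (m.2.2.1, m.1, m.2.1, m.2.2.2), fun m => (m.2.1, m.2.2.1, m.1, m.2.2.2),
      fun _ => rfl, fun _ => rfl⟩
  have e4 := condEnt_uniform hP _ hfst (α := Fin k₄) (γ := Fin k₁ × Fin k₂ × Fin k₃)
    ⟨fun m => (m.2.2.2, m.1, m.2.1, m.2.2.1), fun m => (m.2.1, m.2.2.1, m.2.2.2, m.1),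
      fun _ => rfl, fun _ => rfl⟩
  -- M₃₂ is uniform given all other messages, hence has at least that entropy given M₂₃ alone, which
  -- is all that decoder 2 knows.
  have e4' := e4.symm.le.trans (condEnt_le_of_comp hP (fun h => h.1.2.2.2) (C' := fun h => h.1.2.1)
    (fun x => x.2.1) fun _ => rfl)
  have f1 := max_le_condMutualInfo hP (fun h => h.1.1) (fun h => (h.2.2.2, h.2.2.1))
    (fun h => h.1.2) (fun u m => (c.g₃ m.2.1 m.2.2 u.1).1) err
    (by convert herr' _ fun h hh => Or.inl hh) e1.symm.le
  have f2 := max_le_condMutualInfo hP (fun h => h.1.2.1) (fun h => (h.2.2.2, h.2.1))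
    (fun h => (h.1.1, h.1.2.2)) (fun u m => (c.g₃ m.2.1 m.2.2 u.1).2) err
    (by convert herr' _ fun h hh => Or.inr (Or.inl hh)) e2.symm.le
  have f12 := max_le_condMutualInfo hP (fun h => (h.1.1, h.1.2.1)) (fun h => h.2.2.2)
    (fun h => h.1.2.2) (fun u m => c.g₃ m.1 m.2 u) err
    (by
      convert herr' _ fun h (hh : c.g₃ h.1.2.2.1 h.1.2.2.2 h.2.2.2 ≠ (h.1.1, h.1.2.1)) => ?_
      by_contra hcon
      simp only [not_or, not_not] at hcon
      exact hh (Prod.ext hcon.1 hcon.2.1)) e12.symm.le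
  have f3 := max_le_condMutualInfo hP (fun h => h.1.2.2.1) (fun h => (h.2.1, h.2.2.1))
    (fun h => (h.1.1, h.1.2.1, h.1.2.2.2)) (fun u m => c.g₁ m.1 u.1) err
    (by convert herr' _ fun h hh => Or.inr (Or.inr (Or.inl hh))) e3.symm.le
  have f4 := max_le_condMutualInfo hP (fun h => h.1.2.2.2) (fun h => h.2.2.1)
    (fun h => h.1.2.1) (fun u m => c.g₂ m u) err
    (by convert herr' _ fun h hh => Or.inr (Or.inr (Or.inr hh))) e4'
  simp only [Fintype.card_prod, Fintype.card_fin, Nat.cast_mul] at f1 f2 f12 f3 f4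
  rw [Real.logb_mul h₁' h₂'] at f12
  have h0 := herr' (fun _ => False) fun _ h => h.elim
  simp only [if_false, Finset.sum_const_zero] at h0
  exact ⟨t, ht, h0, f1.trans b1, f2.trans b2, f12.trans b12, f3.trans b3, f4.trans b4⟩

theorem one_le_rpow_mul (n : ℕ) {R : ℝ} (hR : 0 ≤ R) : (1 : ℝ) ≤ 2 ^ ((n : ℝ) * R) :=
  Real.one_le_rpow one_le_two (by positivity)

theorem messageCount_pos (n : ℕ) {R : ℝ} (hR : 0 ≤ R) : 0 < messageCount n R :=
  Nat.floor_pos.2 (one_le_rpow_mul n hR)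

theorem sub_one_le_logb_messageCount (n : ℕ) {R : ℝ} (hR : 0 ≤ R) :
    n * R - 1 ≤ Real.logb 2 (messageCount n R) := by
  have h1 := one_le_rpow_mul n hR
  have h2 := Nat.lt_floor_add_one ((2 : ℝ) ^ ((n : ℝ) * R))
  have h3 : (1 : ℝ) ≤ messageCount n R := by exact_mod_cast messageCount_pos n hR
  rw [Real.le_logb_iff_rpow_le one_lt_two (by linarith), Real.rpow_sub two_pos, Real.rpow_one,
    div_le_iff₀ two_pos]
  have h4 : (messageCount n R : ℝ) = ⌊(2 : ℝ) ^ ((n : ℝ) * R)⌋₊ := rfl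
  linarith

/-- Rates reduced by a vanishing ε and truncated at 0 satisfy the single-letter bounds for all large
n; the closure does the rest. -/
theorem mem_uniformInputRegion_of_isAchievable (hW : IsSymmetricMac W)
    (hZ₁ : pZ₁ ∈ stdSimplex ℝ (ZMod q)) (hZ₂ : pZ₂ ∈ stdSimplex ℝ (ZMod q)) {R : Rates}
    (hR : IsAchievable W pZ₁ pZ₂ R) : R ∈ uniformInputRegion W pZ₁ pZ₂ := by
  obtain ⟨R₁, R₂, R₃, R₄⟩ := R
  obtain ⟨⟨r₁, r₂, r₃, r₄⟩, c, hc⟩ := hR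
  set S := R₁ + R₂ + R₃ + R₄ with hS
  -- S dominates every rate and R₁ + R₂. Of the 3 bits, one is Fano's and up to two are lost by
  -- rounding message counts, two occurring in the sum rate.
  set ε : ℕ → ℝ := fun n => (c n).errorProb W pZ₁ pZ₂ * S + 3 / n with hε
  have hε0 : Filter.Tendsto ε Filter.atTop (𝓝 0) := by
    simpa using (hc.mul_const S).add (tendsto_const_div_atTop_nhds_zero_nat 3)
  have hlim : ∀ r : ℝ, 0 ≤ r → Filter.Tendsto (fun n => max 0 (r - ε n)) Filter.atTop (𝓝 r) := by
    intro r hr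
    have := (tendsto_const_nhds (x := (0 : ℝ))).max ((tendsto_const_nhds (x := r)).sub hε0)
    simpa [hr] using this
  refine mem_closure_of_tendsto ((hlim R₁ r₁).prodMk_nhds ((hlim R₂ r₂).prodMk_nhds
    ((hlim R₃ r₃).prodMk_nhds (hlim R₄ r₄)))) ?_
  filter_upwards [Filter.eventually_ge_atTop 1, hc.eventually_le_const zero_lt_one] with n hn hle
  refine subset_convexHull _ _ ?_
  obtain ⟨t, ht, herr, b1, b2, b12, b3, b4⟩ := (c n).exists_bound hW hZ₁ hZ₂
    (messageCount_pos n r₁) (messageCount_pos n r₂) (messageCount_pos n r₃)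
    (messageCount_pos n r₄) _ rfl
  have hn0 : (0 : ℝ) < n := by exact_mod_cast hn
  set err := (c n).errorProb W pZ₁ pZ₂ with herr_def
  have hεn : n * ε n = n * (err * S) + 3 := by
    have : ε n = err * S + 3 / n := rfl
    rw [this]
    field_simp
  have hmain : ∀ {r L φ : ℝ}, r ≤ S → n * r - 2 ≤ L →
      max 0 ((1 - err) * L - 1) ≤ n * φ → 0 ≤ φ ∧ r - ε n ≤ φ := by
    intro r L φ hrS hL h
    obtain ⟨h', h''⟩ := max_le_iff.1 h
    refine ⟨nonneg_of_mul_nonneg_right h' hn0, le_of_mul_le_mul_left ?_ hn0⟩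
    have h1 : (1 - err) * (n * r - 2) ≤ (1 - err) * L :=
      mul_le_mul_of_nonneg_left hL (by linarith)
    have h2 : n * (err * r) ≤ n * (err * S) :=
      mul_le_mul_of_nonneg_left (mul_le_mul_of_nonneg_left hrS herr) hn0.le
    rw [mul_sub, hεn]
    nlinarith
  have hL₁ := sub_one_le_logb_messageCount n r₁
  have hL₂ := sub_one_le_logb_messageCount n r₂
  have hL₃ := sub_one_le_logb_messageCount n r₃
  have hL₄ := sub_one_le_logb_messageCount n r₄
  have c1 := hmain (r := R₁) (by linarith) (by linarith) b1
  have c2 := hmain (r := R₂) (by linarith) (by linarith) b2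
  have c12 := hmain (r := R₁ + R₂) (by linarith) (by linarith) b12
  have c3 := hmain (r := R₃) (by linarith) (by linarith) b3
  have c4 := hmain (r := R₄) (by linarith) (by linarith) b4
  have hεpos : 0 ≤ ε n := by
    have : 0 ≤ n * ε n := by rw [hεn]; positivity
    exact nonneg_of_mul_nonneg_right this hn0
  refine mem_uniform_of_mem_bcHull hW hZ₁ hZ₂ ht
    ⟨le_max_left _ _, le_max_left _ _, le_max_left _ _, le_max_left _ _⟩
    (max_le c1.1 c1.2) (max_le c2.1 c2.2) ?_ (max_le c3.1 c3.2) (max_le c4.1 c4.2)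
  -- If a rate is truncated, the sum bound follows from the nonnegativity of the rates and of the
  -- right-hand side; otherwise ε is subtracted twice although once is enough.
  rcases max_cases 0 (R₁ - ε n) with ⟨h, _⟩ | ⟨h, _⟩ <;>
    rcases max_cases 0 (R₂ - ε n) with ⟨h', _⟩ | ⟨h', _⟩ <;> rw [h, h'] <;> linarith [c12.1, c12.2]

theorem capacityRegion_subset_uniformInputRegion (hW : IsSymmetricMac W)
    (hZ₁ : pZ₁ ∈ stdSimplex ℝ (ZMod q)) (hZ₂ : pZ₂ ∈ stdSimplex ℝ (ZMod q)) :
    capacityRegion W pZ₁ pZ₂ ⊆ uniformInputRegion W pZ₁ pZ₂ :=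
  closure_minimal (convexHull_min
    (fun _ hR => mem_uniformInputRegion_of_isAchievable hW hZ₁ hZ₂ hR)
    (convex_convexHull _ _).closure) isClosed_closure

end Converse

/-! ### Independent copies -/

section ProdWeight

variable {ι Ω α β γ : Type*} [Fintype ι] [DecidableEq ι] [Fintype Ω] [Fintype α] [Fintype β] [Fintype γ]
  {P : Ω → ℝ}

/-- The joint law of independent random variables indexed by `ι`, all with law `P`. -/
def prodWeight (P : Ω → ℝ) (c : ι → Ω) : ℝ := ∏ i, P (c i)

theorem sum_prod_eq (f : ι → Ω → ℝ) : ∑ c : ι → Ω, ∏ i, f i (c i) = ∏ i, ∑ a, f i a := by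
  rw [Finset.prod_univ_sum, Fintype.piFinset_univ]

theorem prodWeight_mem_stdSimplex (hP : P ∈ stdSimplex ℝ Ω) :
    (prodWeight P : (ι → Ω) → ℝ) ∈ stdSimplex ℝ (ι → Ω) := by
  classical
  refine ⟨fun c => Finset.prod_nonneg fun i _ => hP.1 _, ?_⟩
  have := sum_prod_eq fun (_ : ι) a => P a
  simp only [hP.2, Finset.prod_const_one] at this
  exact this

theorem law_prodWeight (P : Ω → ℝ) (X : Ω → α) :
    law (prodWeight P : (ι → Ω) → ℝ) (fun c i => X (c i)) = prodWeight (law P X) := by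
  classical
  funext a
  have := sum_prod_eq fun i ω => if X ω = a i then P ω else 0
  simp only [prodWeight, law]
  convert this using 2 with c
  by_cases h : (fun i => X (c i)) = a
  · rw [if_pos h]
    exact Finset.prod_congr rfl fun i _ => (if_pos (congrFun h i)).symm
  · rw [if_neg h]
    obtain ⟨i, hi⟩ := Function.ne_iff.1 h
    exact (Finset.prod_eq_zero (Finset.mem_univ i) (if_neg hi)).symm

/-- Pairwise independence of distinct coordinates. It serves both Chebyshev's inequality and the
comparison of a wrong codeword with the one sent. -/
theorem sum_prodWeight_mul_two (hP : P ∈ stdSimplex ℝ Ω) {m m' : ι} (hm : m' ≠ m)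
    (F : Ω → Ω → ℝ) :
    ∑ c : ι → Ω, prodWeight P c * F (c m') (c m) = ∑ a, P a * ∑ b, P b * F a b := by
  classical
  have key : ∀ a b, law (prodWeight P : (ι → Ω) → ℝ) (fun c => (c m', c m)) (a, b) =
      P a * P b := by
    intro a b
    -- The indicators at m' and m are written as a product over all coordinates, so that the sum
    -- factorizes; every other factor is the total mass 1.
    have := sum_prod_eq fun i ω => P ω * ((if i = m' then (if ω = a then 1 else 0) else 1) *
      if i = m then (if ω = b then 1 else 0) else 1)
    rw [law_eq_sum_mul]
    convert this using 1
    · refine Finset.sum_congr (by congr!) fun c _ => ?_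
      rw [Finset.prod_mul_distrib, Finset.prod_mul_distrib]
      simp only [Finset.prod_ite_eq', Finset.mem_univ, if_true, prodWeight]
      by_cases h1 : c m' = a <;> by_cases h2 : c m = b <;> simp [h1, h2]
    · rw [← Finset.mul_prod_erase Finset.univ _ (Finset.mem_univ m'),
        ← Finset.mul_prod_erase (Finset.univ.erase m') _
          (Finset.mem_erase.2 ⟨hm.symm, Finset.mem_univ m⟩), Finset.prod_eq_one]
      · simp [hm, hm.symm]
      · intro i hi
        simp only [Finset.mem_erase, Finset.mem_univ, and_true] at hi
        simp [hi.1, hi.2, hP.2]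
  rw [← sum_law_mul (prodWeight P : (ι → Ω) → ℝ) (fun c => (c m', c m)) fun x => F x.1 x.2,
    Fintype.sum_prod_type]
  simp only [key, Finset.mul_sum, mul_assoc]

theorem sum_prodWeight_mul_one (hP : P ∈ stdSimplex ℝ Ω) (m : ι) (F : Ω → ℝ) :
    ∑ c : ι → Ω, prodWeight P c * F (c m) = ∑ a, P a * F a := by
  classical
  have key : ∀ a, law (prodWeight P : (ι → Ω) → ℝ) (fun c => c m) a = P a := by
    intro a
    have := sum_prod_eq fun i ω => P ω * (if i = m then (if ω = a then 1 else 0) else 1)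
    rw [law_eq_sum_mul]
    convert this using 1
    · refine Finset.sum_congr (by congr!) fun c _ => ?_
      rw [Finset.prod_mul_distrib]
      simp only [Finset.prod_ite_eq', Finset.mem_univ, if_true, prodWeight]
    · rw [← Finset.mul_prod_erase Finset.univ _ (Finset.mem_univ m), Finset.prod_eq_one]
      · simp
      · intro i hi
        simp only [Finset.mem_erase, Finset.mem_univ, and_true] at hi
        simp [hi, hP.2]
  rw [← sum_law_mul (prodWeight P : (ι → Ω) → ℝ) (fun c => c m) F]
  simp only [key]

/-- Additivity of the variance: the mixed terms vanish by independence, as g has mean 0. -/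
theorem sum_prodWeight_sq (hP : P ∈ stdSimplex ℝ Ω) {g : Ω → ℝ} (hg : ∑ ω, P ω * g ω = 0) :
    ∑ c : ι → Ω, prodWeight P c * (∑ i, g (c i)) ^ 2 =
      Fintype.card ι * ∑ ω, P ω * g ω ^ 2 := by
  classical
  have h : ∀ i j : ι, ∑ c : ι → Ω, prodWeight P c * (g (c i) * g (c j)) =
      if i = j then ∑ ω, P ω * g ω ^ 2 else 0 := by
    intro i j
    split_ifs with hij
    · subst hij
      rw [sum_prodWeight_mul_one hP i fun a => g a * g a]
      simp only [sq]
    · rw [sum_prodWeight_mul_two hP hij fun a b => g a * g b]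
      simp only [mul_left_comm _ (g _), ← Finset.mul_sum, hg, mul_zero, Finset.sum_const_zero]
  calc ∑ c : ι → Ω, prodWeight P c * (∑ i, g (c i)) ^ 2
      = ∑ i, ∑ j, ∑ c : ι → Ω, prodWeight P c * (g (c i) * g (c j)) := by
        simp only [sq, Finset.sum_mul_sum]
        simp only [Finset.mul_sum]
        rw [Finset.sum_comm]
        exact Finset.sum_congr rfl fun i _ => Finset.sum_comm
    _ = _ := by simp [h]

open Classical in
/-- Chebyshev's inequality for sums of independent copies. -/
theorem sum_prodWeight_le (hP : P ∈ stdSimplex ℝ Ω) (G : Ω → ℝ) {t : ℝ}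
    (ht : t < ∑ ω, P ω * G ω) (n : ℕ) (hn : 0 < n) :
    (∑ c : Fin n → Ω, if ∑ i, G (c i) ≤ n * t then prodWeight P c else 0) ≤
      (∑ ω, P ω * (G ω - ∑ ω, P ω * G ω) ^ 2) / (∑ ω, P ω * G ω - t) ^ 2 / n := by
  set m := ∑ ω, P ω * G ω with hm
  have hn0 : (0 : ℝ) < n := by exact_mod_cast hn
  have hmt : 0 < m - t := sub_pos.2 ht
  have hg : ∑ ω, P ω * (G ω - m) = 0 := by
    simp [mul_sub, ← hm, ← Finset.sum_mul, hP.2]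
  have h := sum_prodWeight_sq (ι := Fin n) hP hg
  rw [div_div, le_div_iff₀ (by positivity)]
  have h1 : (∑ c : Fin n → Ω, if ∑ i, G (c i) ≤ n * t then prodWeight P c else 0) *
      (n * (m - t)) ^ 2 ≤ n * ∑ ω, P ω * (G ω - m) ^ 2 := by
    rw [Fintype.card_fin] at h
    rw [← h, Finset.sum_mul]
    refine Finset.sum_le_sum fun c _ => ?_
    have hc : 0 ≤ prodWeight P c := (prodWeight_mem_stdSimplex hP).1 c
    split_ifs with hle
    · refine mul_le_mul_of_nonneg_left ?_ hc
      have h2 : ∑ i, (G (c i) - m) = ∑ i, G (c i) - n * m := by simp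
      rw [h2, ← neg_sq (∑ i, G (c i) - n * m)]
      refine pow_le_pow_left₀ (by positivity) ?_ 2
      linarith
    · rw [zero_mul]
      positivity
  have h3 : (n : ℝ) * ((∑ c : Fin n → Ω, if ∑ i, G (c i) ≤ n * t then prodWeight P c else 0) *
      ((m - t) ^ 2 * n)) ≤ n * ∑ ω, P ω * (G ω - m) ^ 2 := by
    refine le_trans (le_of_eq ?_) h1
    ring
  exact le_of_mul_le_mul_left h3 hn0

end ProdWeight

/-! ### Threshold tests -/

section Test

variable {Ω Ω' α β γ : Type*} [Fintype Ω] [Fintype Ω'] [Fintype α] [Fintype β] [Fintype γ]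
  {P : Ω → ℝ}

/-- The test whether the conditional information density of a sequence of triples exceeds `n t`. -/
def PassesTest (P : Ω → ℝ) (X : Ω → α) (Y : Ω → β) (Z : Ω → γ) (t : ℝ) {n : ℕ}
    (s : Fin n → α × β × γ) : Prop :=
  (2 : ℝ) ^ ((n : ℝ) * t) * ∏ i, law P (fun ω => (X ω, Z ω)) ((s i).1, (s i).2.2) *
      law P (fun ω => (Y ω, Z ω)) (s i).2 <
    ∏ i, law P (fun ω => (X ω, Y ω, Z ω)) (s i) * law P Z (s i).2.2

open Classical in
/-- The probability that `n` independent copies of `(X, Y, Z)` fail the test. -/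
def failProb (P : Ω → ℝ) (X : Ω → α) (Y : Ω → β) (Z : Ω → γ) (t : ℝ) (n : ℕ) : ℝ :=
  ∑ c : Fin n → Ω, if PassesTest P X Y Z t (fun i => (X (c i), Y (c i), Z (c i))) then 0
    else prodWeight P c

theorem failProb_nonneg (hP : P ∈ stdSimplex ℝ Ω) (X : Ω → α) (Y : Ω → β) (Z : Ω → γ) (t : ℝ)
    (n : ℕ) : 0 ≤ failProb P X Y Z t n :=
  Finset.sum_nonneg fun c _ => by
    split_ifs
    exacts [le_rfl, (prodWeight_mem_stdSimplex hP).1 c]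

/-- The logarithm of the test ratio is a sum of independent copies of the information density, whose
mean is I(X; Y | Z) > t; Chebyshev's inequality gives decay of order 1/n. -/
theorem tendsto_failProb (hP : P ∈ stdSimplex ℝ Ω) (X : Ω → α) (Y : Ω → β) (Z : Ω → γ) {t : ℝ}
    (ht : t < condMutualInfo P X Y Z) :
    Filter.Tendsto (failProb P X Y Z t) Filter.atTop (𝓝 0) := by
  classical
  set G : Ω → ℝ := fun ω => Real.logb 2
      (law P (fun ω => (X ω, Y ω, Z ω)) (X ω, Y ω, Z ω) * law P Z (Z ω) /
        (law P (fun ω => (X ω, Z ω)) (X ω, Z ω) * law P (fun ω => (Y ω, Z ω)) (Y ω, Z ω))) with hG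
  rw [condMutualInfo_eq_sum] at ht
  refine squeeze_zero' (Filter.Eventually.of_forall fun n => failProb_nonneg hP X Y Z t n) ?_
    (tendsto_const_div_atTop_nhds_zero_nat
      ((∑ ω, P ω * (G ω - ∑ ω, P ω * G ω) ^ 2) / (∑ ω, P ω * G ω - t) ^ 2))
  filter_upwards [Filter.eventually_gt_atTop 0] with n hn
  refine le_trans (Finset.sum_le_sum fun c _ => ?_) (sum_prodWeight_le hP G ht n hn)
  have hc : 0 ≤ prodWeight P c := (prodWeight_mem_stdSimplex hP).1 c
  split_ifs with h1 h2 h2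
  · exact hc
  · exact le_rfl
  · exact le_rfl
  -- The test fails although the sum of densities exceeds n t. A sequence of nonzero weight has only
  -- positive masses, and taking logarithms would make it pass; so the weight is 0.
  · refine le_of_eq ?_
    by_contra hne
    have hpos : ∀ i, P (c i) ≠ 0 := fun i hi => hne (Finset.prod_eq_zero (Finset.mem_univ i) hi)
    refine h1 ?_
    have a1 := fun i => law_self_pos hP.1 (fun ω => (X ω, Y ω, Z ω)) (hpos i)
    have a2 := fun i => law_self_pos hP.1 (fun ω => (X ω, Z ω)) (hpos i)
    have a3 := fun i => law_self_pos hP.1 (fun ω => (Y ω, Z ω)) (hpos i)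
    have a4 := fun i => law_self_pos hP.1 Z (hpos i)
    have hsum : ∑ i, G (c i) = Real.logb 2 (∏ i,
        (law P (fun ω => (X ω, Y ω, Z ω)) (X (c i), Y (c i), Z (c i)) * law P Z (Z (c i)) /
        (law P (fun ω => (X ω, Z ω)) (X (c i), Z (c i)) *
          law P (fun ω => (Y ω, Z ω)) (Y (c i), Z (c i))))) := by
      rw [Real.logb_prod]
      exact fun i _ => (div_pos (mul_pos (a1 i) (a4 i)) (mul_pos (a2 i) (a3 i))).ne'
    rw [not_le, hsum, Real.lt_logb_iff_rpow_lt one_lt_two (Finset.prod_pos fun i _ =>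
      div_pos (mul_pos (a1 i) (a4 i)) (mul_pos (a2 i) (a3 i))), Finset.prod_div_distrib,
      lt_div_iff₀ (Finset.prod_pos fun i _ => mul_pos (a2 i) (a3 i))] at h2
    exact h2

open Classical in
/-- If `A'` has conditional law `κ` given `C` and is otherwise independent of `B`, then
`n` independent copies of `(A', B, C)` pass the test with small probability. -/
theorem sum_passesTest_le (hP : P ∈ stdSimplex ℝ Ω) (X : Ω → α) (Y : Ω → β) (Z : Ω → γ)
    (t : ℝ) {Q : Ω' → ℝ} (hQ : ∀ ω, 0 ≤ Q ω) (T : Ω' → α × β × γ) (κ : γ → α → ℝ)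
    (hκ : ∀ F : γ → α → ℝ, ∑ ω, P ω * F (Z ω) (X ω) = ∑ ω, P ω * ∑ a, κ (Z ω) a * F (Z ω) a)
    (hT : ∀ F : α × β × γ → ℝ, ∑ ω, Q ω * F (T ω) =
      ∑ ω, P ω * ∑ a, κ (Z ω) a * F (a, Y ω, Z ω)) (n : ℕ) :
    (∑ c : Fin n → Ω', if PassesTest P X Y Z t (fun i => T (c i)) then prodWeight Q c else 0) ≤
      (2 : ℝ) ^ (-((n : ℝ) * t)) := by
  -- Under Q the first component is conditionally independent of the second given the third, so the
  -- denominator of the test ratio is the law of T times the mass of Z.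
  have hlawT : ∀ x : α × β × γ, law Q T x * law P Z x.2.2 =
      law P (fun ω => (X ω, Z ω)) (x.1, x.2.2) * law P (fun ω => (Y ω, Z ω)) x.2 := by
    rintro ⟨a, b, c⟩
    have h1 : law P (fun ω => (X ω, Z ω)) (a, c) = law P Z c * κ c a := by
      rw [← law_prod_eq_of_forall hκ]
      exact law_comp_injective P (fun ω => (Z ω, X ω)) (f := Prod.swap) Prod.swap_injective (c, a)
    have h2 : law Q T (a, b, c) = κ c a * law P (fun ω => (Y ω, Z ω)) (b, c) := by
      rw [law_eq_sum_mul, law_eq_sum_mul,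
        hT fun x => @ite ℝ (x = (a, b, c)) (Classical.propDecidable _) 1 0,
        Finset.mul_sum]
      refine Finset.sum_congr rfl fun ω _ => ?_
      rw [Finset.sum_eq_single a]
      · by_cases hh : (Y ω, Z ω) = (b, c)
        · rw [if_pos (by rw [hh]), if_pos hh, (Prod.mk.inj hh).2]
          ring
        · rw [if_neg fun h => hh (congrArg Prod.snd h), if_neg hh]
          ring
      · intro a' _ ha'
        rw [if_neg fun h => ha' (congrArg Prod.fst h), mul_zero]
      · simp
    rw [h1, h2]
    ring
  have hL : 0 < (2 : ℝ) ^ ((n : ℝ) * t) := Real.rpow_pos_of_pos two_pos _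
  have hQn := law_nonneg hQ T
  have e1 : (∑ c : Fin n → Ω', if PassesTest P X Y Z t (fun i => T (c i)) then prodWeight Q c
      else 0) = ∑ s : Fin n → α × β × γ, prodWeight (law Q T) s *
        (if PassesTest P X Y Z t s then 1 else 0) := by
    rw [← law_prodWeight, sum_law_mul (prodWeight Q) (fun (c : Fin n → Ω') i => T (c i))
      fun s => if PassesTest P X Y Z t s then 1 else 0]
    simp
  rw [e1]
  have hJ := law_mem_stdSimplex hP fun ω => (X ω, Y ω, Z ω)
  -- Change of measure: a passing sequence has Q-mass at most 2^(-nt) times its mass under the true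
  -- joint law, and the latter sums to 1.
  calc ∑ s : Fin n → α × β × γ, prodWeight (law Q T) s *
        (if PassesTest P X Y Z t s then 1 else 0)
      ≤ ∑ s : Fin n → α × β × γ, (2 : ℝ) ^ (-((n : ℝ) * t)) *
          prodWeight (law P fun ω => (X ω, Y ω, Z ω)) s := by
        refine Finset.sum_le_sum fun s _ => ?_
        have hJs := (prodWeight_mem_stdSimplex (ι := Fin n) hJ).1 s
        split_ifs with h
        · rw [PassesTest, ← Finset.prod_congr rfl fun i _ => hlawT (s i),
            Finset.prod_mul_distrib, Finset.prod_mul_distrib] at h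
          have hz : 0 ≤ ∏ i, law P Z (s i).2.2 :=
            Finset.prod_nonneg fun i _ => law_nonneg hP.1 _ _
          rw [← mul_assoc] at h
          have h5 := lt_of_mul_lt_mul_right h hz
          rw [mul_one, Real.rpow_neg two_pos.le, ← div_eq_inv_mul, le_div_iff₀ hL, mul_comm]
          exact h5.le
        · rw [mul_zero]
          exact mul_nonneg (Real.rpow_nonneg two_pos.le _) hJs
    _ = _ := by rw [← Finset.mul_sum, (prodWeight_mem_stdSimplex hJ).2, mul_one]

end Test

/-! ### One letter of a random codebook -/

theorem sum_mul_sum_mul {Ω α : Type*} [Fintype Ω] [Fintype α] (P : Ω → ℝ) (c : α → ℝ)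
    (F : α → Ω → ℝ) : ∑ ω, P ω * ∑ a, c a * F a ω = ∑ a, c a * ∑ ω, P ω * F a ω := by
  simp only [Finset.mul_sum]
  rw [Finset.sum_comm]
  exact Finset.sum_congr rfl fun a _ => Finset.sum_congr rfl fun ω _ => by ring

section Letter

open Outcome

variable {q : ℕ} [NeZero q] {Y V : Type*} [Fintype Y] [Fintype V] {k₁ k₂ k₃ k₄ : ℕ}
  {W : ZMod q → ZMod q → ZMod q → Y → ℝ} {pZ₁ pZ₂ : ZMod q → ℝ}
  {p₁ p₂ : ZMod q → ℝ} {w : V → ℝ} {κ : V → ZMod q → ℝ}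

/-- One letter of a codebook: the letters of the codewords of user 1, of user 2, and, for each message
to user 2, of the cloud center and the satellite codewords of user 3. -/
abbrev Letter (q : ℕ) (V : Type*) (k₁ k₂ k₃ k₄ : ℕ) : Type _ :=
  (Fin k₁ → ZMod q) × (Fin k₂ → ZMod q) × (Fin k₄ → V × (Fin k₃ → ZMod q))

/-- The law of a letter of a cloud. -/
def cloudWeight (w : V → ℝ) (κ : V → ZMod q → ℝ) (c : V × (Fin k₃ → ZMod q)) : ℝ :=
  w c.1 * prodWeight (κ c.1) c.2

/-- The law of a letter of a random codebook. -/
def letterWeight (p₁ p₂ : ZMod q → ℝ) (w : V → ℝ) (κ : V → ZMod q → ℝ)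
    (c : Letter q V k₁ k₂ k₃ k₄) : ℝ :=
  prodWeight p₁ c.1 * prodWeight p₂ c.2.1 * prodWeight (cloudWeight w κ) c.2.2

/-- The expectation of a function of the noise of the channel with the given inputs. -/
def noiseSum (W : ZMod q → ZMod q → ZMod q → Y → ℝ) (pZ₁ pZ₂ : ZMod q → ℝ) (x₁ x₂ x₃ : ZMod q)
    (G : Y → ZMod q → ZMod q → ℝ) : ℝ :=
  ∑ y, W x₁ x₂ x₃ y * ∑ z₁, pZ₁ z₁ * ∑ z₂, pZ₂ z₂ * G y z₁ z₂

theorem noiseSum_const (hW : ∀ x₁ x₂ x₃, W x₁ x₂ x₃ ∈ stdSimplex ℝ Y)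
    (hZ₁ : pZ₁ ∈ stdSimplex ℝ (ZMod q)) (hZ₂ : pZ₂ ∈ stdSimplex ℝ (ZMod q))
    (x₁ x₂ x₃ : ZMod q) (a : ℝ) : noiseSum W pZ₁ pZ₂ x₁ x₂ x₃ (fun _ _ _ => a) = a := by
  simp [noiseSum, ← Finset.sum_mul, hZ₁.2, hZ₂.2, (hW _ _ _).2]

theorem sum_joint_expand (p₁ p₂ : ZMod q → ℝ) (r : V × ZMod q → ℝ) (F : Outcome q V Y → ℝ) :
    ∑ ω, jointDist (prodInput p₁ p₂ r) W pZ₁ pZ₂ ω * F ω =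
      ∑ x₁, p₁ x₁ * ∑ x₂, p₂ x₂ * ∑ u : V × ZMod q, r u *
        noiseSum W pZ₁ pZ₂ x₁ x₂ u.2 fun y z₁ z₂ => F (x₁, x₂, u.2, u.1, y, z₁, z₂) := by
  rw [sum_jointDist_mul, Fintype.sum_prod_type]
  refine Finset.sum_congr rfl fun x₁ _ => ?_
  rw [Fintype.sum_prod_type, Finset.mul_sum]
  refine Finset.sum_congr rfl fun x₂ _ => ?_
  rw [Fintype.sum_prod_type, Fintype.sum_prod_type, Finset.sum_comm]
  simp only [prodInput, noiseSum, mul_assoc, Finset.mul_sum]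

/-- The three parts of a codebook letter are independent, so each can be replaced by the marginal of
the few codewords that an event involves. -/
theorem sum_letterWeight_mul {τ₁ τ₂ τ₃ : Type*} [Fintype τ₁] [Fintype τ₂] [Fintype τ₃]
    {T₁ : (Fin k₁ → ZMod q) → τ₁} {T₂ : (Fin k₂ → ZMod q) → τ₂}
    {T₃ : (Fin k₄ → V × (Fin k₃ → ZMod q)) → τ₃} {L₁ : τ₁ → ℝ} {L₂ : τ₂ → ℝ} {L₃ : τ₃ → ℝ}
    (h₁ : ∀ F : τ₁ → ℝ, ∑ c, prodWeight p₁ c * F (T₁ c) = ∑ t, L₁ t * F t)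
    (h₂ : ∀ F : τ₂ → ℝ, ∑ c, prodWeight p₂ c * F (T₂ c) = ∑ t, L₂ t * F t)
    (h₃ : ∀ F : τ₃ → ℝ, ∑ c, prodWeight (cloudWeight w κ) c * F (T₃ c) = ∑ t, L₃ t * F t)
    (G : τ₁ → τ₂ → τ₃ → ℝ) :
    ∑ c : Letter q V k₁ k₂ k₃ k₄, letterWeight p₁ p₂ w κ c * G (T₁ c.1) (T₂ c.2.1) (T₃ c.2.2) =
      ∑ t₁, L₁ t₁ * ∑ t₂, L₂ t₂ * ∑ t₃, L₃ t₃ * G t₁ t₂ t₃ := by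
  rw [← h₁ fun t₁ => ∑ t₂, L₂ t₂ * ∑ t₃, L₃ t₃ * G t₁ t₂ t₃, Fintype.sum_prod_type]
  refine Finset.sum_congr rfl fun c₁ _ => ?_
  rw [← h₂ fun t₂ => ∑ t₃, L₃ t₃ * G (T₁ c₁) t₂ t₃, Fintype.sum_prod_type, Finset.mul_sum]
  refine Finset.sum_congr rfl fun c₂ _ => ?_
  rw [← h₃ fun t₃ => G (T₁ c₁) (T₂ c₂) t₃, Finset.mul_sum, Finset.mul_sum]
  simp only [letterWeight, mul_assoc]

variable (hp₁ : p₁ ∈ stdSimplex ℝ (ZMod q)) (hp₂ : p₂ ∈ stdSimplex ℝ (ZMod q))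
  (hw : w ∈ stdSimplex ℝ V) (hκ : ∀ v, κ v ∈ stdSimplex ℝ (ZMod q))

/-- The law of `(V, X₃)` given the law of `V` and the conditional law of `X₃`. -/
abbrev mixInput (w : V → ℝ) (κ : V → ZMod q → ℝ) : V × ZMod q → ℝ := fun u => w u.1 * κ u.1 u.2

section Marginals

include hκ in
theorem sum_cloudWeight_one (m₃ : Fin k₃) (F : V → ZMod q → ℝ) :
    ∑ c, cloudWeight w κ c * F c.1 (c.2 m₃) = ∑ v, w v * ∑ x, κ v x * F v x := by
  rw [Fintype.sum_prod_type]
  refine Finset.sum_congr rfl fun v _ => ?_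
  rw [← sum_prodWeight_mul_one (hκ v) m₃, Finset.mul_sum]
  simp only [cloudWeight, mul_assoc]

include hκ in
theorem sum_cloudWeight_two {m₃ m₃' : Fin k₃} (h : m₃' ≠ m₃) (F : V → ZMod q → ZMod q → ℝ) :
    ∑ c, cloudWeight w κ c * F c.1 (c.2 m₃') (c.2 m₃) =
      ∑ v, w v * ∑ x', κ v x' * ∑ x, κ v x * F v x' x := by
  rw [Fintype.sum_prod_type]
  refine Finset.sum_congr rfl fun v _ => ?_
  rw [← sum_prodWeight_mul_two (hκ v) h, Finset.mul_sum]
  simp only [cloudWeight, mul_assoc]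

include hw hκ

theorem cloudWeight_mem_stdSimplex :
    (cloudWeight w κ : V × (Fin k₃ → ZMod q) → ℝ) ∈ stdSimplex ℝ _ := by
  refine ⟨fun c => mul_nonneg (hw.1 _) ((prodWeight_mem_stdSimplex (hκ _)).1 _), ?_⟩
  rw [Fintype.sum_prod_type]
  simp [cloudWeight, ← Finset.mul_sum, (prodWeight_mem_stdSimplex (hκ _)).2, hw.2]

theorem sum_clouds_one (m₃ : Fin k₃) (m₄ : Fin k₄) (F : V × ZMod q → ℝ) :
    ∑ c : Fin k₄ → V × (Fin k₃ → ZMod q), prodWeight (cloudWeight w κ) c *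
      F ((c m₄).1, (c m₄).2 m₃) = ∑ u : V × ZMod q, w u.1 * κ u.1 u.2 * F u := by
  rw [sum_prodWeight_mul_one (cloudWeight_mem_stdSimplex hw hκ) m₄ fun cl => F (cl.1, cl.2 m₃),
    sum_cloudWeight_one hκ m₃ fun v x => F (v, x), Fintype.sum_prod_type]
  simp only [Finset.mul_sum, mul_assoc]

/-- Different clouds are independent: a wrong center is a fresh sample of V. -/
theorem sum_clouds_center (m₃ : Fin k₃) {m₄ m₄' : Fin k₄} (h : m₄' ≠ m₄)
    (F : V × (V × ZMod q) → ℝ) :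
    ∑ c : Fin k₄ → V × (Fin k₃ → ZMod q), prodWeight (cloudWeight w κ) c *
      F ((c m₄').1, ((c m₄).1, (c m₄).2 m₃)) =
    ∑ u : V × (V × ZMod q), w u.1 * (w u.2.1 * κ u.2.1 u.2.2) * F u := by
  rw [sum_prodWeight_mul_two (cloudWeight_mem_stdSimplex hw hκ) h
    fun cl' cl => F (cl'.1, (cl.1, cl.2 m₃)),
    sum_cloudWeight_one hκ m₃ fun v' _ => ∑ cl, cloudWeight w κ cl * F (v', (cl.1, cl.2 m₃)),
    Fintype.sum_prod_type]
  refine Finset.sum_congr rfl fun v' _ => ?_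
  rw [← Finset.sum_mul, (hκ v').2, one_mul,
    sum_cloudWeight_one hκ m₃ fun v x => F (v', (v, x)), Fintype.sum_prod_type]
  simp only [Finset.mul_sum, mul_assoc]

/-- Within the true cloud a wrong satellite shares V with the one sent and is independent of it only
given V. -/
theorem sum_clouds_satellite {m₃ m₃' : Fin k₃} (h : m₃' ≠ m₃) (m₄ : Fin k₄)
    (F : ZMod q × (V × ZMod q) → ℝ) :
    ∑ c : Fin k₄ → V × (Fin k₃ → ZMod q), prodWeight (cloudWeight w κ) c *
      F ((c m₄).2 m₃', ((c m₄).1, (c m₄).2 m₃)) =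
    ∑ u : ZMod q × (V × ZMod q), κ u.2.1 u.1 * (w u.2.1 * κ u.2.1 u.2.2) * F u := by
  rw [sum_prodWeight_mul_one (cloudWeight_mem_stdSimplex hw hκ) m₄
    fun cl => F (cl.2 m₃', (cl.1, cl.2 m₃)),
    sum_cloudWeight_two hκ h fun v x' x => F (x', (v, x)), Fintype.sum_prod_type]
  simp only [Fintype.sum_prod_type, Finset.mul_sum]
  rw [Finset.sum_comm]
  refine Finset.sum_congr rfl fun v _ => Finset.sum_congr rfl fun x' _ =>
    Finset.sum_congr rfl fun x _ => by ring

omit hw hκ in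
theorem sum_codewords_two {p : ZMod q → ℝ} (hp : p ∈ stdSimplex ℝ (ZMod q)) {k : ℕ}
    {m m' : Fin k} (h : m' ≠ m) (F : ZMod q × ZMod q → ℝ) :
    ∑ c : Fin k → ZMod q, prodWeight p c * F (c m', c m) =
      ∑ u : ZMod q × ZMod q, p u.1 * p u.2 * F u := by
  rw [sum_prodWeight_mul_two hp h fun a b => F (a, b), Fintype.sum_prod_type]
  simp only [Finset.mul_sum, mul_assoc]

end Marginals

/-- The law of the letter of a random codebook and the noise, when the given messages are sent. -/
def sentDist (W : ZMod q → ZMod q → ZMod q → Y → ℝ) (pZ₁ pZ₂ p₁ p₂ : ZMod q → ℝ) (w : V → ℝ)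
    (κ : V → ZMod q → ℝ) (m₁ : Fin k₁) (m₂ : Fin k₂) (m₃ : Fin k₃) (m₄ : Fin k₄) :
    Letter q V k₁ k₂ k₃ k₄ × Y × ZMod q × ZMod q → ℝ :=
  stepDist (letterWeight p₁ p₂ w κ) W pZ₁ pZ₂ (fun c => c.1 m₁) (fun c => c.2.1 m₂)
    fun c => (c.2.2 m₄).2 m₃

/-- The inputs, the auxiliary variable and the noise, when the given messages are sent. -/
def sentOutcome (m₁ : Fin k₁) (m₂ : Fin k₂) (m₃ : Fin k₃) (m₄ : Fin k₄)
    (s : Letter q V k₁ k₂ k₃ k₄ × Y × ZMod q × ZMod q) : Outcome q V Y :=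
  (s.1.1 m₁, s.1.2.1 m₂, (s.1.2.2 m₄).2 m₃, (s.1.2.2 m₄).1, s.2)

theorem sum_sentDist_mul (m₁ : Fin k₁) (m₂ : Fin k₂) (m₃ : Fin k₃) (m₄ : Fin k₄)
    (F : Letter q V k₁ k₂ k₃ k₄ × Y × ZMod q × ZMod q → ℝ) :
    ∑ s, sentDist W pZ₁ pZ₂ p₁ p₂ w κ m₁ m₂ m₃ m₄ s * F s =
    ∑ c, letterWeight p₁ p₂ w κ c * noiseSum W pZ₁ pZ₂ (c.1 m₁) (c.2.1 m₂) ((c.2.2 m₄).2 m₃)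
      fun y z₁ z₂ => F (c, y, z₁, z₂) :=
  sum_stepDist_mul F

section Sent

include hp₁ hp₂ hw hκ

theorem sum_sent (m₁ : Fin k₁) (m₂ : Fin k₂) (m₃ : Fin k₃) (m₄ : Fin k₄)
    (F : Outcome q V Y → ℝ) :
    ∑ s, sentDist W pZ₁ pZ₂ p₁ p₂ w κ m₁ m₂ m₃ m₄ s * F (sentOutcome m₁ m₂ m₃ m₄ s) =
      ∑ ω, jointDist (prodInput p₁ p₂ (mixInput w κ)) W pZ₁ pZ₂ ω * F ω := by
  rw [sum_sentDist_mul, sum_joint_expand]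
  exact sum_letterWeight_mul (sum_prodWeight_mul_one hp₁ m₁) (sum_prodWeight_mul_one hp₂ m₂)
    (sum_clouds_one hw hκ m₃ m₄) fun x₁ x₂ u => noiseSum W pZ₁ pZ₂ x₁ x₂ u.2
      fun y z₁ z₂ => F (x₁, x₂, u.2, u.1, y, z₁, z₂)

/-- A wrong codeword of user 1 is independent of everything sent and received. This statement and
the next four provide the hypothesis `hT` of `sum_passesTest_le` for each kind of wrong message. -/
theorem sum_sent₁ {m₁ m₁' : Fin k₁} (h : m₁' ≠ m₁) (m₂ : Fin k₂) (m₃ : Fin k₃) (m₄ : Fin k₄)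
    (F : ZMod q → Outcome q V Y → ℝ) :
    ∑ s, sentDist W pZ₁ pZ₂ p₁ p₂ w κ m₁ m₂ m₃ m₄ s *
      F (s.1.1 m₁') (sentOutcome m₁ m₂ m₃ m₄ s) = ∑ ω, jointDist (prodInput p₁ p₂ (mixInput w κ)) W pZ₁ pZ₂ ω * ∑ a, p₁ a * F a ω := by
  rw [sum_sentDist_mul]
  refine (sum_letterWeight_mul (sum_codewords_two hp₁ h) (sum_prodWeight_mul_one hp₂ m₂)
    (sum_clouds_one hw hκ m₃ m₄) fun x x₂ u => noiseSum W pZ₁ pZ₂ x.2 x₂ u.2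
      fun y z₁ z₂ => F x.1 (x.2, x₂, u.2, u.1, y, z₁, z₂)).trans ?_
  rw [sum_mul_sum_mul (jointDist _ W pZ₁ pZ₂)]
  simp only [sum_joint_expand]
  simp only [Fintype.sum_prod_type (α₁ := ZMod q) (α₂ := ZMod q), Finset.mul_sum]
  refine Finset.sum_congr rfl fun a _ => Finset.sum_congr rfl fun x₁ _ =>
    Finset.sum_congr rfl fun x₂ _ => Finset.sum_congr rfl fun u _ => by ring

theorem sum_sent₂ (m₁ : Fin k₁) {m₂ m₂' : Fin k₂} (h : m₂' ≠ m₂) (m₃ : Fin k₃) (m₄ : Fin k₄)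
    (F : ZMod q → Outcome q V Y → ℝ) :
    ∑ s, sentDist W pZ₁ pZ₂ p₁ p₂ w κ m₁ m₂ m₃ m₄ s *
      F (s.1.2.1 m₂') (sentOutcome m₁ m₂ m₃ m₄ s) = ∑ ω, jointDist (prodInput p₁ p₂ (mixInput w κ)) W pZ₁ pZ₂ ω * ∑ a, p₂ a * F a ω := by
  rw [sum_sentDist_mul]
  refine (sum_letterWeight_mul (sum_prodWeight_mul_one hp₁ m₁) (sum_codewords_two hp₂ h)
    (sum_clouds_one hw hκ m₃ m₄) fun x₁ x u => noiseSum W pZ₁ pZ₂ x₁ x.2 u.2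
      fun y z₁ z₂ => F x.1 (x₁, x.2, u.2, u.1, y, z₁, z₂)).trans ?_
  rw [sum_mul_sum_mul (jointDist _ W pZ₁ pZ₂)]
  simp only [sum_joint_expand]
  simp only [Fintype.sum_prod_type (α₁ := ZMod q) (α₂ := ZMod q), Finset.mul_sum]
  rw [Finset.sum_comm]
  refine Finset.sum_congr rfl fun a _ => Finset.sum_congr rfl fun x₁ _ =>
    Finset.sum_congr rfl fun x₂ _ => Finset.sum_congr rfl fun u _ => by ring

theorem sum_sent₁₂ {m₁ m₁' : Fin k₁} (h : m₁' ≠ m₁) {m₂ m₂' : Fin k₂} (h' : m₂' ≠ m₂)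
    (m₃ : Fin k₃) (m₄ : Fin k₄) (F : ZMod q × ZMod q → Outcome q V Y → ℝ) :
    ∑ s, sentDist W pZ₁ pZ₂ p₁ p₂ w κ m₁ m₂ m₃ m₄ s *
      F (s.1.1 m₁', s.1.2.1 m₂') (sentOutcome m₁ m₂ m₃ m₄ s) =
      ∑ ω, jointDist (prodInput p₁ p₂ (mixInput w κ)) W pZ₁ pZ₂ ω * ∑ a : ZMod q × ZMod q, p₁ a.1 * p₂ a.2 * F a ω := by
  rw [sum_sentDist_mul]
  refine (sum_letterWeight_mul (sum_codewords_two hp₁ h) (sum_codewords_two hp₂ h')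
    (sum_clouds_one hw hκ m₃ m₄) fun x x' u => noiseSum W pZ₁ pZ₂ x.2 x'.2 u.2
      fun y z₁ z₂ => F (x.1, x'.1) (x.2, x'.2, u.2, u.1, y, z₁, z₂)).trans ?_
  rw [sum_mul_sum_mul (jointDist _ W pZ₁ pZ₂)]
  simp only [sum_joint_expand]
  simp only [Fintype.sum_prod_type (α₁ := ZMod q) (α₂ := ZMod q), Finset.mul_sum]
  refine Finset.sum_congr rfl fun a _ => ?_
  rw [Finset.sum_comm]
  refine Finset.sum_congr rfl fun a' _ => Finset.sum_congr rfl fun x₁ _ =>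
    Finset.sum_congr rfl fun x₂ _ => Finset.sum_congr rfl fun u _ => by ring

theorem sum_sent_center (m₁ : Fin k₁) (m₂ : Fin k₂) (m₃ : Fin k₃) {m₄ m₄' : Fin k₄}
    (h : m₄' ≠ m₄) (F : V → Outcome q V Y → ℝ) :
    ∑ s, sentDist W pZ₁ pZ₂ p₁ p₂ w κ m₁ m₂ m₃ m₄ s *
      F (s.1.2.2 m₄').1 (sentOutcome m₁ m₂ m₃ m₄ s) = ∑ ω, jointDist (prodInput p₁ p₂ (mixInput w κ)) W pZ₁ pZ₂ ω * ∑ a, w a * F a ω := by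
  rw [sum_sentDist_mul]
  refine (sum_letterWeight_mul (sum_prodWeight_mul_one hp₁ m₁) (sum_prodWeight_mul_one hp₂ m₂)
    (sum_clouds_center hw hκ m₃ h) fun x₁ x₂ u => noiseSum W pZ₁ pZ₂ x₁ x₂ u.2.2
      fun y z₁ z₂ => F u.1 (x₁, x₂, u.2.2, u.2.1, y, z₁, z₂)).trans ?_
  rw [sum_mul_sum_mul (jointDist _ W pZ₁ pZ₂)]
  simp only [sum_joint_expand]
  simp only [Fintype.sum_prod_type (α₁ := V) (α₂ := V × ZMod q), Finset.mul_sum]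
  have e' : ∀ G : ZMod q → ZMod q → V → V × ZMod q → ℝ,
      ∑ x₁, ∑ x₂, ∑ a, ∑ u, G x₁ x₂ a u = ∑ a, ∑ x₁, ∑ x₂, ∑ u, G x₁ x₂ a u := by
    intro G
    rw [Finset.sum_comm (s := (Finset.univ : Finset V))]
    exact Finset.sum_congr rfl fun x₁ _ => Finset.sum_comm
  rw [e']
  refine Finset.sum_congr rfl fun a _ => Finset.sum_congr rfl fun x₁ _ =>
    Finset.sum_congr rfl fun x₂ _ => Finset.sum_congr rfl fun u _ => by ring

theorem sum_sent_satellite (m₁ : Fin k₁) (m₂ : Fin k₂) {m₃ m₃' : Fin k₃} (h : m₃' ≠ m₃)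
    (m₄ : Fin k₄) (F : ZMod q → Outcome q V Y → ℝ) :
    ∑ s, sentDist W pZ₁ pZ₂ p₁ p₂ w κ m₁ m₂ m₃ m₄ s *
      F ((s.1.2.2 m₄).2 m₃') (sentOutcome m₁ m₂ m₃ m₄ s) =
      ∑ ω, jointDist (prodInput p₁ p₂ (mixInput w κ)) W pZ₁ pZ₂ ω * ∑ a, κ (aux ω) a * F a ω := by
  rw [sum_sentDist_mul]
  refine (sum_letterWeight_mul (sum_prodWeight_mul_one hp₁ m₁) (sum_prodWeight_mul_one hp₂ m₂)
    (sum_clouds_satellite hw hκ h m₄) fun x₁ x₂ u => noiseSum W pZ₁ pZ₂ x₁ x₂ u.2.2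
      fun y z₁ z₂ => F u.1 (x₁, x₂, u.2.2, u.2.1, y, z₁, z₂)).trans ?_
  rw [sum_joint_expand]
  refine Finset.sum_congr rfl fun x₁ _ => congrArg _ (Finset.sum_congr rfl fun x₂ _ =>
    congrArg _ ?_)
  rw [Fintype.sum_prod_type, Finset.sum_comm]
  refine Finset.sum_congr rfl fun u _ => ?_
  have e : ∀ (c : ZMod q → ℝ) (G : ZMod q → Y → ZMod q → ZMod q → ℝ),
      noiseSum W pZ₁ pZ₂ x₁ x₂ u.2 (fun y z₁ z₂ => ∑ a, c a * G a y z₁ z₂) =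
        ∑ a, c a * noiseSum W pZ₁ pZ₂ x₁ x₂ u.2 (G a) := by
    intro c G
    simp only [noiseSum, Finset.mul_sum]
    have e' : ∀ H : Y → ZMod q → ZMod q → ZMod q → ℝ, ∑ y, ∑ z₁, ∑ z₂, ∑ a, H y z₁ z₂ a =
        ∑ a, ∑ y, ∑ z₁, ∑ z₂, H y z₁ z₂ a := by
      intro H
      rw [Finset.sum_comm (t := (Finset.univ : Finset Y))]
      refine Finset.sum_congr rfl fun y _ => ?_
      rw [Finset.sum_comm (γ := ZMod q) (s := Finset.univ) (t := Finset.univ)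
        (f := fun a z₁ => ∑ z₂, H y z₁ z₂ a)]
      exact Finset.sum_congr rfl fun z₁ _ => Finset.sum_comm
    rw [e']
    refine Finset.sum_congr rfl fun a _ => Finset.sum_congr rfl fun y _ =>
      Finset.sum_congr rfl fun z₁ _ => Finset.sum_congr rfl fun z₂ _ => by ring
  have e2 := e (κ u.1) fun a y z₁ z₂ => F a (x₁, x₂, u.2, u.1, y, z₁, z₂)
  simp only [aux] at e2 ⊢
  rw [e2, Finset.mul_sum]
  exact Finset.sum_congr rfl fun a _ => by ring

end Sent

end Letter

/-! ### The union bound -/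

section Prob

variable {Ω ι : Type*} [Fintype Ω] {P : Ω → ℝ}

open Classical in
/-- The probability of an event. -/
def prob (P : Ω → ℝ) (p : Ω → Prop) : ℝ := ∑ ω, P ω * if p ω then 1 else 0

theorem prob_mono (hP : ∀ ω, 0 ≤ P ω) {p p' : Ω → Prop} (h : ∀ ω, p ω → p' ω) :
    prob P p ≤ prob P p' := by
  refine Finset.sum_le_sum fun ω _ => mul_le_mul_of_nonneg_left ?_ (hP ω)
  split_ifs with h1 h2 h2
  exacts [le_rfl, (h2 (h _ h1)).elim, zero_le_one, le_rfl]

theorem prob_or_le (hP : ∀ ω, 0 ≤ P ω) (p p' : Ω → Prop) :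
    prob P (fun ω => p ω ∨ p' ω) ≤ prob P p + prob P p' := by
  rw [prob, prob, prob, ← Finset.sum_add_distrib]
  refine Finset.sum_le_sum fun ω _ => ?_
  rw [← mul_add]
  refine mul_le_mul_of_nonneg_left ?_ (hP ω)
  by_cases h1 : p ω <;> by_cases h2 : p' ω <;> simp [h1, h2]

theorem prob_exists_le (hP : ∀ ω, 0 ≤ P ω) (s : Finset ι) (p : ι → Ω → Prop) {b : ℝ}
    (hb : ∀ i ∈ s, prob P (p i) ≤ b) : prob P (fun ω => ∃ i ∈ s, p i ω) ≤ s.card * b := by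
  classical
  calc prob P (fun ω => ∃ i ∈ s, p i ω) ≤ ∑ i ∈ s, prob P (p i) := by
        simp only [prob]
        rw [Finset.sum_comm]
        refine Finset.sum_le_sum fun ω _ => ?_
        rw [← Finset.mul_sum]
        refine mul_le_mul_of_nonneg_left ?_ (hP ω)
        split_ifs with h
        · obtain ⟨i, hi, hpi⟩ := h
          refine le_trans ?_ (Finset.single_le_sum (f := fun i => if p i ω then (1 : ℝ) else 0)
            (fun j _ => by split_ifs <;> norm_num) hi)
          simp [hpi]
        · exact Finset.sum_nonneg fun j _ => by split_ifs <;> norm_num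
    _ ≤ s.card * b := by
        rw [← nsmul_eq_mul]
        exact Finset.sum_le_card_nsmul _ _ _ hb

theorem card_erase_mul_le {k : ℕ} (m : Fin k) (b : ℝ) :
    ((Finset.univ.erase m).card : ℝ) * b = (k - 1) * b := by
  have hk : 1 ≤ k := m.pos
  rw [Finset.card_erase_of_mem (Finset.mem_univ m), Finset.card_univ, Fintype.card_fin,
    Nat.cast_sub hk, Nat.cast_one]

theorem ite_eq_mul_ite {p p' : Prop} {_ : Decidable p} {_ : Decidable p'} (h : p ↔ p') (a : ℝ) :
    (if p then a else 0) = a * if p' then 1 else 0 := by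
  by_cases hp : p
  · rw [if_pos hp, if_pos (h.1 hp), mul_one]
  · rw [if_neg hp, if_neg (mt h.2 hp), mul_zero]

theorem ite_not_eq {p : Prop} {_ : Decidable p} {_ : Decidable (¬ p)} :
    (if ¬ p then (1 : ℝ) else 0) = if p then 0 else 1 := by
  by_cases hp : p
  · rw [if_pos hp, if_neg (not_not.2 hp)]
  · rw [if_pos hp, if_neg hp]

end Prob

/-! ### Failure of the tests for the messages sent and for wrong messages -/

section Events

open Outcome

variable {q : ℕ} [NeZero q] {Y V : Type*} [Fintype Y] [Fintype V] {k₁ k₂ k₃ k₄ : ℕ}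
  {W : ZMod q → ZMod q → ZMod q → Y → ℝ} {pZ₁ pZ₂ : ZMod q → ℝ}
  {p₁ p₂ : ZMod q → ℝ} {w : V → ℝ} {κ : V → ZMod q → ℝ}

theorem mixInput_mem_stdSimplex (hw : w ∈ stdSimplex ℝ V)
    (hκ : ∀ v, κ v ∈ stdSimplex ℝ (ZMod q)) : mixInput w κ ∈ stdSimplex ℝ (V × ZMod q) := by
  refine ⟨fun u => mul_nonneg (hw.1 _) ((hκ _).1 _), ?_⟩
  rw [Fintype.sum_prod_type]
  change ∑ v, ∑ x, w v * κ v x = 1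
  simp only [← Finset.mul_sum, (hκ _).2, mul_one, hw.2]

theorem letterWeight_mem_stdSimplex (hp₁ : p₁ ∈ stdSimplex ℝ (ZMod q))
    (hp₂ : p₂ ∈ stdSimplex ℝ (ZMod q)) (hw : w ∈ stdSimplex ℝ V)
    (hκ : ∀ v, κ v ∈ stdSimplex ℝ (ZMod q)) :
    (letterWeight p₁ p₂ w κ : Letter q V k₁ k₂ k₃ k₄ → ℝ) ∈ stdSimplex ℝ _ := by
  have h₁ := prodWeight_mem_stdSimplex (ι := Fin k₁) hp₁
  have h₂ := prodWeight_mem_stdSimplex (ι := Fin k₂) hp₂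
  have h₃ := prodWeight_mem_stdSimplex (ι := Fin k₄)
    (cloudWeight_mem_stdSimplex (k₃ := k₃) hw hκ)
  refine ⟨fun c => mul_nonneg (mul_nonneg (h₁.1 _) (h₂.1 _)) (h₃.1 _), ?_⟩
  simp only [letterWeight, Fintype.sum_prod_type]
  simp [← Finset.mul_sum, h₁.2, h₂.2, h₃.2]

theorem sum_joint_input (hW : ∀ x₁ x₂ x₃, W x₁ x₂ x₃ ∈ stdSimplex ℝ Y)
    (hZ₁ : pZ₁ ∈ stdSimplex ℝ (ZMod q)) (hZ₂ : pZ₂ ∈ stdSimplex ℝ (ZMod q))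
    (r : V × ZMod q → ℝ) (F : ZMod q → ZMod q → V × ZMod q → ℝ) :
    ∑ ω, jointDist (prodInput p₁ p₂ r) W pZ₁ pZ₂ ω * F (X₁ ω) (X₂ ω) (aux ω, X₃ ω) =
      ∑ x₁, p₁ x₁ * ∑ x₂, p₂ x₂ * ∑ u, r u * F x₁ x₂ u := by
  rw [sum_joint_expand]
  simp only [X₁, X₂, aux, X₃, noiseSum_const hW hZ₁ hZ₂]

section Kernels

variable (hp₁ : p₁ ∈ stdSimplex ℝ (ZMod q)) (hp₂ : p₂ ∈ stdSimplex ℝ (ZMod q))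
  (hw : w ∈ stdSimplex ℝ V) (hκ : ∀ v, κ v ∈ stdSimplex ℝ (ZMod q))
  (hW : ∀ x₁ x₂ x₃, W x₁ x₂ x₃ ∈ stdSimplex ℝ Y)
  (hZ₁ : pZ₁ ∈ stdSimplex ℝ (ZMod q)) (hZ₂ : pZ₂ ∈ stdSimplex ℝ (ZMod q))
include hp₁ hp₂ hw hκ hW hZ₁ hZ₂

/-- The true X₁ has the same conditional law given (X₂, X₃) as a wrong codeword letter; this and its
analogues below provide the hypothesis `hκ` of `sum_passesTest_le`. -/
theorem kernel_X₁ (F : ZMod q × ZMod q → ZMod q → ℝ) :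
    ∑ ω, jointDist (prodInput p₁ p₂ (mixInput w κ)) W pZ₁ pZ₂ ω * F (X₂ ω, X₃ ω) (X₁ ω) =
    ∑ ω, jointDist (prodInput p₁ p₂ (mixInput w κ)) W pZ₁ pZ₂ ω *
      ∑ a, p₁ a * F (X₂ ω, X₃ ω) a := by
  rw [sum_joint_input hW hZ₁ hZ₂ _ fun x₁ x₂ u => F (x₂, u.2) x₁,
    sum_joint_input hW hZ₁ hZ₂ _ fun x₁ x₂ u => ∑ a, p₁ a * F (x₂, u.2) a, ← Finset.sum_mul, hp₁.2,
    one_mul, sum_mul_sum_mul p₁]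
  refine Finset.sum_congr rfl fun x₂ _ => congrArg _ ?_
  rw [sum_mul_sum_mul p₁]

theorem kernel_X₂ (F : ZMod q × ZMod q → ZMod q → ℝ) :
    ∑ ω, jointDist (prodInput p₁ p₂ (mixInput w κ)) W pZ₁ pZ₂ ω * F (X₁ ω, X₃ ω) (X₂ ω) =
    ∑ ω, jointDist (prodInput p₁ p₂ (mixInput w κ)) W pZ₁ pZ₂ ω *
      ∑ a, p₂ a * F (X₁ ω, X₃ ω) a := by
  rw [sum_joint_input hW hZ₁ hZ₂ _ fun x₁ x₂ u => F (x₁, u.2) x₂,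
    sum_joint_input hW hZ₁ hZ₂ _ fun x₁ x₂ u => ∑ a, p₂ a * F (x₁, u.2) a]
  refine Finset.sum_congr rfl fun x₁ _ => congrArg _ ?_
  rw [← Finset.sum_mul, hp₂.2, one_mul, sum_mul_sum_mul p₂]

theorem kernel_X₁₂ (F : ZMod q → ZMod q × ZMod q → ℝ) :
    ∑ ω, jointDist (prodInput p₁ p₂ (mixInput w κ)) W pZ₁ pZ₂ ω * F (X₃ ω) (X₁ ω, X₂ ω) =
    ∑ ω, jointDist (prodInput p₁ p₂ (mixInput w κ)) W pZ₁ pZ₂ ω *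
      ∑ a : ZMod q × ZMod q, p₁ a.1 * p₂ a.2 * F (X₃ ω) a := by
  rw [sum_joint_input hW hZ₁ hZ₂ _ fun x₁ x₂ u => F u.2 (x₁, x₂),
    sum_joint_input hW hZ₁ hZ₂ _ fun x₁ x₂ u => ∑ a : ZMod q × ZMod q, p₁ a.1 * p₂ a.2 * F u.2 a,
    ← Finset.sum_mul, hp₁.2, one_mul, ← Finset.sum_mul, hp₂.2, one_mul, sum_mul_sum_mul (mixInput w κ),
    Fintype.sum_prod_type]
  simp only [Finset.mul_sum, mul_assoc]

theorem kernel_aux (F : Unit → V → ℝ) :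
    ∑ ω, jointDist (prodInput p₁ p₂ (mixInput w κ)) W pZ₁ pZ₂ ω * F () (aux ω) =
    ∑ ω, jointDist (prodInput p₁ p₂ (mixInput w κ)) W pZ₁ pZ₂ ω * ∑ a, w a * F () a := by
  have hP := jointDist_mem_stdSimplex (prodInput_mem_stdSimplex hp₁ hp₂
    (mixInput_mem_stdSimplex hw hκ)) hW hZ₁ hZ₂
  rw [sum_joint_input hW hZ₁ hZ₂ _ fun x₁ x₂ u => F () u.1, ← Finset.sum_mul, ← Finset.sum_mul,
    ← Finset.sum_mul, hp₁.2, one_mul, hp₂.2, one_mul, hP.2, one_mul, Fintype.sum_prod_type]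
  refine Finset.sum_congr rfl fun v _ => ?_
  simp only [mixInput]
  rw [← Finset.sum_mul, ← Finset.mul_sum, (hκ v).2, mul_one]

theorem kernel_X₃ (F : V → ZMod q → ℝ) :
    ∑ ω, jointDist (prodInput p₁ p₂ (mixInput w κ)) W pZ₁ pZ₂ ω * F (aux ω) (X₃ ω) =
    ∑ ω, jointDist (prodInput p₁ p₂ (mixInput w κ)) W pZ₁ pZ₂ ω *
      ∑ a, κ (aux ω) a * F (aux ω) a := by
  rw [sum_joint_input hW hZ₁ hZ₂ _ fun x₁ x₂ u => F u.1 u.2,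
    sum_joint_input hW hZ₁ hZ₂ _ fun x₁ x₂ u => ∑ a, κ u.1 a * F u.1 a]
  refine Finset.sum_congr rfl fun x₁ _ => congrArg _ (Finset.sum_congr rfl fun x₂ _ =>
    congrArg _ ?_)
  rw [Fintype.sum_prod_type, Fintype.sum_prod_type]
  refine Finset.sum_congr rfl fun v _ => ?_
  simp only [mixInput]
  rw [← Finset.sum_mul, ← Finset.mul_sum, (hκ v).2, mul_one, Finset.mul_sum]
  simp only [mul_assoc]

end Kernels

variable (hp₁ : p₁ ∈ stdSimplex ℝ (ZMod q)) (hp₂ : p₂ ∈ stdSimplex ℝ (ZMod q))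
  (hw : w ∈ stdSimplex ℝ V) (hκ : ∀ v, κ v ∈ stdSimplex ℝ (ZMod q))
  (hW : ∀ x₁ x₂ x₃, W x₁ x₂ x₃ ∈ stdSimplex ℝ Y)
  (hZ₁ : pZ₁ ∈ stdSimplex ℝ (ZMod q)) (hZ₂ : pZ₂ ∈ stdSimplex ℝ (ZMod q))
include hp₁ hp₂ hw hκ

theorem law_sentOutcome (m₁ : Fin k₁) (m₂ : Fin k₂) (m₃ : Fin k₃) (m₄ : Fin k₄) :
    law (sentDist W pZ₁ pZ₂ p₁ p₂ w κ m₁ m₂ m₃ m₄) (sentOutcome m₁ m₂ m₃ m₄) =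
      jointDist (prodInput p₁ p₂ (mixInput w κ)) W pZ₁ pZ₂ := by
  rw [← law_id (jointDist (prodInput p₁ p₂ (mixInput w κ)) W pZ₁ pZ₂)]
  exact law_eq_of_forall fun F => by rw [sum_sent hp₁ hp₂ hw hκ]

theorem prob_fail_eq {α β γ : Type*} [Fintype α] [Fintype β] [Fintype γ]
    (m₁ : Fin k₁) (m₂ : Fin k₂) (m₃ : Fin k₃) (m₄ : Fin k₄)
    (A : Outcome q V Y → α) (B : Outcome q V Y → β) (C : Outcome q V Y → γ) (t : ℝ) (n : ℕ) :
    prob (prodWeight (sentDist W pZ₁ pZ₂ p₁ p₂ w κ m₁ m₂ m₃ m₄)) (fun c : Fin n → _ =>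
      ¬ PassesTest (jointDist (prodInput p₁ p₂ (mixInput w κ)) W pZ₁ pZ₂) A B C t
        (fun i => (A (sentOutcome m₁ m₂ m₃ m₄ (c i)), B (sentOutcome m₁ m₂ m₃ m₄ (c i)),
          C (sentOutcome m₁ m₂ m₃ m₄ (c i))))) =
    failProb (jointDist (prodInput p₁ p₂ (mixInput w κ)) W pZ₁ pZ₂) A B C t n := by
  classical
  have h := sum_law_mul (prodWeight (sentDist W pZ₁ pZ₂ p₁ p₂ w κ m₁ m₂ m₃ m₄))
    (fun (c : Fin n → _) i => sentOutcome m₁ m₂ m₃ m₄ (c i)) fun s =>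
      if PassesTest (jointDist (prodInput p₁ p₂ (mixInput w κ)) W pZ₁ pZ₂) A B C t
        (fun i => (A (s i), B (s i), C (s i))) then 0 else 1
  rw [law_prodWeight, law_sentOutcome hp₁ hp₂ hw hκ] at h
  rw [prob]
  refine Eq.trans ?_ (h.symm.trans ?_)
  · exact Finset.sum_congr rfl fun s _ => congrArg _ ite_not_eq
  · exact Finset.sum_congr rfl fun s _ => by rw [mul_ite, mul_zero, mul_one]

include hW hZ₁ hZ₂

theorem sentDist_nonneg (m₁ : Fin k₁) (m₂ : Fin k₂) (m₃ : Fin k₃) (m₄ : Fin k₄)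
    (s : Letter q V k₁ k₂ k₃ k₄ × Y × ZMod q × ZMod q) :
    0 ≤ sentDist W pZ₁ pZ₂ p₁ p₂ w κ m₁ m₂ m₃ m₄ s :=
  mul_nonneg (mul_nonneg (mul_nonneg ((letterWeight_mem_stdSimplex hp₁ hp₂ hw hκ).1 _)
    ((hW _ _ _).1 _)) (hZ₁.1 _)) (hZ₂.1 _)

/-- A' is the letter of a wrong codeword, tested against the true B and C; ρ is its conditional law
given C, shared by the true A. -/
theorem prob_pass_le {α β γ : Type*} [Fintype α] [Fintype β] [Fintype γ]
    (m₁ : Fin k₁) (m₂ : Fin k₂) (m₃ : Fin k₃) (m₄ : Fin k₄)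
    (A : Outcome q V Y → α) (B : Outcome q V Y → β) (C : Outcome q V Y → γ) (t : ℝ)
    (A' : Letter q V k₁ k₂ k₃ k₄ → α) (ρ : γ → α → ℝ)
    (hρ : ∀ F : γ → α → ℝ,
      ∑ ω, jointDist (prodInput p₁ p₂ (mixInput w κ)) W pZ₁ pZ₂ ω * F (C ω) (A ω) =
      ∑ ω, jointDist (prodInput p₁ p₂ (mixInput w κ)) W pZ₁ pZ₂ ω *
        ∑ a, ρ (C ω) a * F (C ω) a)
    (hA' : ∀ F : α → Outcome q V Y → ℝ,
      ∑ s, sentDist W pZ₁ pZ₂ p₁ p₂ w κ m₁ m₂ m₃ m₄ s *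
        F (A' s.1) (sentOutcome m₁ m₂ m₃ m₄ s) =
      ∑ ω, jointDist (prodInput p₁ p₂ (mixInput w κ)) W pZ₁ pZ₂ ω * ∑ a, ρ (C ω) a * F a ω)
    (n : ℕ) :
    prob (prodWeight (sentDist W pZ₁ pZ₂ p₁ p₂ w κ m₁ m₂ m₃ m₄)) (fun c : Fin n → _ =>
      PassesTest (jointDist (prodInput p₁ p₂ (mixInput w κ)) W pZ₁ pZ₂) A B C t
        (fun i => (A' (c i).1, B (sentOutcome m₁ m₂ m₃ m₄ (c i)),
          C (sentOutcome m₁ m₂ m₃ m₄ (c i))))) ≤ (2 : ℝ) ^ (-((n : ℝ) * t)) := by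
  have h := sum_passesTest_le (jointDist_mem_stdSimplex (prodInput_mem_stdSimplex hp₁ hp₂
    (mixInput_mem_stdSimplex hw hκ)) hW hZ₁ hZ₂) A B C t
    (sentDist_nonneg hp₁ hp₂ hw hκ hW hZ₁ hZ₂ m₁ m₂ m₃ m₄)
    (fun s => (A' s.1, B (sentOutcome m₁ m₂ m₃ m₄ s), C (sentOutcome m₁ m₂ m₃ m₄ s))) ρ hρ
    (fun F => hA' fun a ω => F (a, B ω, C ω)) n
  refine le_trans (le_of_eq ?_) h
  rw [prob]
  exact Finset.sum_congr rfl fun s _ => by split_ifs <;> simp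

end Events

/-! ### Random coding -/

section RandomCode

open Outcome

variable {q : ℕ} [NeZero q] {Y V : Type*} [Fintype Y] [Fintype V] {n k₁ k₂ k₃ k₄ : ℕ}
  {W : ZMod q → ZMod q → ZMod q → Y → ℝ} {pZ₁ pZ₂ : ZMod q → ℝ}
  {p₁ p₂ : ZMod q → ℝ} {w : V → ℝ} {κ : V → ZMod q → ℝ}

/-- User 3 accepts a pair of messages of users 1 and 2. -/
def Accepts₃ (J : Outcome q V Y → ℝ) (t₁ t₂ t₁₂ : ℝ) (cb : Fin n → Letter q V k₁ k₂ k₃ k₄)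
    (m₃ : Fin k₃) (m₄ : Fin k₄) (y : Fin n → Y) (m : Fin k₁ × Fin k₂) : Prop :=
  PassesTest J X₁ Y₃ (fun ω => (X₂ ω, X₃ ω)) t₁
    (fun i => ((cb i).1 m.1, y i, ((cb i).2.1 m.2, ((cb i).2.2 m₄).2 m₃))) ∧
  PassesTest J X₂ Y₃ (fun ω => (X₁ ω, X₃ ω)) t₂
    (fun i => ((cb i).2.1 m.2, y i, ((cb i).1 m.1, ((cb i).2.2 m₄).2 m₃))) ∧
  PassesTest J (fun ω => (X₁ ω, X₂ ω)) Y₃ X₃ t₁₂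
    (fun i => (((cb i).1 m.1, (cb i).2.1 m.2), y i, ((cb i).2.2 m₄).2 m₃))

/-- User 1 accepts a pair of messages of user 3. -/
def Accepts₁ (J : Outcome q V Y → ℝ) (t₃ t₄ : ℝ) (cb : Fin n → Letter q V k₁ k₂ k₃ k₄)
    (m₁ : Fin k₁) (y : Fin n → ZMod q) (m : Fin k₃ × Fin k₄) : Prop :=
  PassesTest J aux (fun ω => X₃ ω + Z₁ ω) (fun _ => ()) t₄
    (fun i => (((cb i).2.2 m.2).1, y i - (cb i).1 m₁, ())) ∧
  PassesTest J X₃ (fun ω => X₃ ω + Z₁ ω) aux t₃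
    (fun i => (((cb i).2.2 m.2).2 m.1, y i - (cb i).1 m₁, ((cb i).2.2 m.2).1))

/-- User 2 accepts a message of user 3. -/
def Accepts₂ (J : Outcome q V Y → ℝ) (t₄ : ℝ) (cb : Fin n → Letter q V k₁ k₂ k₃ k₄)
    (m₂ : Fin k₂) (y : Fin n → ZMod q) (m : Fin k₄) : Prop :=
  PassesTest J aux (fun ω => X₃ ω + Z₁ ω + Z₂ ω) (fun _ => ()) t₄
    (fun i => (((cb i).2.2 m).1, y i - (cb i).2.1 m₂, ()))

/-- The code with a given codebook and decoding by threshold tests. -/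
def codebookCode [NeZero k₁] [NeZero k₂] [NeZero k₃] [NeZero k₄] (J : Outcome q V Y → ℝ)
    (t₁ t₂ t₁₂ t₃ t₄ : ℝ) (cb : Fin n → Letter q V k₁ k₂ k₃ k₄) : Code q Y n k₁ k₂ k₃ k₄ where
  f₁ i m₁ _ := (cb i).1 m₁
  f₂ i m₂ _ := (cb i).2.1 m₂
  f₃ i m₃ m₄ _ := ((cb i).2.2 m₄).2 m₃
  g₁ m₁ y := (Classical.epsilon (Accepts₁ J t₃ t₄ cb m₁ y)).1
  g₂ m₂ y := Classical.epsilon (Accepts₂ J t₄ cb m₂ y)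
  g₃ m₃ m₄ y := Classical.epsilon (Accepts₃ J t₁ t₂ t₁₂ cb m₃ m₄ y)

theorem epsilon_eq_of_forall {α : Type*} [Nonempty α] {p : α → Prop} {a : α} (ha : p a)
    (h : ∀ b, p b → b = a) : Classical.epsilon p = a :=
  h _ (Classical.epsilon_spec ⟨a, ha⟩)

/-- Change of variables from the noise to the outputs. -/
theorem sum_codebook_eq (m₁ : Fin k₁) (m₂ : Fin k₂) (m₃ : Fin k₃) (m₄ : Fin k₄)
    (G : (Fin n → Letter q V k₁ k₂ k₃ k₄) → (Fin n → ZMod q) → (Fin n → ZMod q) → (Fin n → Y) → ℝ) :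
    ∑ cb, prodWeight (letterWeight p₁ p₂ w κ) cb * ∑ y₁, ∑ y₂, ∑ y₃,
      (∏ i, channel W pZ₁ pZ₂ ((cb i).1 m₁) ((cb i).2.1 m₂) (((cb i).2.2 m₄).2 m₃)
        (y₁ i) (y₂ i) (y₃ i)) * G cb y₁ y₂ y₃ =
    ∑ c, prodWeight (sentDist W pZ₁ pZ₂ p₁ p₂ w κ m₁ m₂ m₃ m₄) c * G (fun i => (c i).1)
      (fun i => (c i).1.1 m₁ + ((c i).1.2.2 m₄).2 m₃ + (c i).2.2.1)
      (fun i => (c i).1.2.1 m₂ + ((c i).1.2.2 m₄).2 m₃ + (c i).2.2.1 + (c i).2.2.2)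
      (fun i => (c i).2.1) := by
  let e : ((Fin n → Letter q V k₁ k₂ k₃ k₄) × (Fin n → ZMod q) × (Fin n → ZMod q) × (Fin n → Y)) ≃
      (Fin n → Letter q V k₁ k₂ k₃ k₄ × Y × ZMod q × ZMod q) :=
    { toFun := fun x i => (x.1 i, x.2.2.2 i, x.2.1 i - (x.1 i).1 m₁ - ((x.1 i).2.2 m₄).2 m₃,
        x.2.2.1 i - (x.1 i).2.1 m₂ - x.2.1 i + (x.1 i).1 m₁)
      invFun := fun c => (fun i => (c i).1,
        fun i => (c i).1.1 m₁ + ((c i).1.2.2 m₄).2 m₃ + (c i).2.2.1,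
        fun i => (c i).1.2.1 m₂ + ((c i).1.2.2 m₄).2 m₃ + (c i).2.2.1 + (c i).2.2.2,
        fun i => (c i).2.1)
      left_inv := fun x => by
        refine Prod.ext rfl (Prod.ext ?_ (Prod.ext ?_ rfl)) <;> funext i <;> simp only <;> ring
      right_inv := fun c => by
        funext i
        refine Prod.ext rfl (Prod.ext rfl (Prod.ext ?_ ?_)) <;> simp only <;> ring }
  rw [← Equiv.sum_comp e]
  simp only [Fintype.sum_prod_type (α₂ := (Fin n → ZMod q) × (Fin n → ZMod q) × (Fin n → Y)),
    Fintype.sum_prod_type (α₁ := Fin n → ZMod q), Finset.mul_sum]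
  refine Finset.sum_congr rfl fun cb _ => Finset.sum_congr rfl fun y₁ _ =>
    Finset.sum_congr rfl fun y₂ _ => Finset.sum_congr rfl fun y₃ _ => ?_
  have h := e.left_inv (cb, y₁, y₂, y₃)
  have h1 := congrArg (fun x => G x.1 x.2.1 x.2.2.1 x.2.2.2) h
  refine Eq.trans ?_ (congrArg (_ * ·) h1.symm)
  rw [← mul_assoc]
  refine congrArg (· * _) ?_
  rw [prodWeight, prodWeight, ← Finset.prod_mul_distrib]
  exact Finset.prod_congr rfl fun i _ => by simp [e, sentDist, stepDist, channel, mul_assoc]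

variable (hp₁ : p₁ ∈ stdSimplex ℝ (ZMod q)) (hp₂ : p₂ ∈ stdSimplex ℝ (ZMod q))
  (hw : w ∈ stdSimplex ℝ V) (hκ : ∀ v, κ v ∈ stdSimplex ℝ (ZMod q))
  (hW : ∀ x₁ x₂ x₃, W x₁ x₂ x₃ ∈ stdSimplex ℝ Y)
  (hZ₁ : pZ₁ ∈ stdSimplex ℝ (ZMod q)) (hZ₂ : pZ₂ ∈ stdSimplex ℝ (ZMod q))

/-- A bound for the average error probability of random codes. -/
def codingBound (J : Outcome q V Y → ℝ) (k₁ k₂ k₃ k₄ : ℕ) (t₁ t₂ t₁₂ t₃ t₄ : ℝ) (n : ℕ) : ℝ :=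
  (failProb J X₁ Y₃ (fun ω => (X₂ ω, X₃ ω)) t₁ n + failProb J X₂ Y₃ (fun ω => (X₁ ω, X₃ ω)) t₂ n +
    failProb J (fun ω => (X₁ ω, X₂ ω)) Y₃ X₃ t₁₂ n +
    failProb J X₃ (fun ω => X₃ ω + Z₁ ω) aux t₃ n +
    failProb J aux (fun ω => X₃ ω + Z₁ ω) (fun _ => ()) t₄ n +
    failProb J aux (fun ω => X₃ ω + Z₁ ω + Z₂ ω) (fun _ => ()) t₄ n) +
  ((k₁ - 1) * 2 ^ (-(n * t₁)) + (k₂ - 1) * 2 ^ (-(n * t₂)) +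
    (k₁ - 1) * ((k₂ - 1) * 2 ^ (-(n * t₁₂))) + (k₃ - 1) * 2 ^ (-(n * t₃)) +
    (k₄ - 1) * 2 ^ (-(n * t₄)) + (k₄ - 1) * 2 ^ (-(n * t₄)))

/-- A message is decoded wrongly by the code `codebookCode`. -/
def DecodesWrong [NeZero k₁] [NeZero k₂] [NeZero k₃] [NeZero k₄] (J : Outcome q V Y → ℝ)
    (t₁ t₂ t₁₂ t₃ t₄ : ℝ) (m₁ : Fin k₁) (m₂ : Fin k₂) (m₃ : Fin k₃) (m₄ : Fin k₄)
    (cb : Fin n → Letter q V k₁ k₂ k₃ k₄) (y₁ y₂ : Fin n → ZMod q) (y₃ : Fin n → Y) : Prop :=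
  (Classical.epsilon (Accepts₃ J t₁ t₂ t₁₂ cb m₃ m₄ y₃)).1 ≠ m₁ ∨
  (Classical.epsilon (Accepts₃ J t₁ t₂ t₁₂ cb m₃ m₄ y₃)).2 ≠ m₂ ∨
  (Classical.epsilon (Accepts₁ J t₃ t₄ cb m₁ y₁)).1 ≠ m₃ ∨
  Classical.epsilon (Accepts₂ J t₄ cb m₂ y₂) ≠ m₄

/-- Averaging over codebooks before messages turns the error probability into that of n independent
copies of a codebook letter with its noise. -/
theorem sum_errorProb_codebookCode [NeZero k₁] [NeZero k₂] [NeZero k₃] [NeZero k₄]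
    (J : Outcome q V Y → ℝ) (t₁ t₂ t₁₂ t₃ t₄ : ℝ) :
    ∑ cb : Fin n → Letter q V k₁ k₂ k₃ k₄, prodWeight (letterWeight p₁ p₂ w κ) cb *
      (codebookCode J t₁ t₂ t₁₂ t₃ t₄ cb).errorProb W pZ₁ pZ₂ =
    1 / ((k₁ : ℝ) * k₂ * k₃ * k₄) * ∑ m₁ : Fin k₁, ∑ m₂ : Fin k₂, ∑ m₃ : Fin k₃, ∑ m₄ : Fin k₄,
      prob (prodWeight (sentDist W pZ₁ pZ₂ p₁ p₂ w κ m₁ m₂ m₃ m₄)) fun c : Fin n → _ =>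
        DecodesWrong J t₁ t₂ t₁₂ t₃ t₄ m₁ m₂ m₃ m₄ (fun i => (c i).1)
      (fun i => (c i).1.1 m₁ + ((c i).1.2.2 m₄).2 m₃ + (c i).2.2.1)
      (fun i => (c i).1.2.1 m₂ + ((c i).1.2.2 m₄).2 m₃ + (c i).2.2.1 + (c i).2.2.2)
      (fun i => (c i).2.1) := by
  classical
  have h := fun m₁ m₂ m₃ m₄ => sum_codebook_eq (W := W) (pZ₁ := pZ₁) (pZ₂ := pZ₂) (p₁ := p₁)
    (p₂ := p₂) (w := w) (κ := κ) m₁ m₂ m₃ m₄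
    fun (cb : Fin n → Letter q V k₁ k₂ k₃ k₄) y₁ y₂ y₃ =>
      if DecodesWrong J t₁ t₂ t₁₂ t₃ t₄ m₁ m₂ m₃ m₄ cb y₁ y₂ y₃ then (1 : ℝ) else 0
  have e1 : ∀ cb : Fin n → Letter q V k₁ k₂ k₃ k₄,
      (codebookCode J t₁ t₂ t₁₂ t₃ t₄ cb).errorProb W pZ₁ pZ₂ =
      1 / ((k₁ : ℝ) * k₂ * k₃ * k₄) * ∑ m : Fin k₁ × Fin k₂ × Fin k₃ × Fin k₄, ∑ y₁, ∑ y₂, ∑ y₃,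
        (∏ i, channel W pZ₁ pZ₂ ((cb i).1 m.1) ((cb i).2.1 m.2.1)
          (((cb i).2.2 m.2.2.2).2 m.2.2.1) (y₁ i) (y₂ i) (y₃ i)) *
        if DecodesWrong J t₁ t₂ t₁₂ t₃ t₄ m.1 m.2.1 m.2.2.1 m.2.2.2 cb y₁ y₂ y₃ then (1 : ℝ)
        else 0 := by
    intro cb
    simp only [Code.errorProb, Code.outputProb, codebookCode]
    rw [Fintype.sum_prod_type]
    simp only [Fintype.sum_prod_type (α₂ := Fin k₃ × Fin k₄),
      Fintype.sum_prod_type (α₁ := Fin k₃) (α₂ := Fin k₄)]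
    refine congrArg _ (Finset.sum_congr rfl fun m₁ _ => Finset.sum_congr rfl fun m₂ _ =>
      Finset.sum_congr rfl fun m₃ _ => Finset.sum_congr rfl fun m₄ _ =>
      Finset.sum_congr rfl fun y₁ _ => Finset.sum_congr rfl fun y₂ _ =>
      Finset.sum_congr rfl fun y₃ _ => ?_)
    exact ite_eq_mul_ite Iff.rfl _
  simp only [e1, mul_left_comm (prodWeight _ _), ← Finset.mul_sum]
  refine congrArg _ ?_
  have e2 : ∀ (F : (Fin n → Letter q V k₁ k₂ k₃ k₄) → Fin k₁ × Fin k₂ × Fin k₃ × Fin k₄ → ℝ),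
      ∑ cb, prodWeight (letterWeight p₁ p₂ w κ) cb * ∑ m, F cb m =
      ∑ m, ∑ cb, prodWeight (letterWeight p₁ p₂ w κ) cb * F cb m := fun F => by
    simp only [Finset.mul_sum]
    exact Finset.sum_comm
  rw [e2]
  simp only [h, Fintype.sum_prod_type (α₁ := Fin k₁), Fintype.sum_prod_type (α₁ := Fin k₂),
    Fintype.sum_prod_type (α₁ := Fin k₃)]
  rfl

include hp₁ hp₂ hw hκ hW hZ₁ hZ₂

/-- Each test guards against one kind of wrong pair: only the first message wrong, only the second,
or both. In each case the union bound needs just the matching test. -/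
theorem prob_wrong₃_le [NeZero k₁] [NeZero k₂] {J : Outcome q V Y → ℝ}
    (hJ : J = jointDist (prodInput p₁ p₂ (mixInput w κ)) W pZ₁ pZ₂)
    (t₁ t₂ t₁₂ : ℝ) (m₁ : Fin k₁) (m₂ : Fin k₂) (m₃ : Fin k₃) (m₄ : Fin k₄) :
    prob (prodWeight (sentDist W pZ₁ pZ₂ p₁ p₂ w κ m₁ m₂ m₃ m₄)) (fun c : Fin n → _ =>
      Classical.epsilon (Accepts₃ J t₁ t₂ t₁₂ (fun i => (c i).1) m₃ m₄ fun i => (c i).2.1) ≠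
        (m₁, m₂)) ≤
    failProb J X₁ Y₃ (fun ω => (X₂ ω, X₃ ω)) t₁ n + (failProb J X₂ Y₃ (fun ω => (X₁ ω, X₃ ω)) t₂ n +
    (failProb J (fun ω => (X₁ ω, X₂ ω)) Y₃ X₃ t₁₂ n + ((k₁ - 1) * 2 ^ (-(n * t₁)) +
    ((k₂ - 1) * 2 ^ (-(n * t₂)) + (k₁ - 1) * ((k₂ - 1) * 2 ^ (-(n * t₁₂))))))) := by
  subst hJ
  have hQ0 : ∀ c, 0 ≤ prodWeight (ι := Fin n) (sentDist W pZ₁ pZ₂ p₁ p₂ w κ m₁ m₂ m₃ m₄) c :=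
    fun c => Finset.prod_nonneg fun i _ => sentDist_nonneg hp₁ hp₂ hw hκ hW hZ₁ hZ₂ m₁ m₂ m₃ m₄ _
  rw [← prob_fail_eq hp₁ hp₂ hw hκ m₁ m₂ m₃ m₄ X₁ Y₃ (fun ω => (X₂ ω, X₃ ω)) t₁ n,
    ← prob_fail_eq hp₁ hp₂ hw hκ m₁ m₂ m₃ m₄ X₂ Y₃ (fun ω => (X₁ ω, X₃ ω)) t₂ n,
    ← prob_fail_eq hp₁ hp₂ hw hκ m₁ m₂ m₃ m₄ (fun ω => (X₁ ω, X₂ ω)) Y₃ X₃ t₁₂ n,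
    ← card_erase_mul_le m₁, ← card_erase_mul_le m₂, ← card_erase_mul_le m₁, ← card_erase_mul_le m₂]
  refine le_trans (prob_mono hQ0 ?_) ((prob_or_le hQ0 _ _).trans (add_le_add_right
    ((prob_or_le hQ0 _ _).trans (add_le_add_right ((prob_or_le hQ0 _ _).trans (add_le_add_right
    ((prob_or_le hQ0 _ _).trans (add_le_add (prob_exists_le hQ0 _ _ fun a ha =>
      prob_pass_le hp₁ hp₂ hw hκ hW hZ₁ hZ₂ m₁ m₂ m₃ m₄ X₁ Y₃ (fun ω => (X₂ ω, X₃ ω)) t₁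
        (fun l => l.1 a) (fun _ => p₁) (kernel_X₁ hp₁ hp₂ hw hκ hW hZ₁ hZ₂)
        (sum_sent₁ hp₁ hp₂ hw hκ (Finset.ne_of_mem_erase ha) m₂ m₃ m₄) n)
      ((prob_or_le hQ0 _ _).trans (add_le_add (prob_exists_le hQ0 _ _ fun b hb =>
      prob_pass_le hp₁ hp₂ hw hκ hW hZ₁ hZ₂ m₁ m₂ m₃ m₄ X₂ Y₃ (fun ω => (X₁ ω, X₃ ω)) t₂
        (fun l => l.2.1 b) (fun _ => p₂) (kernel_X₂ hp₁ hp₂ hw hκ hW hZ₁ hZ₂)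
        (sum_sent₂ hp₁ hp₂ hw hκ m₁ (Finset.ne_of_mem_erase hb) m₃ m₄) n)
      (prob_exists_le hQ0 _ _ fun a ha => prob_exists_le hQ0 _ _ fun b hb =>
      prob_pass_le hp₁ hp₂ hw hκ hW hZ₁ hZ₂ m₁ m₂ m₃ m₄ (fun ω => (X₁ ω, X₂ ω)) Y₃ X₃ t₁₂
        (fun l => (l.1 a, l.2.1 b)) (fun _ a => p₁ a.1 * p₂ a.2)
        (kernel_X₁₂ hp₁ hp₂ hw hκ hW hZ₁ hZ₂)
        (sum_sent₁₂ hp₁ hp₂ hw hκ (Finset.ne_of_mem_erase ha) (Finset.ne_of_mem_erase hb)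
          m₃ m₄) n))))) _)) _)) _))
  -- Outside the six bad events the true pair is accepted and no other pair is, so the choice
  -- operator must return it.
  intro c hc
  by_contra hcon
  simp only [not_or, not_not, not_exists, not_and, Finset.mem_erase, Finset.mem_univ,
    and_true] at hcon
  obtain ⟨f1, f2, f12, h1, h2, h12⟩ := hcon
  refine hc (epsilon_eq_of_forall ⟨f1, f2, f12⟩ ?_)
  rintro ⟨a, b⟩ ⟨g1, g2, g12⟩
  by_cases ha : a = m₁
  · by_cases hb : b = m₂
    · rw [ha, hb]
    · subst ha
      exact (h2 b hb g2).elim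
  · by_cases hb : b = m₂
    · subst hb
      exact (h1 a ha g1).elim
    · exact (h12 a ha b hb g12).elim

/-- User 1 subtracts its own input and observes X₃ + Z₁. A wrong center is caught by the first test
whatever the satellite, so only k₄ - 1 centers count; a wrong satellite in the true cloud is caught
by the second test. -/
theorem prob_wrong₁_le [NeZero k₃] [NeZero k₄] {J : Outcome q V Y → ℝ}
    (hJ : J = jointDist (prodInput p₁ p₂ (mixInput w κ)) W pZ₁ pZ₂)
    (t₃ t₄ : ℝ) (m₁ : Fin k₁) (m₂ : Fin k₂) (m₃ : Fin k₃) (m₄ : Fin k₄) :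
    prob (prodWeight (sentDist W pZ₁ pZ₂ p₁ p₂ w κ m₁ m₂ m₃ m₄)) (fun c : Fin n → _ =>
      Classical.epsilon (Accepts₁ J t₃ t₄ (fun i => (c i).1) m₁ fun i =>
        (c i).1.1 m₁ + ((c i).1.2.2 m₄).2 m₃ + (c i).2.2.1) ≠ (m₃, m₄)) ≤
    failProb J X₃ (fun ω => X₃ ω + Z₁ ω) aux t₃ n +
    (failProb J aux (fun ω => X₃ ω + Z₁ ω) (fun _ => ()) t₄ n +
    ((k₃ - 1) * 2 ^ (-(n * t₃)) + (k₄ - 1) * 2 ^ (-(n * t₄)))) := by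
  subst hJ
  have hQ0 : ∀ c, 0 ≤ prodWeight (ι := Fin n) (sentDist W pZ₁ pZ₂ p₁ p₂ w κ m₁ m₂ m₃ m₄) c :=
    fun c => Finset.prod_nonneg fun i _ => sentDist_nonneg hp₁ hp₂ hw hκ hW hZ₁ hZ₂ m₁ m₂ m₃ m₄ _
  rw [← prob_fail_eq hp₁ hp₂ hw hκ m₁ m₂ m₃ m₄ X₃ (fun ω => X₃ ω + Z₁ ω) aux t₃ n,
    ← prob_fail_eq hp₁ hp₂ hw hκ m₁ m₂ m₃ m₄ aux (fun ω => X₃ ω + Z₁ ω) (fun _ => ()) t₄ n,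
    ← card_erase_mul_le m₃, ← card_erase_mul_le m₄]
  refine le_trans (prob_mono hQ0 ?_) ((prob_or_le hQ0 _ _).trans (add_le_add_right
    ((prob_or_le hQ0 _ _).trans (add_le_add_right
    ((prob_or_le hQ0 _ _).trans (add_le_add (prob_exists_le hQ0 _ _ fun a ha =>
      prob_pass_le hp₁ hp₂ hw hκ hW hZ₁ hZ₂ m₁ m₂ m₃ m₄ X₃ (fun ω => X₃ ω + Z₁ ω) aux t₃
        (fun l => (l.2.2 m₄).2 a) κ (kernel_X₃ hp₁ hp₂ hw hκ hW hZ₁ hZ₂)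
        (sum_sent_satellite hp₁ hp₂ hw hκ m₁ m₂ (Finset.ne_of_mem_erase ha) m₄) n)
      (prob_exists_le hQ0 _ _ fun b hb =>
      prob_pass_le hp₁ hp₂ hw hκ hW hZ₁ hZ₂ m₁ m₂ m₃ m₄ aux (fun ω => X₃ ω + Z₁ ω)
        (fun _ => ()) t₄ (fun l => (l.2.2 b).1) (fun _ => w)
        (kernel_aux hp₁ hp₂ hw hκ hW hZ₁ hZ₂)
        (sum_sent_center hp₁ hp₂ hw hκ m₁ m₂ m₃ (Finset.ne_of_mem_erase hb)) n))) _)) _))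
  intro c hc
  by_contra hcon
  simp only [not_or, not_not, not_exists, not_and, Finset.mem_erase, Finset.mem_univ,
    and_true] at hcon
  obtain ⟨f3, f4, h3, h4⟩ := hcon
  have hy : ∀ i, (c i).1.1 m₁ + ((c i).1.2.2 m₄).2 m₃ + (c i).2.2.1 - (c i).1.1 m₁ =
      ((c i).1.2.2 m₄).2 m₃ + (c i).2.2.1 := fun i => by ring
  refine hc (epsilon_eq_of_forall ?_ ?_)
  · simp only [Accepts₁, hy]
    exact ⟨f4, f3⟩
  · rintro ⟨a, b⟩ hab
    simp only [Accepts₁, hy] at hab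
    by_cases hb : b = m₄
    · by_cases ha : a = m₃
      · rw [ha, hb]
      · subst hb
        exact (h3 a ha hab.2).elim
    · exact (h4 b hb hab.1).elim

theorem prob_wrong₂_le [NeZero k₄] {J : Outcome q V Y → ℝ}
    (hJ : J = jointDist (prodInput p₁ p₂ (mixInput w κ)) W pZ₁ pZ₂)
    (t₄ : ℝ) (m₁ : Fin k₁) (m₂ : Fin k₂) (m₃ : Fin k₃) (m₄ : Fin k₄) :
    prob (prodWeight (sentDist W pZ₁ pZ₂ p₁ p₂ w κ m₁ m₂ m₃ m₄)) (fun c : Fin n → _ =>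
      Classical.epsilon (Accepts₂ J t₄ (fun i => (c i).1) m₂ fun i =>
        (c i).1.2.1 m₂ + ((c i).1.2.2 m₄).2 m₃ + (c i).2.2.1 + (c i).2.2.2) ≠ m₄) ≤
    failProb J aux (fun ω => X₃ ω + Z₁ ω + Z₂ ω) (fun _ => ()) t₄ n +
      (k₄ - 1) * 2 ^ (-(n * t₄)) := by
  subst hJ
  have hQ0 : ∀ c, 0 ≤ prodWeight (ι := Fin n) (sentDist W pZ₁ pZ₂ p₁ p₂ w κ m₁ m₂ m₃ m₄) c :=
    fun c => Finset.prod_nonneg fun i _ => sentDist_nonneg hp₁ hp₂ hw hκ hW hZ₁ hZ₂ m₁ m₂ m₃ m₄ _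
  rw [← prob_fail_eq hp₁ hp₂ hw hκ m₁ m₂ m₃ m₄ aux (fun ω => X₃ ω + Z₁ ω + Z₂ ω) (fun _ => ()) t₄ n,
    ← card_erase_mul_le m₄]
  refine le_trans (prob_mono hQ0 ?_) ((prob_or_le hQ0 _ _).trans (add_le_add_right
      (prob_exists_le hQ0 _ _ fun b hb =>
      prob_pass_le hp₁ hp₂ hw hκ hW hZ₁ hZ₂ m₁ m₂ m₃ m₄ aux (fun ω => X₃ ω + Z₁ ω + Z₂ ω)
        (fun _ => ()) t₄ (fun l => (l.2.2 b).1) (fun _ => w)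
        (kernel_aux hp₁ hp₂ hw hκ hW hZ₁ hZ₂)
        (sum_sent_center hp₁ hp₂ hw hκ m₁ m₂ m₃ (Finset.ne_of_mem_erase hb)) n) _))
  intro c hc
  by_contra hcon
  simp only [not_or, not_not, not_exists, not_and, Finset.mem_erase, Finset.mem_univ,
    and_true] at hcon
  obtain ⟨f4, h4⟩ := hcon
  have hy : ∀ i, (c i).1.2.1 m₂ + ((c i).1.2.2 m₄).2 m₃ + (c i).2.2.1 + (c i).2.2.2 -
      (c i).1.2.1 m₂ = ((c i).1.2.2 m₄).2 m₃ + (c i).2.2.1 + (c i).2.2.2 := fun i => by ring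
  refine hc (epsilon_eq_of_forall ?_ ?_)
  · simp only [Accepts₂, hy]
    exact f4
  · intro b hab
    simp only [Accepts₂, hy] at hab
    by_contra hb
    exact h4 b hb hab

theorem prob_decodesWrong_le [NeZero k₁] [NeZero k₂] [NeZero k₃] [NeZero k₄]
    {J : Outcome q V Y → ℝ} (hJ : J = jointDist (prodInput p₁ p₂ (mixInput w κ)) W pZ₁ pZ₂)
    (t₁ t₂ t₁₂ t₃ t₄ : ℝ) (m₁ : Fin k₁) (m₂ : Fin k₂) (m₃ : Fin k₃) (m₄ : Fin k₄) :
    prob (prodWeight (sentDist W pZ₁ pZ₂ p₁ p₂ w κ m₁ m₂ m₃ m₄)) (fun c : Fin n → _ =>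
        DecodesWrong J t₁ t₂ t₁₂ t₃ t₄ m₁ m₂ m₃ m₄ (fun i => (c i).1)
      (fun i => (c i).1.1 m₁ + ((c i).1.2.2 m₄).2 m₃ + (c i).2.2.1)
      (fun i => (c i).1.2.1 m₂ + ((c i).1.2.2 m₄).2 m₃ + (c i).2.2.1 + (c i).2.2.2)
      (fun i => (c i).2.1)) ≤ codingBound J k₁ k₂ k₃ k₄ t₁ t₂ t₁₂ t₃ t₄ n := by
  have hQ0 : ∀ c, 0 ≤ prodWeight (ι := Fin n) (sentDist W pZ₁ pZ₂ p₁ p₂ w κ m₁ m₂ m₃ m₄) c :=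
    fun c => Finset.prod_nonneg fun i _ => sentDist_nonneg hp₁ hp₂ hw hκ hW hZ₁ hZ₂ m₁ m₂ m₃ m₄ _
  have h3 := prob_wrong₃_le (n := n) hp₁ hp₂ hw hκ hW hZ₁ hZ₂ hJ t₁ t₂ t₁₂ m₁ m₂ m₃ m₄
  have h1 := prob_wrong₁_le (n := n) hp₁ hp₂ hw hκ hW hZ₁ hZ₂ hJ t₃ t₄ m₁ m₂ m₃ m₄
  have h2 := prob_wrong₂_le (n := n) hp₁ hp₂ hw hκ hW hZ₁ hZ₂ hJ t₄ m₁ m₂ m₃ m₄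
  refine le_trans (prob_mono hQ0 ?_) ((prob_or_le hQ0 _ _).trans ((add_le_add h3
    ((prob_or_le hQ0 _ _).trans (add_le_add h1 h2))).trans (le_of_eq ?_)))
  · rintro c (h | h | h | h)
    · exact Or.inl fun e => h (congrArg Prod.fst e)
    · exact Or.inl fun e => h (congrArg Prod.snd e)
    · exact Or.inr (Or.inl fun e => h (congrArg Prod.fst e))
    · exact Or.inr (Or.inr h)
  · rw [codingBound]
    ring

/-- The random coding bound. -/
theorem exists_code_errorProb_le (hk₁ : 0 < k₁) (hk₂ : 0 < k₂) (hk₃ : 0 < k₃) (hk₄ : 0 < k₄)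
    {J : Outcome q V Y → ℝ} (hJ : J = jointDist (prodInput p₁ p₂ (mixInput w κ)) W pZ₁ pZ₂)
    (t₁ t₂ t₁₂ t₃ t₄ : ℝ) : ∃ c : Code q Y n k₁ k₂ k₃ k₄,
      c.errorProb W pZ₁ pZ₂ ≤ codingBound J k₁ k₂ k₃ k₄ t₁ t₂ t₁₂ t₃ t₄ n := by
  have := NeZero.of_pos hk₁
  have := NeZero.of_pos hk₂
  have := NeZero.of_pos hk₃
  have := NeZero.of_pos hk₄
  have hL := prodWeight_mem_stdSimplex (ι := Fin n) (letterWeight_mem_stdSimplex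
    (k₁ := k₁) (k₂ := k₂) (k₃ := k₃) (k₄ := k₄) hp₁ hp₂ hw hκ)
  -- If every code exceeded the bound, so would the mean over random codebooks; a codebook of
  -- positive weight makes the inequality strict.
  by_contra! hcon
  have h1 : ∑ cb : Fin n → Letter q V k₁ k₂ k₃ k₄, prodWeight (letterWeight p₁ p₂ w κ) cb *
      (codebookCode J t₁ t₂ t₁₂ t₃ t₄ cb).errorProb W pZ₁ pZ₂ ≤
      codingBound J k₁ k₂ k₃ k₄ t₁ t₂ t₁₂ t₃ t₄ n := by
    rw [sum_errorProb_codebookCode]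
    have h₁' : (0 : ℝ) < k₁ := by exact_mod_cast hk₁
    have h₂' : (0 : ℝ) < k₂ := by exact_mod_cast hk₂
    have h₃' : (0 : ℝ) < k₃ := by exact_mod_cast hk₃
    have h₄' : (0 : ℝ) < k₄ := by exact_mod_cast hk₄
    refine (mul_le_mul_of_nonneg_left (Finset.sum_le_sum fun m₁ _ => Finset.sum_le_sum fun m₂ _ =>
      Finset.sum_le_sum fun m₃ _ => Finset.sum_le_sum fun m₄ _ =>
      prob_decodesWrong_le hp₁ hp₂ hw hκ hW hZ₁ hZ₂ hJ t₁ t₂ t₁₂ t₃ t₄ m₁ m₂ m₃ m₄)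
      (by positivity)).trans (le_of_eq ?_)
    simp only [Finset.sum_const, Finset.card_univ, Fintype.card_fin, nsmul_eq_mul]
    field_simp
  obtain ⟨cb, -, hcb⟩ := Finset.exists_ne_zero_of_sum_ne_zero (hL.2.trans_ne one_ne_zero)
  have h2 : ∑ cb : Fin n → Letter q V k₁ k₂ k₃ k₄, prodWeight (letterWeight p₁ p₂ w κ) cb *
      codingBound J k₁ k₂ k₃ k₄ t₁ t₂ t₁₂ t₃ t₄ n <
      ∑ cb : Fin n → Letter q V k₁ k₂ k₃ k₄, prodWeight (letterWeight p₁ p₂ w κ) cb *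
      (codebookCode J t₁ t₂ t₁₂ t₃ t₄ cb).errorProb W pZ₁ pZ₂ :=
    Finset.sum_lt_sum (fun cb _ => mul_le_mul_of_nonneg_left (hcon _).le (hL.1 cb))
      ⟨cb, Finset.mem_univ _, mul_lt_mul_of_pos_left (hcon _) ((hL.1 cb).lt_of_ne' hcb)⟩
  rw [← Finset.sum_mul, hL.2, one_mul] at h2
  exact (h1.trans_lt h2).false

end RandomCode

/-! ### Achievability -/

section Thresholds

open Filter

theorem messageCount_zero (n : ℕ) : messageCount n 0 = 1 := by simp [messageCount]

theorem tendsto_two_rpow_neg {δ : ℝ} (hδ : 0 < δ) :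
    Tendsto (fun n : ℕ => (2 : ℝ) ^ (-(n * δ))) atTop (𝓝 0) := by
  have h : ∀ n : ℕ, (2 : ℝ) ^ (-(n * δ)) = ((2 : ℝ) ^ (-δ)) ^ n := fun n => by
    rw [← Real.rpow_natCast, ← Real.rpow_mul two_pos.le]
    ring_nf
  simp only [h]
  exact tendsto_pow_atTop_nhds_zero_of_lt_one (Real.rpow_nonneg two_pos.le _)
    (Real.rpow_lt_one_of_one_lt_of_neg one_lt_two (neg_lt_zero.2 hδ))

theorem messageCount_sub_one_nonneg (n : ℕ) {R : ℝ} (hR : 0 ≤ R) :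
    (0 : ℝ) ≤ messageCount n R - 1 := by
  have : (1 : ℝ) ≤ messageCount n R := by exact_mod_cast messageCount_pos n hR
  linarith

theorem messageCount_sub_one_le (n : ℕ) (R : ℝ) :
    (messageCount n R : ℝ) - 1 ≤ 2 ^ ((n : ℝ) * R) := by
  have := Nat.floor_le (Real.rpow_nonneg (two_pos (α := ℝ)).le ((n : ℝ) * R))
  rw [messageCount]
  linarith

/-- The midpoint of R and I leaves the exponent -(I - R)/2. At rate 0 there is a single message,
hence no wrong one, and any t below I works even if I = 0. -/
theorem exists_threshold {R I : ℝ} (hR : 0 ≤ R) (h : R = 0 ∨ R < I) : ∃ t < I,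
    Tendsto (fun n : ℕ => ((messageCount n R : ℝ) - 1) * 2 ^ (-(n * t))) atTop (𝓝 0) := by
  obtain rfl | h := h
  · exact ⟨I - 1, sub_one_lt I, by simp [messageCount_zero]⟩
  · refine ⟨(R + I) / 2, by linarith, squeeze_zero (fun n => mul_nonneg
      (messageCount_sub_one_nonneg n hR) (Real.rpow_nonneg two_pos.le _)) (fun n => ?_)
      (tendsto_two_rpow_neg (δ := (I - R) / 2) (by linarith))⟩
    refine (mul_le_mul_of_nonneg_right (messageCount_sub_one_le n R)
      (Real.rpow_nonneg two_pos.le _)).trans (le_of_eq ?_)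
    rw [← Real.rpow_add two_pos]
    ring_nf

theorem exists_threshold_add {R R' I : ℝ} (hR : 0 ≤ R) (hR' : 0 ≤ R')
    (h : R = 0 ∨ R' = 0 ∨ R + R' < I) : ∃ t < I,
    Tendsto (fun n : ℕ => ((messageCount n R : ℝ) - 1) *
      (((messageCount n R' : ℝ) - 1) * 2 ^ (-(n * t)))) atTop (𝓝 0) := by
  obtain rfl | rfl | h := h
  · exact ⟨I - 1, sub_one_lt I, by simp [messageCount_zero]⟩
  · exact ⟨I - 1, sub_one_lt I, by simp [messageCount_zero]⟩
  · refine ⟨(R + R' + I) / 2, by linarith, squeeze_zero (fun n => mul_nonneg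
      (messageCount_sub_one_nonneg n hR) (mul_nonneg (messageCount_sub_one_nonneg n hR')
      (Real.rpow_nonneg two_pos.le _))) (fun n => ?_)
      (tendsto_two_rpow_neg (δ := (I - R - R') / 2) (by linarith))⟩
    refine (mul_le_mul (messageCount_sub_one_le n R) (mul_le_mul_of_nonneg_right
      (messageCount_sub_one_le n R') (Real.rpow_nonneg two_pos.le _)) (mul_nonneg
      (messageCount_sub_one_nonneg n hR') (Real.rpow_nonneg two_pos.le _))
      (Real.rpow_nonneg two_pos.le _)).trans (le_of_eq ?_)
    rw [← Real.rpow_add two_pos, ← Real.rpow_add two_pos]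
    ring_nf

end Thresholds

section Achievability

open Outcome Filter

variable {q : ℕ} [NeZero q] {Y V : Type*} [Fintype Y] [Fintype V]
  {W : ZMod q → ZMod q → ZMod q → Y → ℝ} {pZ₁ pZ₂ : ZMod q → ℝ}

theorem Code.errorProb_nonneg (hW : ∀ x₁ x₂ x₃, W x₁ x₂ x₃ ∈ stdSimplex ℝ Y)
    (hZ₁ : pZ₁ ∈ stdSimplex ℝ (ZMod q)) (hZ₂ : pZ₂ ∈ stdSimplex ℝ (ZMod q)) {n k₁ k₂ k₃ k₄ : ℕ}
    (c : Code q Y n k₁ k₂ k₃ k₄) : 0 ≤ c.errorProb W pZ₁ pZ₂ := by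
  refine mul_nonneg (by positivity) (Finset.sum_nonneg fun m₁ _ => Finset.sum_nonneg fun m₂ _ =>
    Finset.sum_nonneg fun m₃ _ => Finset.sum_nonneg fun m₄ _ => Finset.sum_nonneg fun y₁ _ =>
    Finset.sum_nonneg fun y₂ _ => Finset.sum_nonneg fun y₃ _ => ?_)
  split_ifs
  · exact Finset.prod_nonneg fun i _ => mul_nonneg (mul_nonneg ((hW _ _ _).1 _) (hZ₁.1 _)) (hZ₂.1 _)
  · exact le_rfl

theorem condEnt_Z₂ {p : ZMod q × ZMod q × ZMod q × V → ℝ} (hp : p ∈ stdSimplex ℝ _)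
    (hW : ∀ x₁ x₂ x₃, W x₁ x₂ x₃ ∈ stdSimplex ℝ Y)
    (hZ₁ : pZ₁ ∈ stdSimplex ℝ (ZMod q)) (hZ₂ : pZ₂ ∈ stdSimplex ℝ (ZMod q))
    {γ : Type*} [Fintype γ] (f : V → ZMod q → γ) :
    condEnt (jointDist p W pZ₁ pZ₂) Z₂ (fun ω => f (aux ω) (X₃ ω + Z₁ ω)) = entropy pZ₂ := by
  refine condEnt_eq_entropy (jointDist_mem_stdSimplex hp hW hZ₁ hZ₂) hZ₂.2 fun F => ?_
  rw [sum_jointDist_mul, sum_jointDist_mul]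
  simp only [aux, X₃, Z₁, Z₂, ← Finset.sum_mul, hZ₂.2, one_mul]

/-- Data processing: adjoining the independent noise Z₂ to X₃ + Z₁ adds no information about V, and
the observation of user 2 is a function of the pair. Hence a center that user 2 can decode is
decodable by user 1. -/
theorem condMutualInfo_aux_le {p : ZMod q × ZMod q × ZMod q × V → ℝ} (hp : p ∈ stdSimplex ℝ _)
    (hW : ∀ x₁ x₂ x₃, W x₁ x₂ x₃ ∈ stdSimplex ℝ Y)
    (hZ₁ : pZ₁ ∈ stdSimplex ℝ (ZMod q)) (hZ₂ : pZ₂ ∈ stdSimplex ℝ (ZMod q)) :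
    condMutualInfo (jointDist p W pZ₁ pZ₂) aux (fun ω => X₃ ω + Z₁ ω + Z₂ ω) (fun _ => ()) ≤
      condMutualInfo (jointDist p W pZ₁ pZ₂) aux (fun ω => X₃ ω + Z₁ ω) (fun _ => ()) := by
  have hJ := jointDist_mem_stdSimplex hp hW hZ₁ hZ₂
  have e1 := condEnt_Z₂ hp hW hZ₁ hZ₂ fun _ s => ((), s)
  have e2 := condEnt_Z₂ hp hW hZ₁ hZ₂ fun v s => ((v, ()), s)
  generalize jointDist p W pZ₁ pZ₂ = J at hJ e1 e2 ⊢
  have h := condMutualInfo_chain hJ.1 (aux : Outcome q V Y → V) (U := fun ω => X₃ ω + Z₁ ω)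
    (B := Z₂) (U' := fun ω => (X₃ ω + Z₁ ω, Z₂ ω)) (fun _ => ()) Prod.mk id (fun _ => rfl)
    fun _ _ => rfl
  rw [e1, e2, sub_self, add_zero] at h
  rw [← h, condMutualInfo_eq_condEnt' hJ.1, condMutualInfo_eq_condEnt' hJ.1]
  have h' := condEnt_le_of_comp hJ (aux : Outcome q V Y → V)
    (C := fun ω => ((X₃ ω + Z₁ ω, Z₂ ω), ())) (C' := fun ω => (X₃ ω + Z₁ ω + Z₂ ω, ()))
    (fun u => (u.1.1 + u.1.2, ())) fun _ => rfl
  linarith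

/-- Shrinking by s < 1 makes each rate strictly smaller than its bound or equal to 0, and these are
the two cases in which a threshold exists. -/
theorem isAchievable_smul (hW : ∀ x₁ x₂ x₃, W x₁ x₂ x₃ ∈ stdSimplex ℝ Y)
    (hZ₁ : pZ₁ ∈ stdSimplex ℝ (ZMod q)) (hZ₂ : pZ₂ ∈ stdSimplex ℝ (ZMod q)) {p₁ p₂ : ZMod q → ℝ}
    (hp₁ : p₁ ∈ stdSimplex ℝ (ZMod q)) (hp₂ : p₂ ∈ stdSimplex ℝ (ZMod q)) {r : V × ZMod q → ℝ}
    (hr : r ∈ stdSimplex ℝ (V × ZMod q)) {R : Rates}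
    (hR : R ∈ rateRegion (prodInput p₁ p₂ r) W pZ₁ pZ₂) {s : ℝ} (hs0 : 0 ≤ s) (hs1 : s < 1) :
    IsAchievable W pZ₁ pZ₂ (s • R) := by
  -- Superposition coding draws the centers from the law of V and the satellites from the
  -- conditional law of X₃.
  obtain ⟨w, κ, hw, hκ, rfl⟩ : ∃ (w : V → ℝ) (κ : V → ZMod q → ℝ), w ∈ stdSimplex ℝ V ∧
      (∀ v, κ v ∈ stdSimplex ℝ (ZMod q)) ∧ r = mixInput w κ := by
    obtain ⟨κ, hκ, hrκ⟩ := exists_disintegration hr Prod.fst Prod.snd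
    refine ⟨law r Prod.fst, κ, law_mem_stdSimplex hr _, hκ, funext fun u => ?_⟩
    exact (congrFun (law_id r) u).symm.trans (hrκ u.1 u.2)
  obtain ⟨R₁, R₂, R₃, R₄⟩ := R
  obtain ⟨⟨h₁, h₂, h₃, h₄⟩, b₁, b₂, b₁₂, b₃, b₄⟩ := hR
  have hp := prodInput_mem_stdSimplex hp₁ hp₂ hr
  have hJm := jointDist_mem_stdSimplex hp hW hZ₁ hZ₂
  have hdp := condMutualInfo_aux_le hp hW hZ₁ hZ₂
  rw [mutualInfo_eq_condMutualInfo hJm] at b₄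
  set J := jointDist (prodInput p₁ p₂ (mixInput w κ)) W pZ₁ pZ₂ with hJ
  have key : ∀ {x I : ℝ}, 0 ≤ x → x ≤ I → s * x = 0 ∨ s * x < I := by
    intro x I hx hI
    rcases hx.eq_or_lt with rfl | hx
    · exact Or.inl (mul_zero s)
    · exact Or.inr (lt_of_lt_of_le (by nlinarith) hI)
  obtain ⟨t₁, ht₁, l₁⟩ := exists_threshold (mul_nonneg hs0 h₁) (key h₁ b₁)
  obtain ⟨t₂, ht₂, l₂⟩ := exists_threshold (mul_nonneg hs0 h₂) (key h₂ b₂)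
  obtain ⟨t₃, ht₃, l₃⟩ := exists_threshold (mul_nonneg hs0 h₃) (key h₃ b₃)
  obtain ⟨t₄, ht₄, l₄⟩ := exists_threshold (mul_nonneg hs0 h₄) (key h₄ b₄)
  obtain ⟨t₁₂, ht₁₂, l₁₂⟩ := exists_threshold_add (mul_nonneg hs0 h₁) (mul_nonneg hs0 h₂)
    (I := condMutualInfo J (fun ω => (X₁ ω, X₂ ω)) Y₃ X₃) (by
      rcases key (add_nonneg h₁ h₂) b₁₂ with h | h
      · rcases mul_eq_zero.1 h with h | h
        · exact Or.inl (by rw [h, zero_mul])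
        · exact Or.inl (by rw [show R₁ = 0 by linarith, mul_zero])
      · exact Or.inr (Or.inr (by linarith)))
  choose c hc using fun n => exists_code_errorProb_le (n := n) hp₁ hp₂ hw hκ hW hZ₁ hZ₂
    (messageCount_pos n (mul_nonneg hs0 h₁)) (messageCount_pos n (mul_nonneg hs0 h₂))
    (messageCount_pos n (mul_nonneg hs0 h₃)) (messageCount_pos n (mul_nonneg hs0 h₄)) hJ
    t₁ t₂ t₁₂ t₃ t₄
  refine ⟨⟨mul_nonneg hs0 h₁, mul_nonneg hs0 h₂, mul_nonneg hs0 h₃, mul_nonneg hs0 h₄⟩, c,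
    squeeze_zero (fun n => (c n).errorProb_nonneg hW hZ₁ hZ₂) hc ?_⟩
  -- The threshold t₄ is below the information of user 2 about V, hence by `hdp` also below that of
  -- user 1, and serves both receivers.
  have h := ((((((tendsto_failProb hJm X₁ Y₃ _ ht₁).add (tendsto_failProb hJm X₂ Y₃ _ ht₂)).add
    (tendsto_failProb hJm _ Y₃ X₃ ht₁₂)).add (tendsto_failProb hJm X₃ _ aux ht₃)).add
    (tendsto_failProb hJm aux _ _ (ht₄.trans_le hdp))).add (tendsto_failProb hJm aux _ _ ht₄)).add
    (((((l₁.add l₂).add l₁₂).add l₃).add l₄).add l₄)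
  simpa only [add_zero, codingBound] using h

theorem uniformInputRegion_subset_capacityRegion
    (hW : ∀ x₁ x₂ x₃, W x₁ x₂ x₃ ∈ stdSimplex ℝ Y)
    (hZ₁ : pZ₁ ∈ stdSimplex ℝ (ZMod q)) (hZ₂ : pZ₂ ∈ stdSimplex ℝ (ZMod q)) :
    uniformInputRegion W pZ₁ pZ₂ ⊆ capacityRegion W pZ₁ pZ₂ := by
  refine closure_minimal (convexHull_min ?_ (convex_convexHull _ _).closure) isClosed_closure
  rintro R ⟨k, -, r, hr, hR⟩
  -- Boundary points are limits of achievable points s • R as s increases to 1.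
  have hlim : Tendsto (fun s : ℝ => s • R) (𝓝[<] 1) (𝓝 R) := by
    have : Tendsto (fun s : ℝ => s • R) (𝓝 1) (𝓝 ((1 : ℝ) • R)) :=
      (continuous_id.smul continuous_const).tendsto 1
    rw [one_smul] at this
    exact this.mono_left nhdsWithin_le_nhds
  refine mem_closure_of_tendsto hlim ?_
  filter_upwards [Ioo_mem_nhdsLT (zero_lt_one' ℝ)] with s hs
  exact subset_convexHull ℝ _ (isAchievable_smul hW hZ₁ hZ₂ unif_mem_stdSimplex
    unif_mem_stdSimplex hr hR hs.1.le hs.2)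

end Achievability

end MADB

end

/-! ### The regions coincide. -/

theorem theorem15 {q : ℕ} [NeZero q] (hq : 2 ≤ q) {Y : Type*} [Fintype Y]
    (W : ZMod q → ZMod q → ZMod q → Y → ℝ)
    (hW : ∀ x₁ x₂ x₃, W x₁ x₂ x₃ ∈ stdSimplex ℝ Y)
    (pZ₁ pZ₂ : ZMod q → ℝ)
    (hZ₁ : pZ₁ ∈ stdSimplex ℝ (ZMod q)) (hZ₂ : pZ₂ ∈ stdSimplex ℝ (ZMod q))
    (h₁ : ∀ a b : ZMod q, ∃ π : Equiv.Perm Y, ∀ x₁ x₂ x₃ y,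
      W x₁ x₂ x₃ y = W (Equiv.swap a b x₁) x₂ x₃ (π y))
    (h₂ : ∀ a b : ZMod q, ∃ π : Equiv.Perm Y, ∀ x₁ x₂ x₃ y,
      W x₁ x₂ x₃ y = W x₁ (Equiv.swap a b x₂) x₃ (π y)) :
    MADB.innerBound W pZ₁ pZ₂ = MADB.outerBound W pZ₁ pZ₂ ∧
    MADB.capacityRegion W pZ₁ pZ₂ = MADB.innerBound W pZ₁ pZ₂ ∧
    MADB.capacityRegion W pZ₁ pZ₂ = MADB.uniformInputRegion W pZ₁ pZ₂ := by
  have hM := MADB.isSymmetricMac_of_swap hW h₁ h₂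
  have hui := MADB.uniformInputRegion_subset_innerBound (W := W) (pZ₁ := pZ₁) (pZ₂ := pZ₂)
  have hio := MADB.innerBound_subset_outerBound (W := W) (pZ₁ := pZ₁) (pZ₂ := pZ₂)
  have hou := MADB.outerBound_subset_uniformInputRegion hM hZ₁ hZ₂
  have hcu := MADB.capacityRegion_subset_uniformInputRegion hM hZ₁ hZ₂
  have huc := MADB.uniformInputRegion_subset_capacityRegion hW hZ₁ hZ₂
  exact ⟨hio.antisymm (hou.trans hui), (hcu.trans hui).antisymm ((hio.trans hou).trans huc),
    hcu.antisymm huc⟩
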